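/- **Setting.** Let $n\ge 1$ and write $B(y,r)=\{x\in\mathbb R^n:|x-y|<r\}$. A *weight* is a positive (a.e.), locally integrable function $w$ on $\mathbb R^n$; put $w(E)=\int_E w(x)\,dx$. We write $w\in A_1$ if there is $C$ with $\frac{w(B)}{|B|}\le C\,\operatorname{ess\,inf}_B w$ for every ball $B$, and $\mu\in\Delta_2$ if there is $C$ with $\mu(B(y,2r))\le C\,\mu(B(y,r))$ for all $y\in\mathbb R^n$, $r>0$. Let $\|f\|_{L^1_w}=\int|f|\,w\,dx$ and $\|f\|_{WL^1_w}=\sup_{\lambda>0}\lambda\, w(\{|f|>\lambda\})$. For $1\le\alpha\le q\le\infty$ and weights $w,\mu$, the space $(L^1,L^q)^\alpha(w;\mu)$ consists of the locally integrable functions $f:\mathbb R^n\to\mathbb C$ with $$\|f\|_{(L^1,L^q)^\alpha(w;\mu)}:=\sup_{r>0}\Big\|\,w(B(y,r))^{1/\alpha-1-1/q}\,\big\|f\chi_{B(y,r)}\big\|_{L^1_w}\Big\|_{L^q(\mu(y)\,dy)}<\infty ,$$ and $(WL^1,L^q)^\alpha(w;\mu)$ consists of the measurable functions $f$ for which the same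 expression with $\|\cdot\|_{WL^1_w}$ in place of $\|\cdot\|_{L^1_w}$, denoted $\|f\|_{(WL^1,L^q)^\alpha(w;\mu)}$, is finite. Let $\theta$ be a non-negative, non-decreasing function on $(0,\infty)$ with $\int_0^1\theta(t)\,\frac{dt}{t}<\infty$. A *$\theta$-type kernel* is a measurable function $K$ on $\{(x,y)\in\mathbb R^n\times\mathbb R^n:x\ne y\}$ such that, for some constant $C$, $|K(x,y)|\le C|x-y|^{-n}$ for $x\neq y$, and $$|K(x,y)-K(z,y)|+|K(y,x)-K(y,z)|\le \frac{C}{|x-y|^n}\,\theta\Big(\frac{|x-z|}{|x-y|}\Big)\quad\text{for } 0<|x-z|<\tfrac12|x-y| .$$ A *$\theta$-type Calderón–Zygmund operator* is a linear operator $T_\theta:\mathscr S(\mathbb R^n)\to\mathscr S'(\mathbb R^n)$ that extends to a bounded linear operator on $L^2(\mathbb R^n)$ (again denoted $T_\theta$) and for which there is a $\theta$-type kernel $K$ with $T_\theta f(x)=\int K(x,y)f(y)\,dy$ for all $f\in C_0^\infty(\mathbb R^n)$ and almost every $x\notin\operatorname{supp}f$. For $w\in A_1$ and a locally integrable function $f$,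 we say that a measurable function $g$ is *a value of $T_\theta$ at $f$*, written $g=T_\theta f$, if for every ball $B=B(y,r)$, with $2B=B(y,2r)$, we have $f\chi_{2B}\in L^1_w$ and there is a measurable function $h_B$ such that * $T_\theta\varphi_k\to h_B$ in $WL^1_w$ for every sequence $\varphi_k\in L^2(\mathbb R^n)$ with $\|\varphi_k-f\chi_{2B}\|_{L^1_w}\to0$ (so $h_B$ is the image of $f\chi_{2B}$ under the continuous extension of $T_\theta$ from $L^1_w$ to $WL^1_w$), and * for almost every $x\in B$, the integral $\int_{(2B)^c}K(x,z)f(z)\,dz$ converges absolutely and $g(x)=h_B(x)+\int_{(2B)^c}K(x,z)f(z)\,dz$. **Theorem 2.2.** Let $1\le\alpha<q\le\infty$, $w\in A_1$ and $\mu\in\Delta_2$, and let $T_\theta$ be a $\theta$-type Calderón–Zygmund operator. Then $T_\theta$ is a well-defined bounded linear operator from $(L^1,L^q)^\alpha(w;\mu)$ into $(WL^1,L^q)^\alpha(w;\mu)$. That is: 1. There is a constant $C$, independent of $f$, such that every $f\in(L^1,L^q)^\alpha(w;\mu)$ has a value $T_\theta f$, which is unique up to equality almost everywhere, belongs to $(WL^1,L^q)^\alpha(w;\mu)$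 and satisfies $$\|T_\theta f\|_{(WL^1,L^q)^\alpha(w;\mu)}\le C\,\|f\|_{(L^1,L^q)^\alpha(w;\mu)} .$$ 2. The operator so defined is linear: if $g_1,g_2$ are values of $T_\theta$ at $f_1,f_2\in(L^1,L^q)^\alpha(w;\mu)$ and $c\in\mathbb C$, then $cg_1+g_2$ is a value of $T_\theta$ at $cf_1+f_2$. 3. It agrees with the given operator on $L^2(\mathbb R^n)\cap(L^1,L^q)^\alpha(w;\mu)$: for $f$ in this intersection, the $L^2$-image of $f$ is a value of $T_\theta$ at $f$. -/

import Mathlib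

open MeasureTheory Metric Filter Topology Set
open scoped ENNReal NNReal SchwartzMap

noncomputable section

namespace Amalgam

/-- The Euclidean space `ℝⁿ` with the Euclidean norm and Lebesgue measure. -/
abbrev Rn (n : ℕ) : Type := EuclideanSpace ℝ (Fin n)

/-- The Hilbert space `L²(ℝⁿ)` of complex-valued functions. -/
abbrev L2 (n : ℕ) : Type := Lp ℂ 2 (volume : Measure (Rn n))

variable {n : ℕ}

/-! ### Weights -/

/-- A weight: a locally integrable function that is positive almost everywhere. -/
structure IsWeight (w : Rn n → ℝ) : Prop where
  pos : ∀ᵐ x, 0 < w x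
  locallyIntegrable : LocallyIntegrable w

/-- The measure `w(x) dx`. -/
def wMeas (w : Rn n → ℝ) : Measure (Rn n) :=
  volume.withDensity fun x => ENNReal.ofReal (w x)

/-- The Muckenhoupt class `A₁`: weights `w` with `w(B) / |B| ≤ C · ess inf_B w` for all balls. -/
def IsA1 (w : Rn n → ℝ) : Prop :=
  IsWeight w ∧ ∃ C : ℝ≥0, ∀ (y : Rn n) (r : ℝ), 0 < r →
    wMeas w (ball y r) / volume (ball y r) ≤
      C * essInf (fun x => ENNReal.ofReal (w x)) (volume.restrict (ball y r))

/-- The class `Δ₂` of doubling weights: `w(2B) ≤ C · w(B)` for all balls. -/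
def IsDoubling (w : Rn n → ℝ) : Prop :=
  IsWeight w ∧ ∃ C : ℝ≥0, ∀ (y : Rn n) (r : ℝ), 0 < r →
    wMeas w (ball y (2 * r)) ≤ C * wMeas w (ball y r)

/-! ### Weighted amalgam spaces -/

/-- The weak Lebesgue quasi-norm `sup_{λ > 0} λ · ν({|f| > λ})^{1/p}`
(the value `λ = 0` contributes `0`). -/
def weakNorm (p : ℝ≥0) (ν : Measure (Rn n)) (f : Rn n → ℂ) : ℝ≥0∞ :=
  ⨆ t : ℝ≥0, t * ν {x | (t : ℝ≥0∞) < ‖f x‖ₑ} ^ (1 / (p : ℝ))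

/-- The factor `w(B(y,r))^{1/α - 1/p - 1/q}`, with `1/∞ = 0`. -/
def ballFactor (p : ℝ≥0) (q α : ℝ≥0∞) (w : Rn n → ℝ) (y : Rn n) (r : ℝ) : ℝ≥0∞ :=
  wMeas w (ball y r) ^ ((α⁻¹).toReal - 1 / (p : ℝ) - (q⁻¹).toReal)

/-- The norm of `(L^p, L^q)^α(w; μ)`:
`sup_{r > 0} ‖ w(B(y,r))^{1/α-1/p-1/q} ‖f χ_{B(y,r)}‖_{L^p_w} ‖_{L^q_μ(dy)}`. -/
def amalgamNorm (p : ℝ≥0) (q α : ℝ≥0∞) (w μ : Rn n → ℝ) (f : Rn n → ℂ) : ℝ≥0∞ :=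
  ⨆ (r : ℝ) (_ : 0 < r),
    eLpNorm (fun y => ballFactor p q α w y r * eLpNorm ((ball y r).indicator f) p (wMeas w))
      q (wMeas μ)

/-- The norm of `(WL^p, L^q)^α(w; μ)`. -/
def weakAmalgamNorm (p : ℝ≥0) (q α : ℝ≥0∞) (w μ : Rn n → ℝ) (f : Rn n → ℂ) : ℝ≥0∞ :=
  ⨆ (r : ℝ) (_ : 0 < r),
    eLpNorm (fun y => ballFactor p q α w y r * weakNorm p (wMeas w) ((ball y r).indicator f))
      q (wMeas μ)

/-- Membership in `(L^p, L^q)^α(w; μ)`. -/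
def MemAmalgam (p : ℝ≥0) (q α : ℝ≥0∞) (w μ : Rn n → ℝ) (f : Rn n → ℂ) : Prop :=
  LocallyIntegrable f ∧ amalgamNorm p q α w μ f < ∞

/-- Membership in `(WL^p, L^q)^α(w; μ)`. -/
def MemWeakAmalgam (p : ℝ≥0) (q α : ℝ≥0∞) (w μ : Rn n → ℝ) (f : Rn n → ℂ) : Prop :=
  AEStronglyMeasurable f ∧ weakAmalgamNorm p q α w μ f < ∞

/-! ### Calderón–Zygmund operators of type `θ` -/

/-- `θ` is non-negative and non-decreasing on `(0, ∞)` with `∫₀¹ θ(t)/t dt < ∞`. -/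
structure IsDiniModulus (θ : ℝ → ℝ) : Prop where
  nonneg : ∀ t, 0 < t → 0 ≤ θ t
  mono : MonotoneOn θ (Ioi 0)
  integrable : IntegrableOn (fun t => θ t / t) (Ioo 0 1)

/-- `θ`-type kernels. Since `θ` lives on `(0, ∞)`, the regularity condition is required for
`z ≠ x` (for `z = x` its left-hand side vanishes). Values on the diagonal are irrelevant. -/
structure IsThetaKernel (θ : ℝ → ℝ) (K : Rn n → Rn n → ℂ) : Prop where
  measurable : Measurable fun p : {p : Rn n × Rn n // p.1 ≠ p.2} => K p.1.1 p.1.2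
  bounds : ∃ C : ℝ,
    (∀ x y, x ≠ y → ‖K x y‖ ≤ C / ‖x - y‖ ^ n) ∧
    ∀ x y z, x ≠ z → ‖x - z‖ < ‖x - y‖ / 2 →
      ‖K x y - K z y‖ + ‖K y x - K y z‖ ≤ C / ‖x - y‖ ^ n * θ (‖x - z‖ / ‖x - y‖)

/-- The linear operator `T : 𝓢(ℝⁿ) → 𝓢'(ℝⁿ)` is a `θ`-type Calderón–Zygmund operator; `L` is its
bounded extension to `L²(ℝⁿ)` and `K` its `θ`-type kernel. The Schwartz functions of compact
support are exactly the functions in `C₀^∞(ℝⁿ)`. -/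
structure IsThetaCZO (θ : ℝ → ℝ) (T : 𝓢(Rn n, ℂ) →ₗ[ℂ] 𝓢'(Rn n, ℂ))
    (L : L2 n →L[ℂ] L2 n) (K : Rn n → Rn n → ℂ) : Prop where
  modulus : IsDiniModulus θ
  extends_T : ∀ φ : 𝓢(Rn n, ℂ), T φ = Lp.toTemperedDistribution (L (φ.toLp 2))
  kernel : IsThetaKernel θ K
  representation : ∀ φ : 𝓢(Rn n, ℂ), HasCompactSupport φ →
    ∀ᵐ x, x ∉ tsupport φ → L (φ.toLp 2) x = ∫ y, K x y * φ y

/-- `h` is the image of `f ∈ L¹_w` under the continuous extension `L¹_w → WL¹_w` of the operator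
`L` on `L²`: whenever `φ_k ∈ L²` and `φ_k → f` in `L¹_w`, then `L φ_k → h` in `WL¹_w`. (Such
sequences exist for each `f ∈ L¹_w`, for instance truncations of `f`.) -/
structure IsL1Value (L : L2 n →L[ℂ] L2 n) (w : Rn n → ℝ) (f h : Rn n → ℂ) : Prop where
  memLp : MemLp f 1 (wMeas w)
  measurable : AEStronglyMeasurable h
  tendsto : ∀ φ : ℕ → L2 n,
    Tendsto (fun k => eLpNorm (fun x => φ k x - f x) 1 (wMeas w)) atTop (𝓝 0) →
    Tendsto (fun k => weakNorm 1 (wMeas w) fun x => L (φ k) x - h x) atTop (𝓝 0)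

/-- `g = T f` for a locally integrable `f` that need not lie in a Lebesgue space: on every ball
`B`, `g` is the sum of the image of `f χ_{2B}` under the extension of the operator to `L¹_w` and
of the absolutely convergent integral `∫_{(2B)ᶜ} K(x,z) f(z) dz`. -/
structure IsValue (L : L2 n →L[ℂ] L2 n) (K : Rn n → Rn n → ℂ) (w : Rn n → ℝ)
    (f g : Rn n → ℂ) : Prop where
  measurable : AEStronglyMeasurable g
  onBall : ∀ (y : Rn n) (r : ℝ), 0 < r → ∃ h : Rn n → ℂ,
    IsL1Value L w ((ball y (2 * r)).indicator f) h ∧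
    ∀ᵐ x ∂volume.restrict (ball y r),
      IntegrableOn (fun z => K x z * f z) (ball y (2 * r))ᶜ ∧
      g x = h x + ∫ z in (ball y (2 * r))ᶜ, K x z * f z

end Amalgam

end

noncomputable section

namespace Amalgam

variable {n : ℕ}

/-! ### Dyadic cubes -/

/-! For a ball B let S(B) be the sum over k of the w-averages of |f| over the dilates 2^(k+1)B
(`dilateSum`). The whole bound rests on the local estimate ‖gχ_B‖_{WL¹_w} ≤ C w(B) S(B) for a value
g at f (`IsValue.weakNorm_ball_le`). The near part h_B is handled by the weak type (1,1) inequality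
for w and doubling. The far integral is bounded on B by splitting (2B)ᶜ into annuli, using |K(x,z)|
≤ C|x-z|^(-n), and exchanging Lebesgue averages for w-averages by A₁
(`IsRegularCZO.lintegral_far_le`).

The amalgam norm multiplies this by w(B)^(1/α-1/q-1), so one has to estimate w(B)^s S(B) in L^q(μ)
with s = 1/α - 1/q > 0. Reverse doubling gives w(B) ≤ η^k w(2^k B) with η < 1. The k-th term is
therefore at most η^(sk) times the quantity whose L^q(μ) norm enters the amalgam norm at radius
2^(k+1)r, and Minkowski and a geometric series finish (`exists_eLpNorm_dilateSum_le`). The same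
estimate shows S(B) finite for every ball (`dilateSum_ne_top`). So the far integrals converge
absolutely and f is w-integrable on balls.

The hard ingredient is the weighted weak type inequality (`IsRegularCZO.exists_weighted_weak_type`).
The unweighted one comes from a Calderón–Zygmund decomposition and the Dini condition. To pass to w,
a good-λ argument is run on D_t, the union of the dyadic cubes more than half filled by {|Lφ| > t}.
Let Q be a maximal such cube containing a point where the maximal function of φ is at most γt. The
parent of Q is at most half filled, so it contains a point where Lφ and its local part are both
controlled. Since the far part hardly oscillates, {|Lφ| > (1+κ)t} fills at most a quarter of Q. Then
D_{(1+κ)t} fills at most half of Q, and A₁ gives it at most the share 1-κ of w(Q). Because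
(1+κ)(1-κ) < 1, t·w(D_t) contracts up to the maximal function term. It is finite beforehand for φ of
bounded support, so it can be absorbed. No maximal truncated operator is needed.

Finally the weak type inequality extends L to L¹_w by truncation (`exists_isL1Value`). On nested
balls the two local formulas agree, because their near parts differ by the image of a function
vanishing on the smaller ball, where the kernel represents it (`IsRegularCZO.local_value_eq`).
Gluing over B(0, j+1) gives the value. -/

/-- The index of the dyadic cube of side `2 ^ (-k)` that contains `x`. -/
def dyadicIndex (k : ℤ) (x : Rn n) : Fin n → ℤ := fun i => ⌊x i * 2 ^ k⌋

/-- The dyadic cube of side `2 ^ (-c.1)` with index `c.2`. -/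
def dcube (c : ℤ × (Fin n → ℤ)) : Set (Rn n) := {x | dyadicIndex c.1 x = c.2}

lemma mem_dcube {c : ℤ × (Fin n → ℤ)} {x : Rn n} : x ∈ dcube c ↔ dyadicIndex c.1 x = c.2 := Iff.rfl

lemma mem_dcube_self (k : ℤ) (x : Rn n) : x ∈ dcube (k, dyadicIndex k x) := rfl

/-- The floor of half a number is the integer half of its floor. Hence every cube lies in a single
parent, and the dyadic grids are nested. -/
lemma dyadicIndex_pred (k : ℤ) (x : Rn n) (i : Fin n) :
    dyadicIndex (k - 1) x i = dyadicIndex k x i / 2 := by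
  have h := Int.mul_cast_floor_div_cancel_of_pos (n := 2) (by norm_num) (x i * 2 ^ (k - 1))
  unfold dyadicIndex
  have e : (2 : ℝ) ^ (k - 1) * ((2 : ℤ) : ℝ) = 2 ^ k := by
    rw [zpow_sub_one₀ (by norm_num)]
    push_cast
    ring
  rw [← h, mul_assoc, e]

lemma dyadicIndex_eq_of_le {j k : ℤ} (hjk : j ≤ k) {x y : Rn n}
    (h : dyadicIndex k x = dyadicIndex k y) : dyadicIndex j x = dyadicIndex j y := by
  induction j, hjk using Int.leInductionDown with
  | base => exact h
  | pred j _ ih =>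
    funext i
    rw [dyadicIndex_pred, dyadicIndex_pred, ih]

lemma dcube_subset_of_le {j k : ℤ} (hjk : j ≤ k) (x : Rn n) :
    dcube (k, dyadicIndex k x) ⊆ dcube (j, dyadicIndex j x) := fun _ hy =>
  dyadicIndex_eq_of_le hjk hy

lemma measurableSet_dcube (c : ℤ × (Fin n → ℤ)) : MeasurableSet (dcube c) := by
  have : Measurable (dyadicIndex (n := n) c.1) := by
    refine measurable_pi_lambda _ fun i => Int.measurable_floor.comp ?_
    fun_prop
  exact this (measurableSet_singleton c.2)

lemma volume_dcube (c : ℤ × (Fin n → ℤ)) :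
    volume (dcube c) = ENNReal.ofReal ((2 ^ (-c.1)) ^ n) := by
  have h2 : (0 : ℝ) < 2 ^ c.1 := by positivity
  have hset : dcube c = (MeasurableEquiv.toLp 2 (Fin n → ℝ)).symm ⁻¹'
      (Set.univ.pi fun i => Ico ((c.2 i : ℝ) * 2 ^ (-c.1)) ((c.2 i + 1 : ℝ) * 2 ^ (-c.1))) := by
    ext x
    simp only [mem_dcube, dyadicIndex, funext_iff, mem_preimage, mem_univ_pi, mem_Ico,
      Int.floor_eq_iff, zpow_neg, ← div_eq_mul_inv, div_le_iff₀ h2, lt_div_iff₀ h2]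
    rfl
  rw [hset, (EuclideanSpace.volume_preserving_symm_measurableEquiv_toLp (Fin n)).measure_preimage
    (MeasurableSet.univ_pi fun i => measurableSet_Ico).nullMeasurableSet, Real.volume_pi_Ico]
  simp only [← sub_mul, add_sub_cancel_left, one_mul, Finset.prod_const, Finset.card_univ,
    Fintype.card_fin]
  rw [ENNReal.ofReal_pow (by positivity)]

lemma volume_dcube_ne_zero (c : ℤ × (Fin n → ℤ)) : volume (dcube c) ≠ 0 := by
  rw [volume_dcube]
  simp only [ne_eq, ENNReal.ofReal_eq_zero, not_le]
  positivity

lemma volume_dcube_ne_top (c : ℤ × (Fin n → ℤ)) : volume (dcube c) ≠ ∞ := by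
  rw [volume_dcube]
  exact ENNReal.ofReal_ne_top

lemma volume_dcube_pred (k : ℤ) (m m' : Fin n → ℤ) :
    volume (dcube (k - 1, m)) = 2 ^ n * volume (dcube (k, m')) := by
  rw [volume_dcube, volume_dcube]
  have : (2 : ℝ≥0∞) ^ n = ENNReal.ofReal (2 ^ n) := by
    rw [ENNReal.ofReal_pow (by norm_num)]; norm_num
  rw [this, ← ENNReal.ofReal_mul (by positivity), ← mul_pow]
  congr 2
  simp only [neg_sub]
  rw [sub_eq_add_neg, zpow_add₀ (by norm_num)]
  simp

/-- The dyadic cubes of generation `k` have diameter at most `cubeDiam n k`. -/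
def cubeDiam (n : ℕ) (k : ℤ) : ℝ := n * 2 ^ (-k)

lemma cubeDiam_pos (hn : 0 < n) (k : ℤ) : 0 < cubeDiam n k := by
  unfold cubeDiam
  positivity

lemma dist_le_cubeDiam {c : ℤ × (Fin n → ℤ)} {x y : Rn n} (hx : x ∈ dcube c) (hy : y ∈ dcube c) :
    dist x y ≤ cubeDiam n c.1 := by
  have h2 : (0 : ℝ) < 2 ^ c.1 := by positivity
  have key : ∀ i, |x i - y i| ≤ 2 ^ (-c.1) := by
    intro i
    have h : ⌊x i * 2 ^ c.1⌋ = ⌊y i * 2 ^ c.1⌋ := by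
      have := congrFun ((mem_dcube.1 hx).trans (mem_dcube.1 hy).symm) i
      exact this
    have := Int.abs_sub_lt_one_of_floor_eq_floor h
    rw [← sub_mul, abs_mul, abs_of_pos h2] at this
    rw [zpow_neg, ← one_div, le_div_iff₀ h2]
    exact this.le
  rw [EuclideanSpace.dist_eq]
  have : ∑ i, dist (x i) (y i) ^ 2 ≤ (cubeDiam n c.1) ^ 2 := by
    calc ∑ i, dist (x i) (y i) ^ 2 ≤ ∑ _i : Fin n, ((2 : ℝ) ^ (-c.1)) ^ 2 := by
          gcongr with i
          rw [Real.dist_eq]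
          exact key i
      _ = n * ((2 : ℝ) ^ (-c.1)) ^ 2 := by simp
      -- The sharp diameter has √n; the cruder factor n keeps square roots out of all later
      -- constants.
      _ ≤ (n * n) * ((2 : ℝ) ^ (-c.1)) ^ 2 := by
          gcongr
          exact_mod_cast Nat.le_mul_self n
      _ = _ := by unfold cubeDiam; ring
  exact Real.sqrt_le_iff.2 ⟨by unfold cubeDiam; positivity, this⟩

/-! ### Stopping cubes -/

/-- The maximal dyadic cubes with the property `P`. -/
def stopCubes (P : Set (Rn n) → Prop) : Set (ℤ × (Fin n → ℤ)) :=
  {c | P (dcube c) ∧ (dcube c).Nonempty ∧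
    ∀ j < c.1, ∀ x ∈ dcube c, ¬ P (dcube (j, dyadicIndex j x))}

/-- The union of the dyadic cubes with the property `P`. -/
def dyadicUnion (P : Set (Rn n) → Prop) : Set (Rn n) := {x | ∃ k, P (dcube (k, dyadicIndex k x))}

/-- Two cubes through a common point are nested, and the coarser one would contradict the maximality
of the finer. -/
lemma stopCubes_eq {P : Set (Rn n) → Prop} {c c' : ℤ × (Fin n → ℤ)} (hc : c ∈ stopCubes P)
    (hc' : c' ∈ stopCubes P) {x : Rn n} (hx : x ∈ dcube c) (hx' : x ∈ dcube c') : c = c' := by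
  obtain ⟨k, m⟩ := c
  obtain ⟨k', m'⟩ := c'
  have e : m = dyadicIndex k x := (mem_dcube.1 hx).symm
  have e' : m' = dyadicIndex k' x := (mem_dcube.1 hx').symm
  subst e e'
  rcases lt_trichotomy k k' with h | h | h
  · exact absurd hc.1 (hc'.2.2 k h x hx')
  · rw [h]
  · exact absurd hc'.1 (hc.2.2 k' h x hx)

lemma pairwise_disjoint_stopCubes (P : Set (Rn n) → Prop) :
    Pairwise (Function.onFun Disjoint fun c : stopCubes P => dcube c.1) := by
  intro c c' hne
  refine Set.disjoint_left.2 fun x hx hx' => hne ?_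
  exact Subtype.ext (stopCubes_eq c.2 c'.2 hx hx')

/-- A lower bound on the generations excludes infinite ascending chains, so every cube with the
property lies in a coarsest one. -/
lemma iUnion_stopCubes {P : Set (Rn n) → Prop} (hP : ∃ k₀ : ℤ, ∀ c, P (dcube c) → k₀ ≤ c.1) :
    ⋃ c : stopCubes P, dcube c.1 = dyadicUnion P := by
  ext x
  simp only [mem_iUnion]
  constructor
  · rintro ⟨⟨⟨k, m⟩, hc⟩, hx⟩
    have e : m = dyadicIndex k x := (mem_dcube.1 hx).symm
    subst e
    exact ⟨k, hc.1⟩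
  · rintro ⟨k, hk⟩
    obtain ⟨k₀, hk₀⟩ := hP
    obtain ⟨j, hj, hmin⟩ := Int.exists_least_of_bdd
      (P := fun k => P (dcube (k, dyadicIndex k x))) ⟨k₀, fun z hz => hk₀ _ hz⟩ ⟨k, hk⟩
    refine ⟨⟨(j, dyadicIndex j x), hj, ⟨x, rfl⟩, fun i hi y hy hPy => ?_⟩, rfl⟩
    have : dyadicIndex i y = dyadicIndex i x := dyadicIndex_eq_of_le hi.le hy
    rw [this] at hPy
    exact absurd (hmin i hPy) (not_le.2 hi)

lemma measurableSet_dyadicUnion (P : Set (Rn n) → Prop) : MeasurableSet (dyadicUnion P) := by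
  have : dyadicUnion P = ⋃ c : {c : ℤ × (Fin n → ℤ) // P (dcube c)}, dcube c.1 := by
    ext x
    simp only [mem_iUnion]
    constructor
    · rintro ⟨k, hk⟩
      exact ⟨⟨_, hk⟩, rfl⟩
    · rintro ⟨⟨⟨k, m⟩, hc⟩, hx⟩
      have e : m = dyadicIndex k x := (mem_dcube.1 hx).symm
      subst e
      exact ⟨k, hc⟩
  rw [this]
  exact MeasurableSet.iUnion fun c => measurableSet_dcube _

/-- Dyadic cubes of large volume belong to the coarse generations. -/
lemma exists_generation_bound (hn : 0 < n) {V : ℝ≥0∞} (hV : V ≠ ∞) :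
    ∃ k₀ : ℤ, ∀ c : ℤ × (Fin n → ℤ), volume (dcube c) ≤ V → k₀ ≤ c.1 := by
  obtain ⟨N, hN⟩ := pow_unbounded_of_one_lt V.toReal (one_lt_two : (1 : ℝ) < 2)
  refine ⟨-N, fun c hc => ?_⟩
  by_contra! h
  have h1 : V < volume (dcube c) := by
    rw [volume_dcube, ← ENNReal.ofReal_toReal hV]
    refine (ENNReal.ofReal_lt_ofReal_iff (by positivity)).2 (hN.trans_le ?_)
    have h3 : (2 : ℝ) ^ N ≤ 2 ^ (-c.1) := by
      rw [← zpow_natCast]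
      exact zpow_le_zpow_right₀ (by norm_num) (by omega)
    refine h3.trans (le_self_pow₀ ?_ hn.ne')
    exact one_le_zpow₀ (by norm_num) (by omega)
  exact absurd hc (not_le.2 h1)

/-! ### Balls, doubling and `A₁` measures -/

lemma volume_ball_eq (y : Rn n) {r : ℝ} (hr : 0 < r) :
    volume (ball y r) = ENNReal.ofReal (r ^ n) * volume (ball (0 : Rn n) 1) := by
  rw [Measure.addHaar_ball_of_pos _ _ hr, finrank_euclideanSpace_fin]

lemma volume_ball_mul (x y : Rn n) {r s : ℝ} (hr : 0 < r) (hs : 0 < s) :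
    volume (ball x (s * r)) = ENNReal.ofReal (s ^ n) * volume (ball y r) := by
  rw [volume_ball_eq x (mul_pos hs hr), volume_ball_eq y hr, mul_pow,
    ENNReal.ofReal_mul (by positivity), mul_assoc]

lemma volume_ball_ne_zero (y : Rn n) {r : ℝ} (hr : 0 < r) : volume (ball y r) ≠ 0 :=
  (measure_ball_pos volume y hr).ne'

/-- Measures given by `A₁` weights: `ν(B) |s| ≤ A |B| ν(s)` for measurable subsets `s` of
balls `B`. -/
structure IsA1Measure (ν : Measure (Rn n)) (A : ℝ≥0) : Prop where
  ac : ν ≪ volume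
  pos : ∀ y r, 0 < r → ν (ball y r) ≠ 0
  fin : ∀ y r, ν (ball y r) ≠ ∞
  le : ∀ y r, 0 < r → ∀ s ⊆ ball y r, MeasurableSet s →
    ν (ball y r) * volume s ≤ A * volume (ball y r) * ν s

/-- Stated as an inequality of measures, the condition integrates against arbitrary functions,
measurable or not. -/
lemma IsA1Measure.smul_le {ν : Measure (Rn n)} {A : ℝ≥0} (h : IsA1Measure ν A) (y : Rn n) {r : ℝ}
    (hr : 0 < r) : ν (ball y r) • volume.restrict (ball y r) ≤
      (A * volume (ball y r)) • ν.restrict (ball y r) := by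
  refine Measure.le_iff.2 fun s hs => ?_
  simp only [Measure.smul_apply, smul_eq_mul, Measure.restrict_apply hs]
  exact h.le y r hr _ inter_subset_right (hs.inter measurableSet_ball)

lemma IsA1Measure.lintegral_le {ν : Measure (Rn n)} {A : ℝ≥0} (h : IsA1Measure ν A) (y : Rn n)
    {r : ℝ} (hr : 0 < r) (f : Rn n → ℝ≥0∞) :
    ν (ball y r) * ∫⁻ x in ball y r, f x ≤
      A * volume (ball y r) * ∫⁻ x in ball y r, f x ∂ν := by
  rw [← smul_eq_mul, ← smul_eq_mul (A * volume (ball y r)), ← lintegral_smul_measure,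
    ← lintegral_smul_measure]
  exact lintegral_mono' (h.smul_le y hr) le_rfl

/-- If ν(s) = 0, the A₁ inequality on a unit ball reads ν(B)|s ∩ B| ≤ 0 with ν(B) ≠ 0. Almost
everywhere statements can thus be moved freely between ν and Lebesgue measure. -/
lemma IsA1Measure.ac' {ν : Measure (Rn n)} {A : ℝ≥0} (h : IsA1Measure ν A) :
    volume ≪ ν := by
  refine Measure.AbsolutelyContinuous.mk fun s hs hs0 => ?_
  refine measure_null_of_locally_null s fun x _ => ⟨s ∩ ball x 1,
    inter_mem_nhdsWithin s (ball_mem_nhds x one_pos), ?_⟩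
  have := h.le x 1 one_pos _ inter_subset_right (hs.inter measurableSet_ball)
  rw [measure_mono_null (inter_subset_left : s ∩ ball x 1 ⊆ s) hs0, mul_zero] at this
  exact (mul_eq_zero.1 (le_zero_iff.1 this)).resolve_left (h.pos x 1 one_pos)

lemma IsA1Measure.pos_const {ν : Measure (Rn n)} {A : ℝ≥0} (h : IsA1Measure ν A) : 1 ≤ A := by
  have := h.le 0 1 one_pos _ subset_rfl measurableSet_ball
  rw [mul_comm, mul_assoc] at this
  have h0 := ENNReal.mul_pos (volume_ball_ne_zero (0 : Rn n) one_pos) (h.pos 0 1 one_pos)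
  have ht := ENNReal.mul_ne_top (measure_ball_lt_top (μ := volume) (x := (0 : Rn n)) (r := 1)).ne
    (h.fin 0 1)
  have h2 : (1 : ℝ≥0∞) * (volume (ball (0 : Rn n) 1) * ν (ball 0 1)) ≤
    A * (volume (ball (0 : Rn n) 1) * ν (ball 0 1)) := by rwa [one_mul]
  have := (ENNReal.mul_le_mul_iff_left h0.ne' ht).1 h2
  exact_mod_cast this

/-- Growth of `A₁` measures. -/
lemma IsA1Measure.ball_le {ν : Measure (Rn n)} {A : ℝ≥0} (h : IsA1Measure ν A) {y z : Rn n}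
    {r s : ℝ} (hr : 0 < r) (hs : 0 < s) (hsub : ball z r ⊆ ball y (s * r)) :
    ν (ball y (s * r)) ≤ A * ENNReal.ofReal (s ^ n) * ν (ball z r) := by
  have := h.le y (s * r) (mul_pos hs hr) _ hsub measurableSet_ball
  rw [volume_ball_mul y z hr hs, ← mul_assoc, mul_right_comm, ] at this
  refine (ENNReal.mul_le_mul_iff_left (volume_ball_ne_zero z hr)
    (measure_ball_lt_top).ne).1 this

lemma IsA1Measure.doubling {ν : Measure (Rn n)} {A : ℝ≥0} (h : IsA1Measure ν A) (y : Rn n)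
    {r : ℝ} (hr : 0 < r) : ν (ball y (2 * r)) ≤ A * 2 ^ n * ν (ball y r) := by
  have := h.ball_le hr two_pos (ball_subset_ball (x := y) (by linarith : r ≤ 2 * r))
  rwa [ENNReal.ofReal_pow (by norm_num), ENNReal.ofReal_ofNat] at this

/-- If `s` fills a fixed part of a set `Q` of finite measure, then its complement in `Q` has
`ν`-measure at most `(1 - 1/(2A)) ν(Q)`. -/
lemma measure_diff_le_of_half {ν : Measure (Rn n)} {A : ℝ≥0} (hA : 1 ≤ A) {Q s : Set (Rn n)}
    (hs : MeasurableSet s) (hsQ : s ⊆ Q) (hQ0 : volume Q ≠ 0)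
    (hQt : volume Q ≠ ∞) (hνQ : ν Q ≠ ∞)
    (hle : ν Q * volume (Q \ s) ≤ A * volume Q * ν (Q \ s))
    (hhalf : volume s ≤ volume Q / 2) :
    ν s ≤ (1 - 1 / (2 * A) : ℝ≥0) * ν Q := by
  have hνs : ν s ≠ ∞ := ne_top_of_le_ne_top hνQ (measure_mono hsQ)
  have e1 : ν Q = ν s + ν (Q \ s) := by
    rw [← measure_inter_add_sdiff Q hs, inter_eq_self_of_subset_right hsQ]
  have e2 : volume Q = volume s + volume (Q \ s) := by
    rw [← measure_inter_add_sdiff Q hs, inter_eq_self_of_subset_right hsQ]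
  have hνd : ν (Q \ s) ≠ ∞ := ne_top_of_le_ne_top hνQ (measure_mono sdiff_subset)
  have hvd : volume (Q \ s) ≠ ∞ := ne_top_of_le_ne_top hQt (measure_mono sdiff_subset)
  have hvs : volume s ≠ ∞ := ne_top_of_le_ne_top hQt (measure_mono hsQ)
  generalize ν Q = a at *
  generalize ν s = b at *
  generalize ν (Q \ s) = c at *
  generalize volume Q = p at *
  generalize volume s = q at *
  generalize volume (Q \ s) = t at *
  lift a to ℝ≥0 using hνQ
  lift b to ℝ≥0 using hνs
  lift c to ℝ≥0 using hνd
  lift p to ℝ≥0 using hQt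
  lift q to ℝ≥0 using hvs
  lift t to ℝ≥0 using hvd
  have h2 : (p : ℝ≥0∞) / 2 = ((p / 2 : ℝ≥0) : ℝ≥0∞) := by
    rw [ENNReal.coe_div (by norm_num)]; rfl
  rw [h2] at hhalf
  norm_cast at *
  rw [← NNReal.coe_le_coe] at *
  rw [← NNReal.coe_inj] at *
  have hsub : ((1 - 1 / (2 * A) : ℝ≥0) : ℝ) = 1 - 1 / (2 * A) := by
    rw [NNReal.coe_sub]
    · push_cast; ring
    · have hA0 : (0 : ℝ≥0) < A := lt_of_lt_of_le one_pos (by exact_mod_cast hA)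
      rw [div_le_iff₀ (by positivity), one_mul]
      calc (1 : ℝ≥0) ≤ 2 * 1 := by norm_num
        _ ≤ 2 * A := by gcongr; exact_mod_cast hA
  push_cast at *
  rw [hsub]
  have hp : (0 : ℝ) < p := lt_of_le_of_ne p.coe_nonneg (Ne.symm (by exact_mod_cast hQ0))
  have hA' : (1 : ℝ) ≤ A := hA
  -- The complement has at least half the volume, so the A₁ inequality gives it at least the share
  -- 1/(2A) of ν(Q).
  have ht : (p : ℝ) / 2 ≤ t := by linarith
  have h3 : (a : ℝ) * (p / 2) ≤ A * p * c :=
    (mul_le_mul_of_nonneg_left ht a.coe_nonneg).trans hle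
  have h4 : (a : ℝ) / (2 * A) ≤ c := by
    rw [div_le_iff₀ (by positivity)]
    have : (a : ℝ) * p ≤ (c * (2 * A)) * p := by linarith
    exact le_of_mul_le_mul_right this hp
  have : (1 - 1 / (2 * (A : ℝ))) * a = a - a / (2 * A) := by ring
  rw [this]
  linarith

/-- Reverse doubling. -/
lemma IsA1Measure.exists_reverse_doubling (hn : 0 < n) {ν : Measure (Rn n)} {A : ℝ≥0}
    (h : IsA1Measure ν A) : ∃ η : ℝ≥0, η < 1 ∧ ∀ y r, 0 < r →
      ν (ball y r) ≤ η * ν (ball y (2 * r)) := by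
  refine ⟨1 - 1 / (2 * A), ?_, fun y r hr => ?_⟩
  · have := h.pos_const
    refine tsub_lt_self one_pos (by positivity)
  · refine measure_diff_le_of_half h.pos_const measurableSet_ball
      (ball_subset_ball (by linarith)) (volume_ball_ne_zero y (by positivity))
      measure_ball_lt_top.ne (h.fin _ _)
      (h.le y _ (by positivity) _ sdiff_subset (measurableSet_ball.diff measurableSet_ball)) ?_
    -- The ball fills the fraction 2^(-n) of its double, which is at most 1/2 because n ≥ 1.
    rw [ENNReal.le_div_iff_mul_le (by simp) (by simp), volume_ball_mul y y hr two_pos, mul_comm]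
    gcongr
    rw [← ENNReal.ofReal_ofNat]
    gcongr
    exact le_self_pow₀ (by norm_num) hn.ne'

/-- A Muckenhoupt weight gives an `A₁` measure. -/
lemma IsA1.exists_isA1Measure {w : Rn n → ℝ} (hw : IsA1 w) : ∃ A, IsA1Measure (wMeas w) A := by
  obtain ⟨⟨hpos, hloc⟩, C, hC⟩ := hw
  have hm : AEMeasurable (fun x => ENNReal.ofReal (w x)) volume :=
    hloc.aestronglyMeasurable.aemeasurable.ennreal_ofReal
  have hfin : ∀ y r, wMeas w (ball y r) ≠ ∞ := by
    intro y r
    rw [wMeas, withDensity_apply _ measurableSet_ball]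
    have h1 : IntegrableOn w (ball y r) :=
      (hloc.integrableOn_isCompact (isCompact_closedBall y r)).mono_set ball_subset_closedBall
    exact (h1.lintegral_lt_top).ne
  have hpos' : ∀ y r, 0 < r → wMeas w (ball y r) ≠ 0 := by
    intro y r hr h0
    rw [wMeas, withDensity_apply _ measurableSet_ball, lintegral_eq_zero_iff' hm.restrict] at h0
    have : ∀ᵐ x ∂(volume.restrict (ball y r)), False := by
      filter_upwards [h0, ae_restrict_of_ae hpos] with x hx hx'
      simp only [Pi.zero_apply, ENNReal.ofReal_eq_zero] at hx
      linarith
    rw [ae_iff] at this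
    simp only [not_false_eq_true, ofPred_true, Measure.restrict_apply_univ] at this
    exact volume_ball_ne_zero y hr this
  refine ⟨C, withDensity_absolutelyContinuous _ _, hpos', hfin, fun y r hr s hs hsm => ?_⟩
  have h1 := hC y r hr
  have hv0 := volume_ball_ne_zero y hr
  have hvt := (measure_ball_lt_top (μ := volume) (x := y) (r := r)).ne
  set e := essInf (fun x => ENNReal.ofReal (w x)) (volume.restrict (ball y r)) with he
  -- The essential infimum over the ball bounds w from below almost everywhere on s.
  have h2 : e * volume s ≤ wMeas w s := by
    rw [wMeas, withDensity_apply _ hsm, ← setLIntegral_const]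
    refine lintegral_mono_ae ?_
    refine ae_mono (Measure.restrict_mono hs le_rfl) ?_
    exact ae_essInf_le
  rw [ENNReal.div_le_iff hv0 hvt] at h1
  calc wMeas w (ball y r) * volume s ≤ (C * e * volume (ball y r)) * volume s := by gcongr
    _ = C * volume (ball y r) * (e * volume s) := by ring
    _ ≤ _ := by gcongr

/-- The `A₁` condition passes from balls to dyadic cubes. -/
lemma IsA1Measure.exists_dcube_le (hn : 0 < n) {ν : Measure (Rn n)} {A : ℝ≥0}
    (h : IsA1Measure ν A) : ∃ A' : ℝ≥0, 1 ≤ A' ∧ ∀ c : ℤ × (Fin n → ℤ), ∀ s ⊆ dcube c,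
      MeasurableSet s → ν (dcube c) * volume s ≤ A' * volume (dcube c) * ν s := by
  -- The second entry is A times the volume ratio of a ball of radius twice `cubeDiam` to the cube.
  -- The maximum with 1 is for the later use of 1 - 1/(2A').
  refine ⟨max 1 (A * ((2 * n) ^ n * (volume (ball (0 : Rn n) 1)).toNNReal)), le_max_left _ _,
    fun c s hs hsm => ?_⟩
  rcases s.eq_empty_or_nonempty with rfl | ⟨x, hx⟩
  · simp
  have hd := cubeDiam_pos hn c.1
  have hsub : dcube c ⊆ ball x (2 * cubeDiam n c.1) := fun y hy => by
    rw [mem_ball]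
    exact (dist_le_cubeDiam hy (hs hx)).trans_lt (by linarith)
  have h1 := h.le x (2 * cubeDiam n c.1) (by positivity) s (hs.trans hsub) hsm
  have h2 : volume (ball x (2 * cubeDiam n c.1)) =
      ((2 * n) ^ n * (volume (ball (0 : Rn n) 1)).toNNReal : ℝ≥0) * volume (dcube c) := by
    rw [volume_ball_eq _ (by positivity), volume_dcube]
    push_cast
    rw [ENNReal.coe_toNNReal measure_ball_lt_top.ne, cubeDiam, ← mul_assoc, mul_pow,
      ENNReal.ofReal_mul (by positivity)]
    have : ENNReal.ofReal ((2 * (n : ℝ)) ^ n) = (2 * (n : ℝ≥0∞)) ^ n := by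
      rw [ENNReal.ofReal_pow (by positivity), ENNReal.ofReal_mul (by norm_num)]
      simp
    rw [this]
    ring
  calc ν (dcube c) * volume s ≤ ν (ball x (2 * cubeDiam n c.1)) * volume s := by gcongr
    _ ≤ _ := h1
    _ = (A * ((2 * n) ^ n * (volume (ball (0 : Rn n) 1)).toNNReal) : ℝ≥0) *
        volume (dcube c) * ν s := by rw [h2]; push_cast; ring
    _ ≤ _ := by gcongr; exact le_max_right _ _

lemma IsA1Measure.dcube_ne_top (hn : 0 < n) {ν : Measure (Rn n)} {A : ℝ≥0}
    (h : IsA1Measure ν A) (c : ℤ × (Fin n → ℤ)) : ν (dcube c) ≠ ∞ := by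
  rcases (dcube c).eq_empty_or_nonempty with h0 | ⟨x, hx⟩
  · simp [h0]
  have hsub : dcube c ⊆ ball x (2 * cubeDiam n c.1) := fun y hy => by
    rw [mem_ball]
    exact (dist_le_cubeDiam hy hx).trans_lt (by linarith [cubeDiam_pos hn c.1])
  exact ne_top_of_le_ne_top (h.fin _ _) (measure_mono hsub)

/-! ### Lebesgue differentiation along dyadic cubes -/

lemma tendsto_cubeDiam (hn : 0 < n) :
    Tendsto (fun k : ℕ => cubeDiam n k) atTop (𝓝[>] 0) := by
  refine tendsto_nhdsWithin_iff.2 ⟨?_, Eventually.of_forall fun k => cubeDiam_pos hn _⟩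
  have : Tendsto (fun k : ℕ => (n : ℝ) * (1 / 2) ^ k) atTop (𝓝 (n * 0)) :=
    (tendsto_pow_atTop_nhds_zero_of_lt_one (by norm_num) (by norm_num)).const_mul _
  rw [mul_zero] at this
  refine this.congr fun k => ?_
  simp [cubeDiam]

/-- At almost every point, the dyadic averages of a locally integrable function are eventually
close to its value. -/
lemma ae_dyadic_lintegral_le (hn : 0 < n) {f : Rn n → ℂ} (hf : LocallyIntegrable f) :
    ∀ᵐ x, ∀ ε : ℝ≥0, 0 < ε → ∃ k : ℤ,
      ∫⁻ y in dcube (k, dyadicIndex k x), ‖f y - f x‖ₑ ≤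
        ε * volume (dcube (k, dyadicIndex k x)) := by
  filter_upwards [IsUnifLocDoublingMeasure.ae_tendsto_average_norm_sub (μ := volume) hf 1]
    with x hx ε hε
  have h1 := hx (fun _ : ℕ => x) (fun k : ℕ => cubeDiam n k) (tendsto_cubeDiam hn)
    (Eventually.of_forall fun k => mem_closedBall_self (by
      have := (cubeDiam_pos hn k).le
      positivity))
  -- M is the volume ratio of the ball to the cube it contains, so an average of at most ε/M over
  -- the ball gives at most ε over the cube.
  set M : ℝ≥0 := n ^ n * (volume (closedBall (0 : Rn n) 1)).toNNReal with hM
  have hMpos : 0 < M := by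
    have : 0 < (volume (closedBall (0 : Rn n) 1)).toNNReal :=
      ENNReal.toNNReal_pos (measure_closedBall_pos _ _ one_pos).ne' measure_closedBall_lt_top.ne
    positivity
  obtain ⟨k, hk⟩ := (h1.eventually (gt_mem_nhds (show (0 : ℝ) < ε / M by positivity))).exists
  refine ⟨k, ?_⟩
  have hd := cubeDiam_pos hn k
  set B := closedBall x (cubeDiam n k) with hB
  have hsub : dcube ((k : ℤ), dyadicIndex k x) ⊆ B := fun y hy =>
    dist_le_cubeDiam hy (mem_dcube_self _ _)
  have hvB : volume B = M * volume (dcube ((k : ℤ), dyadicIndex k x)) := by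
    rw [hB, Measure.addHaar_closedBall' _ _ hd.le, volume_dcube, finrank_euclideanSpace_fin, hM]
    push_cast
    rw [ENNReal.coe_toNNReal measure_closedBall_lt_top.ne, cubeDiam, mul_pow,
      ENNReal.ofReal_mul (by positivity)]
    have : ENNReal.ofReal ((n : ℝ) ^ n) = (n : ℝ≥0∞) ^ n := by
      rw [ENNReal.ofReal_pow (by positivity)]
      simp
    rw [this]
    ring
  have hint : IntegrableOn (fun y => f y - f x) B :=
    (hf.integrableOn_isCompact (isCompact_closedBall _ _)).sub
      (integrableOn_const measure_closedBall_lt_top.ne)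
  rw [setAverage_eq, smul_eq_mul] at hk
  have hvpos : 0 < volume.real B := ENNReal.toReal_pos (measure_closedBall_pos _ _ hd).ne'
    measure_closedBall_lt_top.ne
  rw [inv_mul_lt_iff₀ hvpos] at hk
  calc ∫⁻ y in dcube ((k : ℤ), dyadicIndex k x), ‖f y - f x‖ₑ
      ≤ ∫⁻ y in B, ‖f y - f x‖ₑ := lintegral_mono_set hsub
    _ = ENNReal.ofReal (∫ y in B, ‖f y - f x‖) := by
        rw [ofReal_integral_norm_eq_lintegral_enorm hint]
    _ ≤ ENNReal.ofReal (volume.real B * (ε / M)) := ENNReal.ofReal_le_ofReal hk.le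
    _ = _ := by
        rw [ENNReal.ofReal_mul hvpos.le, measureReal_def, ENNReal.ofReal_toReal
          measure_closedBall_lt_top.ne, hvB, ENNReal.ofReal_div_of_pos (by exact_mod_cast hMpos),
          ENNReal.ofReal_coe_nnreal, ENNReal.ofReal_coe_nnreal, mul_right_comm,
          ENNReal.mul_div_cancel (by exact_mod_cast hMpos.ne') ENNReal.coe_ne_top]

/-! ### Integrals over dyadic annuli -/

lemma exists_annulus {R t : ℝ} (hR : 0 < R) (ht : R ≤ t) :
    ∃ k : ℕ, 2 ^ k * R ≤ t ∧ t < 2 ^ (k + 1) * R := by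
  obtain ⟨k, h1, h2⟩ := exists_nat_pow_near ((one_le_div hR).2 ht) (one_lt_two : (1 : ℝ) < 2)
  exact ⟨k, (le_div_iff₀ hR).1 h1, (div_lt_iff₀ hR).1 h2⟩

/-- On the k-th annulus the first factor is at most `a k`, and the annulus is then enlarged to the
ball containing it. Serves for the regularity of the kernel, its square integrability and the far
integral. -/
lemma lintegral_compl_ball_le {ν : Measure (Rn n)} (c : Rn n) {R : ℝ} (hR : 0 < R)
    (G F : Rn n → ℝ≥0∞) (a : ℕ → ℝ≥0)
    (hG : ∀ k x, 2 ^ k * R ≤ dist x c → G x ≤ a k) :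
    ∫⁻ x in (ball c R)ᶜ, G x * F x ∂ν ≤
      ∑' k, a k * ∫⁻ x in ball c (2 ^ (k + 1) * R), F x ∂ν := by
  set A : ℕ → Set (Rn n) := fun k => {x | 2 ^ k * R ≤ dist x c ∧ dist x c < 2 ^ (k + 1) * R}
  have hA : ∀ k, MeasurableSet (A k) := fun k =>
    (measurableSet_le measurable_const (measurable_id.dist measurable_const)).inter
      (measurableSet_lt (measurable_id.dist measurable_const) measurable_const)
  have hcov : (ball c R)ᶜ ⊆ ⋃ k, A k := by
    intro x hx
    simp only [mem_compl_iff, mem_ball, not_lt] at hx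
    obtain ⟨k, hk⟩ := exists_annulus hR hx
    exact mem_iUnion.2 ⟨k, hk⟩
  calc ∫⁻ x in (ball c R)ᶜ, G x * F x ∂ν ≤ ∫⁻ x in ⋃ k, A k, G x * F x ∂ν :=
        lintegral_mono_set hcov
    _ ≤ ∑' k, ∫⁻ x in A k, G x * F x ∂ν := lintegral_iUnion_le _ _
    _ ≤ _ := by
      refine ENNReal.tsum_le_tsum fun k => ?_
      calc ∫⁻ x in A k, G x * F x ∂ν ≤ ∫⁻ x in A k, a k * F x ∂ν := by
            refine setLIntegral_mono' (hA k) fun x hx => ?_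
            gcongr
            exact hG k x hx.1
        _ = a k * ∫⁻ x in A k, F x ∂ν := lintegral_const_mul' _ _ ENNReal.coe_ne_top
        _ ≤ _ := by
          gcongr
          exact fun x hx => hx.2

/-- The integral test: on (2^(-k-2), 2^(-k-1)) monotonicity bounds θ(t)/t below by
θ(2^(-k-2))/2^(-k-1), and the interval has length 2^(-k-2), whence the factor 2. The shift by 2
matches annuli starting at radius 4d. -/
lemma IsDiniModulus.tsum_ne_top {θ : ℝ → ℝ} (h : IsDiniModulus θ) :
    ∑' k : ℕ, ENNReal.ofReal (θ ((1 / 2) ^ (k + 2))) ≠ ∞ := by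
  set I : ℕ → Set ℝ := fun k => Ioo ((1 / 2) ^ (k + 2)) ((1 / 2) ^ (k + 1))
  have hdisj : Pairwise (Function.onFun Disjoint I) := by
    intro i j hij
    wlog hlt : i < j generalizing i j
    · exact (this hij.symm (lt_of_le_of_ne (not_lt.1 hlt) hij.symm)).symm
    refine Set.disjoint_left.2 fun x hx hx' => ?_
    have h1 : x < (1 / 2) ^ (j + 1) := hx'.2
    have h2 : (1 / 2 : ℝ) ^ (j + 1) ≤ (1 / 2) ^ (i + 2) :=
      pow_le_pow_of_le_one (by norm_num) (by norm_num) (by omega)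
    exact absurd hx.1 (not_lt.2 (h1.le.trans h2))
  have hsub : ⋃ k, I k ⊆ Ioo 0 1 := by
    refine iUnion_subset fun k x hx => ⟨lt_trans (by positivity) hx.1, hx.2.trans_le ?_⟩
    exact pow_le_one₀ (by norm_num) (by norm_num)
  have key : ∀ k : ℕ, ENNReal.ofReal (θ ((1 / 2) ^ (k + 2))) ≤
      2 * ∫⁻ t in I k, ENNReal.ofReal (θ t / t) := by
    intro k
    have hp : (0 : ℝ) < (1 / 2) ^ (k + 2) := by positivity
    have h1 : ∫⁻ _t in I k, ENNReal.ofReal (θ ((1 / 2) ^ (k + 2)) / (1 / 2) ^ (k + 1)) ≤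
        ∫⁻ t in I k, ENNReal.ofReal (θ t / t) := by
      refine setLIntegral_mono' measurableSet_Ioo fun t ht => ?_
      have ht0 : 0 < t := hp.trans ht.1
      have := h.mono (mem_Ioi.2 hp) (mem_Ioi.2 ht0) ht.1.le
      have h0 := h.nonneg _ ht0
      have := ht.2.le
      gcongr
    rw [setLIntegral_const, Real.volume_Ioo, ← ENNReal.ofReal_mul (div_nonneg (h.nonneg _ hp)
      (by positivity))] at h1
    calc ENNReal.ofReal (θ ((1 / 2) ^ (k + 2)))
        = 2 * ENNReal.ofReal (θ ((1 / 2) ^ (k + 2)) / (1 / 2) ^ (k + 1) *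
            ((1 / 2) ^ (k + 1) - (1 / 2) ^ (k + 2))) := by
          rw [← ENNReal.ofReal_ofNat, ← ENNReal.ofReal_mul (by norm_num)]
          congr 1
          have : ((1 : ℝ) / 2) ^ (k + 1) ≠ 0 := by positivity
          field_simp
          ring
      _ ≤ _ := by gcongr
  refine ne_top_of_le_ne_top ?_ (ENNReal.tsum_le_tsum key)
  rw [ENNReal.tsum_mul_left, ← lintegral_iUnion (fun k => measurableSet_Ioo) hdisj]
  refine ENNReal.mul_ne_top (by norm_num) (ne_top_of_le_ne_top ?_ (lintegral_mono_set hsub))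
  exact h.integrable.lintegral_lt_top.ne

/-! ### Kernels -/

/-- The kernel `K`, set to zero on the diagonal. -/
def offDiag (K : Rn n → Rn n → ℂ) (x y : Rn n) : ℂ := if x = y then 0 else K x y

lemma offDiag_of_ne (K : Rn n → Rn n → ℂ) {x y : Rn n} (h : x ≠ y) : offDiag K x y = K x y :=
  if_neg h

lemma ae_offDiag_eq (hn : 0 < n) (K : Rn n → Rn n → ℂ) (x : Rn n) :
    ∀ᵐ y, offDiag K x y = K x y := by
  have : Nonempty (Fin n) := ⟨⟨0, hn⟩⟩
  filter_upwards [(compl_mem_ae_iff.2 (measure_singleton x) : {x}ᶜ ∈ ae volume)] with y hy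
  exact offDiag_of_ne K (fun h => hy h.symm)

/-- Joint measurability on the full product, which Tonelli's theorem needs, is obtained by extending
by zero from the complement of the closed diagonal. -/
lemma measurable_offDiag {θ : ℝ → ℝ} {K : Rn n → Rn n → ℂ} (hK : IsThetaKernel θ K) :
    Measurable (Function.uncurry (offDiag K)) := by
  have hs : MeasurableSet {p : Rn n × Rn n | p.1 ≠ p.2} :=
    (measurableSet_eq_fun measurable_fst measurable_snd).compl
  have : Function.uncurry (offDiag K) = Function.extend
      (Subtype.val : {p : Rn n × Rn n // p.1 ≠ p.2} → Rn n × Rn n)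
      (fun p => K p.1.1 p.1.2) (fun _ => 0) := by
    ext p
    by_cases h : p.1 = p.2
    · rw [Function.extend_apply']
      · simp [Function.uncurry, offDiag, h]
      · rintro ⟨a, rfl⟩
        exact a.2 h
    · have : p = (⟨p, h⟩ : {p : Rn n × Rn n // p.1 ≠ p.2}).1 := rfl
      conv_rhs => rw [this]
      rw [Subtype.val_injective.extend_apply]
      simp [Function.uncurry, offDiag, h]
  rw [this]
  exact (MeasurableEmbedding.subtype_coe hs).measurable_extend hK.measurable measurable_const

/-- The quantitative properties of Calderón–Zygmund operators that are used below: size and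
integrated regularity of the kernel, and representation off the support. -/
structure IsRegularCZO (L : L2 n →L[ℂ] L2 n) (K : Rn n → Rn n → ℂ) (C : ℝ≥0) : Prop where
  measurable : Measurable (Function.uncurry K)
  size : ∀ x y, x ≠ y → ‖K x y‖ ≤ C / ‖x - y‖ ^ n
  diff_left : ∀ (c : Rn n) (d : ℝ) (x : Rn n), 0 < d → dist x c ≤ d →
    ∀ (F : Rn n → ℝ≥0∞) (s : ℝ≥0∞),
      (∀ r, 0 < r → ∫⁻ y in ball c r, F y ≤ s * volume (ball c r)) →
      ∫⁻ y in (ball c (4 * d))ᶜ, ‖K x y - K c y‖ₑ * F y ≤ C * s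
  diff_right : ∀ (c : Rn n) (d : ℝ) (y : Rn n), 0 < d → dist y c ≤ d →
    ∫⁻ x in (ball c (4 * d))ᶜ, ‖K x y - K x c‖ₑ ≤ C
  repr : ∀ (φ : L2 n) (U : Set (Rn n)), IsOpen U → (∀ᵐ x, x ∈ U → φ x = 0) →
    ∀ᵐ x, x ∈ U → L φ x = ∫ y, K x y * φ y

/-- The k-th annulus has outer volume comparable with (2^k·4d)^n, which cancels the size factor and
leaves the summable θ(2^(-k-2)). With F = |φ| and s a bound for its averages this gives regularity
in the first variable; with F = 1, s = 1, in the second. -/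
lemma lintegral_diff_le_of_pointwise {θ : ℝ → ℝ} (hθ : IsDiniModulus θ) (C : ℝ≥0) (c : Rn n)
    {d : ℝ} (hd : 0 < d) (G F : Rn n → ℝ≥0∞)
    (hG : ∀ k : ℕ, ∀ y, 2 ^ k * (4 * d) ≤ dist y c →
      G y ≤ ENNReal.ofReal (C / (2 ^ k * (4 * d)) ^ n * θ ((1 / 2) ^ (k + 2))))
    (s : ℝ≥0∞) (hF : ∀ r, 0 < r → ∫⁻ y in ball c r, F y ≤ s * volume (ball c r)) :
    ∫⁻ y in (ball c (4 * d))ᶜ, G y * F y ≤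
      (C * 2 ^ n * (volume (ball (0 : Rn n) 1)).toNNReal *
        (∑' k : ℕ, ENNReal.ofReal (θ ((1 / 2) ^ (k + 2)))).toNNReal : ℝ≥0) * s := by
  refine (lintegral_compl_ball_le c (by positivity : 0 < 4 * d) G F
    (fun k => (C / (2 ^ k * (4 * d)) ^ n * θ ((1 / 2) ^ (k + 2))).toNNReal) hG).trans ?_
  push_cast
  rw [ENNReal.coe_toNNReal measure_ball_lt_top.ne, ENNReal.coe_toNNReal hθ.tsum_ne_top,
    mul_assoc, mul_comm _ s, ← mul_assoc, ← ENNReal.tsum_mul_left]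
  refine ENNReal.tsum_le_tsum fun k => ?_
  have hr : 0 < 2 ^ k * (4 * d) := by positivity
  have hr' : 0 < 2 ^ (k + 1) * (4 * d) := by positivity
  have h0 := hθ.nonneg ((1 / 2) ^ (k + 2)) (by positivity)
  have e : ENNReal.ofReal (C / (2 ^ k * (4 * d)) ^ n * θ ((1 / 2) ^ (k + 2))) *
      ENNReal.ofReal ((2 ^ (k + 1) * (4 * d)) ^ n) =
      C * 2 ^ n * ENNReal.ofReal (θ ((1 / 2) ^ (k + 2))) := by
    have h2 : (C : ℝ≥0∞) * 2 ^ n = ENNReal.ofReal (C * 2 ^ n) := by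
      rw [ENNReal.ofReal_mul C.coe_nonneg, ENNReal.ofReal_coe_nnreal,
        ENNReal.ofReal_pow (by norm_num), ENNReal.ofReal_ofNat]
    rw [h2, ← ENNReal.ofReal_mul (by positivity), ← ENNReal.ofReal_mul (by positivity)]
    congr 1
    generalize θ ((1 / 2) ^ (k + 2)) = t
    rw [pow_succ, mul_right_comm _ _ (4 * d), mul_pow _ (2 : ℝ) n]
    field_simp
  calc ((C / (2 ^ k * (4 * d)) ^ n * θ ((1 / 2) ^ (k + 2))).toNNReal : ℝ≥0∞) *
        ∫⁻ x in ball c (2 ^ (k + 1) * (4 * d)), F x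
      ≤ ENNReal.ofReal (C / (2 ^ k * (4 * d)) ^ n * θ ((1 / 2) ^ (k + 2))) *
        (s * (ENNReal.ofReal ((2 ^ (k + 1) * (4 * d)) ^ n) * volume (ball (0 : Rn n) 1))) := by
        rw [← volume_ball_eq c hr']
        gcongr
        · exact le_rfl
        · exact hF _ hr'
    _ = (ENNReal.ofReal (C / (2 ^ k * (4 * d)) ^ n * θ ((1 / 2) ^ (k + 2))) *
          ENNReal.ofReal ((2 ^ (k + 1) * (4 * d)) ^ n)) *
          (s * volume (ball (0 : Rn n) 1)) := by ring
    _ = _ := by rw [e]; ring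
    _ ≤ _ := le_rfl

/-- The pointwise form of the regularity condition on dyadic annuli. -/
lemma regularity_on_annulus {θ : ℝ → ℝ} (hθ : IsDiniModulus θ) {C : ℝ≥0} {c x y : Rn n} {d : ℝ}
    (hd : 0 < d) (hx : dist x c ≤ d) {k : ℕ} (hy : 2 ^ k * (4 * d) ≤ dist y c) {a : ℝ}
    (h0 : c = x → a = 0)
    (ha : c ≠ x → ‖c - x‖ < ‖c - y‖ / 2 → a ≤ C / ‖c - y‖ ^ n * θ (‖c - x‖ / ‖c - y‖)) :
    a ≤ C / (2 ^ k * (4 * d)) ^ n * θ ((1 / 2) ^ (k + 2)) := by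
  have h2 : 0 ≤ θ ((1 / 2) ^ (k + 2)) := hθ.nonneg _ (by positivity)
  by_cases hcx : c = x
  · rw [h0 hcx]
    positivity
  have h1 : (1 : ℝ) ≤ 2 ^ k := one_le_pow₀ (by norm_num)
  rw [dist_comm, dist_eq_norm] at hx hy
  have hxp : 0 < ‖c - x‖ := norm_pos_iff.2 (sub_ne_zero.2 hcx)
  have h4 : 4 * d ≤ ‖c - y‖ := by nlinarith
  refine (ha hcx (by linarith)).trans ?_
  have hyp : 0 < ‖c - y‖ := by linarith
  -- The quotient is at most d/(2^k·4d) = 2^(-k-2).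
  have hθle : θ (‖c - x‖ / ‖c - y‖) ≤ θ ((1 / 2) ^ (k + 2)) := by
    refine hθ.mono (mem_Ioi.2 (by positivity)) (mem_Ioi.2 (by positivity)) ?_
    rw [div_le_iff₀ hyp]
    calc ‖c - x‖ ≤ d := hx
      _ = (1 / 2) ^ (k + 2) * (2 ^ k * (4 * d)) := by
        rw [pow_add, one_div, inv_pow]
        field_simp
        norm_num
      _ ≤ _ := by gcongr
  have := hθ.nonneg (‖c - x‖ / ‖c - y‖) (by positivity)
  gcongr

/-! ### Representation off the support -/

/-- The square of the kernel is of order |x-y|^(-2n), so the k-th annulus contributes a multiple of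
2^(-kn), a convergent geometric series. Pairing with L² functions vanishing near x is therefore
continuous. -/
lemma lintegral_kernel_sq_ne_top (hn : 0 < n) {K : Rn n → Rn n → ℂ} {C : ℝ≥0}
    (hK : ∀ x y, x ≠ y → ‖K x y‖ ≤ C / ‖x - y‖ ^ n) (x : Rn n) {δ : ℝ} (hδ : 0 < δ) :
    ∫⁻ y in (ball x δ)ᶜ, ‖K x y‖ₑ ^ 2 ≠ ∞ := by
  have h := lintegral_compl_ball_le (ν := volume) x hδ (fun y => ‖K x y‖ₑ ^ 2) (fun _ => 1)
    (fun k => ((C / (2 ^ k * δ) ^ n).toNNReal) ^ 2) (fun k y hy => by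
      have hp : 0 < 2 ^ k * δ := by positivity
      have hxy : x ≠ y := by
        rintro rfl
        rw [dist_self] at hy
        linarith
      rw [dist_comm, dist_eq_norm] at hy
      push_cast
      gcongr
      rw [← ofReal_norm]
      refine ENNReal.ofReal_le_ofReal ((hK x y hxy).trans ?_)
      gcongr)
  simp only [mul_one] at h
  refine ne_top_of_le_ne_top ?_ h
  have e : ∀ k : ℕ, (((C / (2 ^ k * δ) ^ n).toNNReal ^ 2 : ℝ≥0) : ℝ≥0∞) *
      ∫⁻ _y in ball x (2 ^ (k + 1) * δ), 1 =
      ENNReal.ofReal (C ^ 2 * 2 ^ n / δ ^ n) * volume (ball (0 : Rn n) 1) *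
        ENNReal.ofReal ((1 / 2) ^ n) ^ k := by
    intro k
    rw [setLIntegral_const, one_mul, volume_ball_eq x (by positivity), ← ENNReal.ofReal_pow
      (by positivity), mul_right_comm, ← mul_assoc, ← ENNReal.ofReal_mul (by positivity)]
    congr 1
    push_cast
    rw [← ENNReal.ofReal, ← ENNReal.ofReal_pow (by positivity),
      ← ENNReal.ofReal_mul (by positivity)]
    congr 1
    rw [mul_pow (2 ^ (k + 1)) δ n, mul_pow (2 ^ k) δ n]
    have h2 : ((2 : ℝ) ^ (k + 1)) ^ n = 2 ^ n * (2 ^ k) ^ n := by rw [pow_succ, mul_pow]; ring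
    have h3 : (((1 : ℝ) / 2) ^ n) ^ k = 1 / (2 ^ k) ^ n := by
      rw [← pow_mul, ← pow_mul, mul_comm n k]; simp
    rw [h2, h3]
    field_simp
  simp_rw [e]
  rw [ENNReal.tsum_mul_left]
  refine ENNReal.mul_ne_top (ENNReal.mul_ne_top ENNReal.ofReal_ne_top measure_ball_lt_top.ne) ?_
  rw [ENNReal.tsum_geometric]
  refine ENNReal.inv_ne_top.2 (tsub_pos_of_lt ?_).ne'
  rw [ENNReal.ofReal_lt_one]
  exact pow_lt_one₀ (by norm_num) (by norm_num) hn.ne'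

lemma memLp_indicator_kernel (hn : 0 < n) {K : Rn n → Rn n → ℂ}
    (hm : Measurable (Function.uncurry K)) {C : ℝ≥0}
    (hK : ∀ x y, x ≠ y → ‖K x y‖ ≤ C / ‖x - y‖ ^ n) (x : Rn n) {δ : ℝ} (hδ : 0 < δ) :
    MemLp ((ball x δ)ᶜ.indicator (K x)) 2 := by
  rw [memLp_indicator_iff_restrict measurableSet_ball.compl]
  refine ⟨(hm.comp measurable_prodMk_left).aestronglyMeasurable, ?_⟩
  rw [eLpNorm_lt_top_iff_lintegral_rpow_enorm_lt_top (by norm_num) (by norm_num)]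
  have := lintegral_kernel_sq_ne_top hn hK x hδ
  simpa using this.lt_top

/-- Testing the kernel against square integrable functions is continuous off the diagonal. -/
lemma tendsto_integral_kernel (hn : 0 < n) {K : Rn n → Rn n → ℂ}
    (hm : Measurable (Function.uncurry K)) {C : ℝ≥0}
    (hK : ∀ x y, x ≠ y → ‖K x y‖ ≤ C / ‖x - y‖ ^ n) (x : Rn n) {δ : ℝ} (hδ : 0 < δ)
    {u : ℕ → L2 n} {φ : L2 n} (hu : Tendsto u atTop (𝓝 φ))
    (hu0 : ∀ j, ∀ᵐ y, y ∈ ball x δ → u j y = 0) (hφ0 : ∀ᵐ y, y ∈ ball x δ → φ y = 0) :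
    Tendsto (fun j => ∫ y, K x y * u j y) atTop (𝓝 (∫ y, K x y * φ y)) := by
  have hmem : MemLp (star ((ball x δ)ᶜ.indicator (K x))) 2 :=
    (memLp_indicator_kernel hn hm hK x hδ).star
  have key : ∀ v : L2 n, (∀ᵐ y, y ∈ ball x δ → v y = 0) →
      ∫ y, K x y * v y = inner ℂ (hmem.toLp _) v := by
    intro v hv
    rw [L2.inner_def]
    refine integral_congr_ae ?_
    filter_upwards [hv, hmem.coeFn_toLp] with y hy hy'
    rw [hy']
    by_cases hyb : y ∈ ball x δ
    · simp [hy hyb]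
    · simp [hyb, mul_comm]
  rw [key φ hφ0]
  simp_rw [fun j => key (u j) (hu0 j)]
  exact tendsto_const_nhds.inner hu

/-- Approximation by Schwartz functions that vanish near the centre of a ball off which `φ`
is supported. -/
lemma exists_schwartz_approx (φ : L2 n) (c : Rn n) {R : ℝ} (hR : 0 < R)
    (h0 : ∀ᵐ x, x ∈ ball c R → φ x = 0) :
    ∃ s : ℕ → 𝓢(Rn n, ℂ), (∀ j, HasCompactSupport (s j)) ∧
      (∀ j, tsupport (s j) ⊆ (ball c (R / 2))ᶜ) ∧
      Tendsto (fun j => (s j).toLp 2) atTop (𝓝 φ) := by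
  have hdense := Lp.dense_hasCompactSupport_contDiff (E := Rn n) (F := ℂ) (μ := volume) (p := 2)
    (by norm_num)
  obtain ⟨u, hu, hlim⟩ := mem_closure_iff_seq_limit.1 (hdense φ)
  choose g hg hgc hgs using hu
  -- Multiplication by 1 - b kills the approximants on the half ball. It does not increase their
  -- distance to φ, since b lives in the ball where φ = 0.
  let b : ContDiffBump c := ⟨R / 2, R, by positivity, by linarith⟩
  have hb : ContDiff ℝ ((⊤ : ℕ∞) : WithTop ℕ∞) (fun x => 1 - (b x : ℂ)) :=
    contDiff_const.sub (Complex.ofRealCLM.contDiff.comp b.contDiff)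
  have hsc : ∀ j, HasCompactSupport (fun x => (1 - (b x : ℂ)) * g j x) := fun j =>
    (hgc j).mul_left
  let s : ℕ → 𝓢(Rn n, ℂ) := fun j => (hsc j).toSchwartzMap (hb.mul (hgs j))
  have hs : ∀ j x, s j x = (1 - (b x : ℂ)) * g j x := fun j x => rfl
  refine ⟨s, fun j => hsc j, fun j => ?_, ?_⟩
  · refine closure_minimal (fun x hx => ?_) isOpen_ball.isClosed_compl
    simp only [Function.mem_support, hs] at hx
    intro hxb
    refine hx ?_
    rw [b.one_of_mem_closedBall (ball_subset_closedBall hxb)]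
    simp
  · rw [tendsto_iff_norm_sub_tendsto_zero] at hlim ⊢
    refine squeeze_zero (fun _ => norm_nonneg _) (fun j => ?_) hlim
    refine Lp.norm_le_norm_of_ae_le ?_
    filter_upwards [h0, hg j, Lp.coeFn_sub ((s j).toLp 2) φ, Lp.coeFn_sub (u j) φ,
      (s j).coeFn_toLp 2] with x hx0 hxg h1 h2 h3
    rw [h1, h2, Pi.sub_apply, Pi.sub_apply, h3, hs, hxg]
    by_cases hxb : x ∈ ball c R
    · rw [hx0 hxb, sub_zero, sub_zero, norm_mul]
      refine mul_le_of_le_one_left (norm_nonneg _) ?_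
      rw [← Complex.ofReal_one, ← Complex.ofReal_sub, Complex.norm_real, Real.norm_eq_abs, abs_le]
      constructor <;> linarith [b.nonneg (x := x), b.le_one (x := x)]
    · have : b x = 0 := b.zero_of_le_dist (by simpa using hxb)
      simp [this]

lemma ae_tendsto_subseq_of_tendsto {u : ℕ → L2 n} {φ : L2 n} (hu : Tendsto u atTop (𝓝 φ)) :
    ∃ ns : ℕ → ℕ, StrictMono ns ∧ ∀ᵐ x, Tendsto (fun j => u (ns j) x) atTop (𝓝 (φ x)) :=
  (tendstoInMeasure_of_tendsto_Lp hu).exists_seq_tendsto_ae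

/-- The kernel formula is given for test functions only. Approximate φ in L² by test functions
vanishing near a given point of U: the left sides converge almost everywhere along a subsequence,
the right sides by square integrability of the kernel away from x. -/
lemma representation_of_isThetaCZO (hn : 0 < n) {θ : ℝ → ℝ} {T : 𝓢(Rn n, ℂ) →ₗ[ℂ] 𝓢'(Rn n, ℂ)}
    {L : L2 n →L[ℂ] L2 n} {K : Rn n → Rn n → ℂ} (hT : IsThetaCZO θ T L K) {C : ℝ≥0}
    (hC : ∀ x y, x ≠ y → ‖offDiag K x y‖ ≤ C / ‖x - y‖ ^ n)
    (φ : L2 n) (U : Set (Rn n)) (hU : IsOpen U) (h0 : ∀ᵐ x, x ∈ U → φ x = 0) :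
    ∀ᵐ x, x ∈ U → L φ x = ∫ y, offDiag K x y * φ y := by
  have hm := measurable_offDiag hT.kernel
  have hloc : ∀ c ∈ U, ∃ R > 0, ∀ᵐ x, x ∈ ball c R → L φ x = ∫ y, offDiag K x y * φ y := by
    intro c hc
    obtain ⟨R, hR, hRU⟩ := Metric.isOpen_iff.1 hU c hc
    have h0R : ∀ᵐ x, x ∈ ball c R → φ x = 0 := h0.mono fun x hx hxb => hx (hRU hxb)
    obtain ⟨s, hsc, hst, hslim⟩ := exists_schwartz_approx φ c hR h0R
    obtain ⟨ns, hns, hae⟩ := ae_tendsto_subseq_of_tendsto ((L.continuous.tendsto _).comp hslim)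
    -- For x within R/4 of c, the ball of radius R/4 about x stays in B(c, R/2), where all
    -- approximants vanish.
    refine ⟨R / 4, by positivity, ?_⟩
    have hrep : ∀ᵐ x, ∀ j, x ∉ tsupport (s j) →
        L ((s j).toLp 2) x = ∫ y, offDiag K x y * s j y := by
      refine ae_all_iff.2 fun j => (hT.representation (s j) (hsc j)).mono fun x hx hxs => ?_
      rw [hx hxs]
      refine integral_congr_ae ((ae_offDiag_eq hn K x).mono fun y hy => ?_)
      simp only [hy]
    filter_upwards [hae, hrep] with x hx hxr hxb
    have hsub : ball x (R / 4) ⊆ ball c (R / 2) := ball_subset_ball' (by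
      rw [mem_ball] at hxb
      linarith)
    have hxc : x ∈ ball c (R / 2) := ball_subset_ball (by linarith) hxb
    have h1 : Tendsto (fun j => ∫ y, offDiag K x y * ((s j).toLp 2 : L2 n) y) atTop
        (𝓝 (∫ y, offDiag K x y * φ y)) := by
      refine tendsto_integral_kernel hn hm hC x (by positivity : 0 < R / 4) hslim (fun j => ?_)
        (h0R.mono fun y hy hyb => hy (ball_subset_ball (by linarith) (hsub hyb)))
      filter_upwards [(s j).coeFn_toLp 2] with y hy hyb
      rw [hy]
      exact image_eq_zero_of_notMem_tsupport fun h => hst j h (hsub hyb)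
    have h2 : ∀ j, L ((s j).toLp 2) x = ∫ y, offDiag K x y * ((s j).toLp 2 : L2 n) y := by
      intro j
      rw [hxr j fun h => hst j h hxc]
      refine integral_congr_ae ?_
      filter_upwards [(s j).coeFn_toLp 2] with y hy
      rw [hy]
    refine tendsto_nhds_unique hx ?_
    simp only [Function.comp_apply, h2]
    exact h1.comp hns.tendsto_atTop
  rw [ae_iff]
  refine measure_null_of_locally_null _ fun x hx => ?_
  simp only [Classical.not_imp, mem_ofPred_eq] at hx
  obtain ⟨R, hR, hae⟩ := hloc x hx.1
  refine ⟨_, inter_mem_nhdsWithin _ (ball_mem_nhds x hR), measure_mono_null ?_ (ae_iff.1 hae)⟩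
  intro y hy
  simp only [Classical.not_imp, mem_ofPred_eq, mem_inter_iff] at hy ⊢
  exact ⟨hy.2, hy.1.2⟩

/-- Calderón–Zygmund operators of type `θ` are regular. -/
lemma IsThetaCZO.exists_isRegularCZO (hn : 0 < n) {θ : ℝ → ℝ}
    {T : 𝓢(Rn n, ℂ) →ₗ[ℂ] 𝓢'(Rn n, ℂ)} {L : L2 n →L[ℂ] L2 n} {K : Rn n → Rn n → ℂ}
    (hT : IsThetaCZO θ T L K) : ∃ C : ℝ≥0, IsRegularCZO L (offDiag K) C := by
  obtain ⟨C₀, hsize, hreg⟩ := hT.kernel.bounds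
  set C : ℝ≥0 := C₀.toNNReal with hCdef
  have hC₀ : C₀ ≤ C := Real.le_coe_toNNReal C₀
  have hθ := hT.modulus
  have hsize' : ∀ x y, x ≠ y → ‖offDiag K x y‖ ≤ C / ‖x - y‖ ^ n := fun x y hxy => by
    rw [offDiag_of_ne K hxy]
    refine (hsize x y hxy).trans ?_
    gcongr
  set C₁ : ℝ≥0 := C * 2 ^ n * (volume (ball (0 : Rn n) 1)).toNNReal *
    (∑' k : ℕ, ENNReal.ofReal (θ ((1 / 2) ^ (k + 2)))).toNNReal with hC₁
  have hreg' : ∀ c y x, c ≠ x → ‖c - x‖ < ‖c - y‖ / 2 →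
      ‖offDiag K c y - offDiag K x y‖ + ‖offDiag K y c - offDiag K y x‖ ≤
        C / ‖c - y‖ ^ n * θ (‖c - x‖ / ‖c - y‖) := by
    intro c y x hcx hlt
    have h1 : 0 < ‖c - x‖ := norm_pos_iff.2 (sub_ne_zero.2 hcx)
    have hyc : c ≠ y := by
      rintro rfl
      simp at hlt
      linarith
    have hxy : x ≠ y := by
      rintro rfl
      linarith
    rw [offDiag_of_ne K hyc, offDiag_of_ne K hyc.symm, offDiag_of_ne K hxy,
      offDiag_of_ne K hxy.symm]
    refine (hreg c y x hcx hlt).trans ?_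
    have : 0 ≤ θ (‖c - x‖ / ‖c - y‖) := hθ.nonneg _ (div_pos h1 (by linarith))
    gcongr
  have hle : C ≤ C + C₁ := le_self_add
  have hle₁ : C₁ ≤ C + C₁ := le_add_self
  refine ⟨C + C₁, measurable_offDiag hT.kernel, fun x y hxy => (hsize' x y hxy).trans ?_, ?_, ?_,
    fun φ U hU h0 => representation_of_isThetaCZO hn hT hsize' φ U hU h0⟩
  · gcongr
  · intro c d x hd hx F s hF
    refine (lintegral_diff_le_of_pointwise hθ C c hd
      (fun y => ‖offDiag K x y - offDiag K c y‖ₑ) F (fun k y hy => ?_) s hF).trans ?_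
    · rw [← ofReal_norm]
      refine ENNReal.ofReal_le_ofReal (regularity_on_annulus hθ hd hx hy (by rintro rfl; simp)
        fun hcx hlt => ?_)
      rw [norm_sub_rev]
      exact (le_add_of_nonneg_right (norm_nonneg _)).trans (hreg' c y x hcx hlt)
    · gcongr
  · intro c d y hd hy
    have := lintegral_diff_le_of_pointwise hθ C c hd
      (fun x => ‖offDiag K x y - offDiag K x c‖ₑ) (fun _ => 1) (fun k x hx => ?_) 1
      (fun r _ => by simp)
    · simp only [mul_one] at this
      refine this.trans ?_
      gcongr
    · rw [← ofReal_norm]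
      refine ENNReal.ofReal_le_ofReal (regularity_on_annulus hθ hd hy hx (by rintro rfl; simp)
        fun hcx hlt => ?_)
      rw [norm_sub_rev]
      exact (le_add_of_nonneg_left (norm_nonneg _)).trans (hreg' c x y hcx hlt)

/-! ### The unweighted weak type `(1,1)` inequality -/

/-- Fatou along an almost everywhere convergent subsequence. A general filter is allowed because
sums over cubes converge along finite sets. -/
lemma setLIntegral_enorm_le_of_tendsto {ι : Type*} {l : Filter ι} [l.NeBot]
    [l.IsCountablyGenerated] {u : ι → L2 n} {φ : L2 n} (hu : Tendsto u l (𝓝 φ))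
    (s : Set (Rn n)) (M : ℝ≥0∞) (hM : ∀ i, ∫⁻ x in s, ‖u i x‖ₑ ≤ M) :
    ∫⁻ x in s, ‖φ x‖ₑ ≤ M := by
  obtain ⟨ns, -, hns⟩ := (tendstoInMeasure_of_tendsto_Lp hu).exists_seq_tendsto_ae'
  calc ∫⁻ x in s, ‖φ x‖ₑ = ∫⁻ x in s, liminf (fun j => ‖u (ns j) x‖ₑ) atTop := by
        refine lintegral_congr_ae (ae_restrict_of_ae (hns.mono fun x hx => ?_))
        exact (hx.enorm.liminf_eq).symm
    _ ≤ liminf (fun j => ∫⁻ x in s, ‖u (ns j) x‖ₑ) atTop :=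
        lintegral_liminf_le fun j => (Lp.stronglyMeasurable (u (ns j))).measurable.enorm
    _ ≤ M := liminf_le_of_frequently_le' (Frequently.of_forall fun j => hM _)

lemma integrable_kernel_mul (hn : 0 < n) {L : L2 n →L[ℂ] L2 n} {K : Rn n → Rn n → ℂ} {C : ℝ≥0}
    (hL : IsRegularCZO L K C) {u : Rn n → ℂ} (hu : MemLp u 2) {x : Rn n} {δ : ℝ} (hδ : 0 < δ)
    (h0 : ∀ᵐ y, y ∈ ball x δ → u y = 0) : Integrable fun y => K x y * u y := by
  refine ((memLp_indicator_kernel hn hL.measurable hL.size x hδ).integrable_mul hu).congr ?_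
  filter_upwards [h0] with y hy
  by_cases hyb : y ∈ ball x δ
  · simp [hy hyb]
  · simp [hyb]

/-- The action on an atom, away from its support. -/
lemma IsRegularCZO.lintegral_atom_le (hn : 0 < n) {L : L2 n →L[ℂ] L2 n} {K : Rn n → Rn n → ℂ}
    {C : ℝ≥0} (hL : IsRegularCZO L K C) (u : L2 n) (hu : Integrable u) (c : Rn n) {d : ℝ}
    (hd : 0 < d) (hsupp : ∀ᵐ x, x ∉ closedBall c d → u x = 0) (hmean : ∫ x, u x = 0) :
    ∫⁻ x in (ball c (4 * d))ᶜ, ‖L u x‖ₑ ≤ C * ∫⁻ x, ‖u x‖ₑ := by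
  have hsub : ∀ x ∉ ball c (4 * d), x ∉ closedBall c d := fun x hx h =>
    hx (closedBall_subset_ball (by linarith) h)
  have h1 : ∀ᵐ x ∂volume.restrict (ball c (4 * d))ᶜ,
      ‖L u x‖ₑ ≤ ∫⁻ y, ‖K x y - K x c‖ₑ * ‖u y‖ₑ := by
    rw [ae_restrict_iff' measurableSet_ball.compl]
    filter_upwards [hL.repr u _ isClosed_closedBall.isOpen_compl hsupp] with x hx hxb
    have hux : ∀ᵐ y, y ∈ ball x d → u y = 0 := hsupp.mono fun y hy hyx => hy fun hyc => by
      simp only [mem_compl_iff, mem_ball, not_lt, mem_closedBall] at hxb hyx hyc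
      have := dist_triangle x y c
      rw [dist_comm x y] at this
      linarith
    have hint := integrable_kernel_mul hn hL (Lp.memLp u) hd hux
    -- The vanishing mean permits subtracting K(x,c), so that regularity in the second variable
    -- applies after Tonelli.
    have e : ∫ y, K x y * u y = ∫ y, (K x y - K x c) * u y := by
      simp_rw [sub_mul]
      rw [integral_sub hint (hu.const_mul _), integral_const_mul, hmean, mul_zero, sub_zero]
    rw [hx (hsub x hxb), e]
    refine (enorm_integral_le_lintegral_enorm _).trans (le_of_eq ?_)
    simp only [enorm_mul]
  have hmeas : Measurable (Function.uncurry fun x y => ‖K x y - K x c‖ₑ * ‖u y‖ₑ) := by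
    refine Measurable.mul (Measurable.enorm (Measurable.sub hL.measurable ?_))
      ((Lp.stronglyMeasurable u).measurable.comp measurable_snd).enorm
    exact hL.measurable.comp (measurable_fst.prodMk measurable_const)
  calc ∫⁻ x in (ball c (4 * d))ᶜ, ‖L u x‖ₑ
      ≤ ∫⁻ x in (ball c (4 * d))ᶜ, ∫⁻ y, ‖K x y - K x c‖ₑ * ‖u y‖ₑ := lintegral_mono_ae h1
    _ = ∫⁻ y, ∫⁻ x in (ball c (4 * d))ᶜ, ‖K x y - K x c‖ₑ * ‖u y‖ₑ :=
        lintegral_lintegral_swap hmeas.aemeasurable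
    _ ≤ ∫⁻ y, C * ‖u y‖ₑ := by
        refine lintegral_mono_ae (hsupp.mono fun y hy => ?_)
        rw [lintegral_mul_const' _ _ enorm_ne_top]
        by_cases hyc : y ∈ closedBall c d
        · gcongr
          exact hL.diff_right c d y hd hyc
        · simp [hy hyc]
    _ = _ := lintegral_const_mul' _ _ ENNReal.coe_ne_top

/-! ### Calderón–Zygmund decomposition -/

/-- The property defining the Calderón–Zygmund cubes of `φ` at height `t`. -/
def largeAverage (φ : Rn n → ℂ) (t : ℝ≥0) (s : Set (Rn n)) : Prop :=
  t * volume s < ∫⁻ x in s, ‖φ x‖ₑ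

lemma exists_generation_bound_largeAverage (hn : 0 < n) {φ : Rn n → ℂ} {t : ℝ≥0} (ht : t ≠ 0)
    (hφ : ∫⁻ x, ‖φ x‖ₑ ≠ ∞) :
    ∃ k₀ : ℤ, ∀ c : ℤ × (Fin n → ℤ), largeAverage φ t (dcube c) → k₀ ≤ c.1 := by
  have ht' : (t : ℝ≥0∞) ≠ 0 := by exact_mod_cast ht
  obtain ⟨k₀, hk₀⟩ := exists_generation_bound hn (V := (∫⁻ x, ‖φ x‖ₑ) / t)
    (ENNReal.div_ne_top hφ ht')
  refine ⟨k₀, fun c hc => hk₀ c ?_⟩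
  rw [ENNReal.le_div_iff_mul_le (Or.inl ht') (Or.inl ENNReal.coe_ne_top), mul_comm]
  exact hc.le.trans (setLIntegral_le_lintegral _ _)

/-- Off the selected cubes all dyadic averages of |φ| are at most t, and Lebesgue differentiation
passes this to |φ| itself. -/
lemma ae_enorm_le_of_notMem_dyadicUnion (hn : 0 < n) {φ : Rn n → ℂ} (hφ : LocallyIntegrable φ)
    (t : ℝ≥0) : ∀ᵐ x, x ∉ dyadicUnion (largeAverage φ t) → ‖φ x‖ₑ ≤ t := by
  filter_upwards [ae_dyadic_lintegral_le hn hφ] with x hx hxΩ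
  refine ENNReal.le_of_forall_pos_le_add fun ε hε _ => ?_
  obtain ⟨k, hk⟩ := hx ε hε
  set Q := dcube (k, dyadicIndex k x) with hQ
  have h1 : ∫⁻ y in Q, ‖φ y‖ₑ ≤ t * volume Q := not_lt.1 fun h => hxΩ ⟨k, h⟩
  have h2 : ‖φ x‖ₑ * volume Q ≤ (t + ε) * volume Q := by
    calc ‖φ x‖ₑ * volume Q = ∫⁻ _y in Q, ‖φ x‖ₑ := (setLIntegral_const _ _).symm
      _ ≤ ∫⁻ y in Q, (‖φ y‖ₑ + ‖φ y - φ x‖ₑ) := by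
        refine lintegral_mono fun y => ?_
        have := enorm_sub_le (a := φ y) (b := φ y - φ x)
        simpa using this
      _ = (∫⁻ y in Q, ‖φ y‖ₑ) + ∫⁻ y in Q, ‖φ y - φ x‖ₑ :=
        lintegral_add_left' hφ.aestronglyMeasurable.restrict.enorm _
      _ ≤ t * volume Q + ε * volume Q := add_le_add h1 hk
      _ = _ := (add_mul _ _ _).symm
  exact (ENNReal.mul_le_mul_iff_left (volume_dcube_ne_zero _) (volume_dcube_ne_top _)).1 h2

/-- The parent of a maximal cube was not selected, and its volume is only 2^n times larger. -/
lemma setLIntegral_le_of_mem_stopCubes {φ : Rn n → ℂ} {t : ℝ≥0} {c : ℤ × (Fin n → ℤ)}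
    (hc : c ∈ stopCubes (largeAverage φ t)) :
    ∫⁻ x in dcube c, ‖φ x‖ₑ ≤ 2 ^ n * t * volume (dcube c) := by
  obtain ⟨x, hx⟩ := hc.2.1
  obtain ⟨k, m⟩ := c
  have e : m = dyadicIndex k x := (mem_dcube.1 hx).symm
  subst e
  have := hc.2.2 (k - 1) (by simp) x hx
  rw [largeAverage, not_lt, volume_dcube_pred k _ (dyadicIndex k x)] at this
  refine (lintegral_mono_set (dcube_subset_of_le (by omega) x)).trans (this.trans (le_of_eq ?_))
  ring

/-- The Calderón–Zygmund decomposition: the good part. -/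
lemma exists_good_part (hn : 0 < n) (φ : L2 n) (hφ : Integrable φ) {t : ℝ≥0} (ht : t ≠ 0) :
    ∃ g : Rn n → ℂ, Measurable g ∧ (∀ᵐ x, ‖g x‖ₑ ≤ 2 ^ n * t) ∧
      (∫⁻ x, ‖g x‖ₑ ≤ ∫⁻ x, ‖φ x‖ₑ) ∧
      (∀ x ∉ dyadicUnion (largeAverage φ t), g x = φ x) ∧
      ∀ c ∈ stopCubes (largeAverage φ t), (∫ x in dcube c, g x = ∫ x in dcube c, φ x) ∧
        ∫⁻ x in dcube c, ‖g x‖ₑ ≤ ∫⁻ x in dcube c, ‖φ x‖ₑ := by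
  classical
  set P := largeAverage (n := n) φ t with hP
  set m : ℤ × (Fin n → ℤ) → ℂ := fun c => ⨍ x in dcube c, φ x with hm
  have hΩ := iUnion_stopCubes (exists_generation_bound_largeAverage hn ht hφ.2.ne)
  have hmeas : ∀ c : stopCubes P, MeasurableSet (dcube c.1) := fun c => measurableSet_dcube _
  -- The index `none` stands for the complement of the cubes, where the good part is φ; on each cube
  -- it is the mean of φ.
  let S : Option (stopCubes P) → Set (Rn n) := fun o => o.elim (dyadicUnion P)ᶜ fun c => dcube c.1
  let G : Option (stopCubes P) → Rn n → ℂ := fun o => o.elim φ fun c _ => m c.1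
  obtain ⟨g, hg, hgS⟩ := exists_measurable_piecewise S
    (by
      rintro (_ | c)
      · exact (measurableSet_dyadicUnion P).compl
      · exact measurableSet_dcube _) G
    (by
      rintro (_ | c)
      · exact (Lp.stronglyMeasurable φ).measurable
      · exact measurable_const)
    (by
      rintro (_ | c) (_ | c') hne x ⟨hx, hx'⟩
      · exact absurd rfl hne
      · exact absurd (hΩ ▸ mem_iUnion.2 ⟨c', hx'⟩) hx
      · exact absurd (hΩ ▸ mem_iUnion.2 ⟨c, hx⟩) hx'
      · have : c = c' := Subtype.ext (stopCubes_eq c.2 c'.2 hx hx')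
        exact absurd (congrArg some this) hne)
  have hgc : ∀ c ∈ stopCubes P, ∀ x ∈ dcube c, g x = m c := fun c hc x hx => hgS (some ⟨c, hc⟩) hx
  have hgo : ∀ x ∉ dyadicUnion P, g x = φ x := fun x hx => hgS none hx
  have hmle : ∀ c, ‖m c‖ₑ * volume (dcube c) ≤ ∫⁻ x in dcube c, ‖φ x‖ₑ := by
    intro c
    have h1 : m c * (volume.real (dcube c) : ℂ) = ∫ x in dcube c, φ x := by
      have : volume.real (dcube c) ≠ 0 :=
        ENNReal.toReal_ne_zero.2 ⟨volume_dcube_ne_zero c, volume_dcube_ne_top c⟩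
      rw [hm]
      dsimp only
      rw [setAverage_eq, Complex.real_smul, mul_comm, ← mul_assoc, Complex.ofReal_inv,
        mul_inv_cancel₀ (by exact_mod_cast this), one_mul]
    calc ‖m c‖ₑ * volume (dcube c) = ‖m c * (volume.real (dcube c) : ℂ)‖ₑ := by
          rw [enorm_mul, measureReal_def, ← ofReal_norm (Complex.ofReal _), Complex.norm_real,
            Real.norm_of_nonneg ENNReal.toReal_nonneg,
            ENNReal.ofReal_toReal (volume_dcube_ne_top c)]
      _ ≤ _ := by rw [h1]; exact enorm_integral_le_lintegral_enorm _
  have hgcle : ∀ c ∈ stopCubes P, ∫⁻ x in dcube c, ‖g x‖ₑ ≤ ∫⁻ x in dcube c, ‖φ x‖ₑ := by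
    intro c hc
    rw [setLIntegral_congr_fun (measurableSet_dcube c) fun x hx => by
      rw [hgc c hc x hx], setLIntegral_const]
    exact hmle c
  refine ⟨g, hg, ?_, ?_, hgo, fun c hc => ⟨?_, hgcle c hc⟩⟩
  · filter_upwards [ae_enorm_le_of_notMem_dyadicUnion hn hφ.locallyIntegrable t] with x hx
    by_cases hxΩ : x ∈ dyadicUnion P
    · rw [← hΩ] at hxΩ
      obtain ⟨c, hxc⟩ := mem_iUnion.1 hxΩ
      rw [hgc c.1 c.2 x hxc]
      exact (ENNReal.mul_le_mul_iff_left (volume_dcube_ne_zero _) (volume_dcube_ne_top _)).1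
        ((hmle c.1).trans (setLIntegral_le_of_mem_stopCubes c.2))
    · rw [hgo x hxΩ]
      refine (hx hxΩ).trans ?_
      calc (t : ℝ≥0∞) = 1 * t := (one_mul _).symm
        _ ≤ 2 ^ n * t := by gcongr; exact one_le_pow₀ (by norm_num)
  · rw [← lintegral_add_compl _ (measurableSet_dyadicUnion P),
      ← lintegral_add_compl (fun x => ‖φ x‖ₑ) (measurableSet_dyadicUnion P), ← hΩ,
      lintegral_iUnion hmeas (pairwise_disjoint_stopCubes P),
      lintegral_iUnion hmeas (pairwise_disjoint_stopCubes P)]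
    refine add_le_add (ENNReal.tsum_le_tsum fun c => hgcle c.1 c.2) (le_of_eq ?_)
    rw [hΩ]
    exact setLIntegral_congr_fun (measurableSet_dyadicUnion P).compl fun x hx => by
      rw [hgo x hx]
  · rw [setIntegral_congr_fun (measurableSet_dcube c) (hgc c hc), setIntegral_const, hm]
    dsimp only
    rw [setAverage_eq, smul_smul, mul_inv_cancel₀, one_smul]
    exact ENNReal.toReal_ne_zero.2 ⟨volume_dcube_ne_zero c, volume_dcube_ne_top c⟩

/-- The restriction of an element of `L²` to a measurable set. -/
def cut (s : Set (Rn n)) (hs : MeasurableSet s) (u : L2 n) : L2 n :=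
  ((Lp.memLp u).indicator hs).toLp (s.indicator u)

lemma coeFn_cut (s : Set (Rn n)) (hs : MeasurableSet s) (u : L2 n) :
    cut s hs u =ᵐ[volume] s.indicator u := MemLp.coeFn_toLp _

lemma lintegral_enorm_sq (u : L2 n) : ∫⁻ x, ‖u x‖ₑ ^ 2 = ‖u‖ₑ ^ 2 := by
  rw [Lp.enorm_def, eLpNorm_eq_lintegral_rpow_enorm_toReal (by norm_num) (by norm_num)]
  simp only [ENNReal.toReal_ofNat, ENNReal.rpow_ofNat, one_div]
  rw [← ENNReal.rpow_two, ← ENNReal.rpow_mul]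
  norm_num

lemma mul_measure_lt_enorm_le (u : L2 n) (t : ℝ≥0) :
    (t : ℝ≥0∞) ^ 2 * volume {x | (t : ℝ≥0∞) < ‖u x‖ₑ} ≤ ‖u‖ₑ ^ 2 := by
  rw [← lintegral_enorm_sq]
  refine le_trans (mul_le_mul_right (measure_mono fun x hx => ?_) _) (mul_meas_ge_le_lintegral
    ((Lp.stronglyMeasurable u).measurable.enorm.pow_const 2) ((t : ℝ≥0∞) ^ 2))
  have hx' : (t : ℝ≥0∞) < ‖u x‖ₑ := hx
  exact pow_le_pow_left' hx'.le 2

/-- The squared L² error is the mass of |b|² dx on the complement of s_i. These sets decrease to a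
null set for that finite measure. -/
lemma tendsto_cut {ι : Type*} [Preorder ι] [Nonempty ι] [IsCountablyGenerated (atTop : Filter ι)]
    {s : ι → Set (Rn n)} (hs : ∀ i, MeasurableSet (s i)) (hmono : Monotone s) (b : L2 n)
    (hb : ∀ᵐ x, x ∉ ⋃ i, s i → b x = 0) :
    Tendsto (fun i => cut (s i) (hs i) b) atTop (𝓝 b) := by
  set ρ : Measure (Rn n) := volume.withDensity fun x => ‖b x‖ₑ ^ 2 with hρ
  have hρfin : ∀ t : Set (Rn n), ρ t ≠ ∞ := fun t => by
    refine ne_top_of_le_ne_top ?_ (measure_mono (subset_univ _))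
    rw [hρ, withDensity_apply _ MeasurableSet.univ, Measure.restrict_univ, lintegral_enorm_sq]
    exact ENNReal.pow_ne_top enorm_ne_top
  have hlim : Tendsto (ρ ∘ fun i => (s i)ᶜ) atTop (𝓝 (ρ (⋂ i, (s i)ᶜ))) :=
    tendsto_measure_iInter_atTop (fun i => (hs i).compl.nullMeasurableSet)
      (fun i j h => compl_subset_compl.2 (hmono h)) ⟨Classical.arbitrary ι, hρfin _⟩
  have hzero : ρ (⋂ i, (s i)ᶜ) = 0 := by
    have hle : ⋂ i, (s i)ᶜ ≤ᵐ[volume] {x | ‖b x‖ₑ ^ 2 = 0} := by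
      filter_upwards [hb] with x hx hxs
      have hxs' : x ∈ ⋂ i, (s i)ᶜ := hxs
      rw [← compl_iUnion] at hxs'
      show ‖b x‖ₑ ^ 2 = 0
      simp [hx hxs']
    have hm : MeasurableSet {x | ‖b x‖ₑ ^ 2 = 0} :=
      ((Lp.stronglyMeasurable b).measurable.enorm.pow_const 2) (measurableSet_singleton 0)
    refine le_zero_iff.1 ((measure_mono_ae ((withDensity_absolutelyContinuous _ _).ae_le hle)).trans
      (le_of_eq ?_))
    rw [withDensity_apply _ hm]
    exact setLIntegral_eq_zero hm fun x hx => hx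
  rw [hzero] at hlim
  have key : ∀ i, ‖cut (s i) (hs i) b - b‖ₑ ^ 2 = ρ (s i)ᶜ := by
    intro i
    rw [← lintegral_enorm_sq, hρ, withDensity_apply _ (hs i).compl,
      ← lintegral_indicator (hs i).compl]
    refine lintegral_congr_ae ?_
    filter_upwards [coeFn_cut (s i) (hs i) b, Lp.coeFn_sub (cut (s i) (hs i) b) b] with x h1 h2
    rw [h2, Pi.sub_apply, h1]
    by_cases hx : x ∈ s i
    · simp [hx]
    · simp [hx]
  rw [tendsto_iff_enorm_sub_tendsto_zero]
  have h2 : Tendsto (fun i => (‖cut (s i) (hs i) b - b‖ₑ ^ 2) ^ (1 / 2 : ℝ))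
      atTop (𝓝 (0 ^ (1 / 2 : ℝ))) := by
    simp_rw [key]
    exact (ENNReal.continuous_rpow_const.tendsto _).comp hlim
  rw [ENNReal.zero_rpow_of_pos (by norm_num)] at h2
  refine h2.congr fun i => ?_
  rw [← ENNReal.rpow_two, ← ENNReal.rpow_mul]
  norm_num

lemma tendsto_sum_cut {ι : Type*} [Countable ι] {Q : ι → Set (Rn n)}
    (hQ : ∀ i, MeasurableSet (Q i)) (hd : Pairwise (Function.onFun Disjoint Q)) (b : L2 n)
    (hb : ∀ᵐ x, x ∉ ⋃ i, Q i → b x = 0) :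
    Tendsto (fun F : Finset ι => ∑ i ∈ F, cut (Q i) (hQ i) b) atTop (𝓝 b) := by
  have hs : ∀ F : Finset ι, MeasurableSet (⋃ i ∈ F, Q i) := fun F =>
    F.measurableSet_biUnion fun i _ => hQ i
  refine (tendsto_cut hs (fun F F' h => biUnion_subset_biUnion_left h) b ?_).congr fun F => ?_
  · filter_upwards [hb] with x hx hxs
    refine hx fun h => hxs ?_
    obtain ⟨i, hi⟩ := mem_iUnion.1 h
    exact mem_iUnion.2 ⟨{i}, by simpa using hi⟩
  · refine Lp.ext ?_
    have hc : ∀ᵐ x, ∀ i, cut (Q i) (hQ i) b x = (Q i).indicator b x :=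
      ae_all_iff.2 fun i => coeFn_cut _ _ _
    filter_upwards [hc, coeFn_cut _ (hs F) b,
      Lp.coeFn_finsetSum F fun i => cut (Q i) (hQ i) b] with x h1 h2 h3
    rw [h2, h3, Finset.sum_apply]
    simp only [h1]
    rw [congrFun (Finset.indicator_biUnion F Q (f := b) fun i _ j _ hij => hd hij) x]

/-- A bounded integrable function is square integrable with ∫|g|² ≤ A∫|g|; the L² bound of the
operator and Chebyshev do the rest. -/
lemma good_part_estimate (L : L2 n →L[ℂ] L2 n) {g : Rn n → ℂ} (hg : AEStronglyMeasurable g)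
    {A : ℝ≥0} {I : ℝ≥0∞} (hA : ∀ᵐ x, ‖g x‖ₑ ≤ A) (hI : ∫⁻ x, ‖g x‖ₑ ≤ I) (hIt : I ≠ ∞) :
    ∃ u : L2 n, u =ᵐ[volume] g ∧ ∀ t : ℝ≥0,
      (t : ℝ≥0∞) ^ 2 * volume {x | (t : ℝ≥0∞) < ‖L u x‖ₑ} ≤ ‖L‖ₑ ^ 2 * (A * I) := by
  have h2 : ∫⁻ x, ‖g x‖ₑ ^ 2 ≤ A * I := by
    calc ∫⁻ x, ‖g x‖ₑ ^ 2 ≤ ∫⁻ x, A * ‖g x‖ₑ := by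
          refine lintegral_mono_ae (hA.mono fun x hx => ?_)
          rw [sq]
          gcongr
      _ = A * ∫⁻ x, ‖g x‖ₑ := lintegral_const_mul' _ _ ENNReal.coe_ne_top
      _ ≤ _ := by gcongr
  have hmem : MemLp g 2 := by
    refine ⟨hg, ?_⟩
    rw [eLpNorm_lt_top_iff_lintegral_rpow_enorm_lt_top (by norm_num) (by norm_num)]
    have := h2.trans_lt (ENNReal.mul_lt_top ENNReal.coe_lt_top hIt.lt_top)
    simpa using this
  refine ⟨hmem.toLp g, hmem.coeFn_toLp, fun t => (mul_measure_lt_enorm_le _ t).trans ?_⟩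
  calc ‖L (hmem.toLp g)‖ₑ ^ 2 ≤ (‖L‖ₑ * ‖hmem.toLp g‖ₑ) ^ 2 := by
        gcongr
        exact L.le_opENorm _
    _ = ‖L‖ₑ ^ 2 * ‖hmem.toLp g‖ₑ ^ 2 := mul_pow _ _ _
    _ ≤ _ := by
        gcongr
        rw [← lintegral_enorm_sq]
        refine le_trans (le_of_eq (lintegral_congr_ae ?_)) h2
        filter_upwards [hmem.coeFn_toLp] with x hx
        rw [hx]

/-- The bad part: a sum of atoms. -/
lemma IsRegularCZO.bad_part_estimate (hn : 0 < n) {L : L2 n →L[ℂ] L2 n} {K : Rn n → Rn n → ℂ}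
    {C : ℝ≥0} (hL : IsRegularCZO L K C) (S : Set (ℤ × (Fin n → ℤ)))
    (hS : Pairwise (Function.onFun Disjoint fun c : S => dcube c.1))
    (z : S → Rn n) (hz : ∀ c : S, z c ∈ dcube c.1)
    (b : L2 n) (hb : Integrable b) (hsupp : ∀ᵐ x, x ∉ ⋃ c : S, dcube c.1 → b x = 0)
    (hmean : ∀ c ∈ S, ∫ x in dcube c, b x = 0) :
    ∫⁻ x in (⋃ c : S, ball (z c) (4 * cubeDiam n c.1.1))ᶜ, ‖L b x‖ₑ ≤ C * ∫⁻ x, ‖b x‖ₑ := by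
  have hm : ∀ c : S, MeasurableSet (dcube c.1) := fun c => measurableSet_dcube _
  have hlim := (L.continuous.tendsto _).comp (tendsto_sum_cut hm hS b hsupp)
  -- The finite partial sums converge in L², so L passes through them, and Fatou reduces the claim
  -- to bounds uniform in the finite set.
  refine setLIntegral_enorm_le_of_tendsto hlim _ _ fun F => ?_
  have hatom : ∀ c : S, ∫⁻ x in (⋃ c : S, ball (z c) (4 * cubeDiam n c.1.1))ᶜ,
      ‖L (cut (dcube c.1) (hm c) b) x‖ₑ ≤ C * ∫⁻ x in dcube c.1, ‖b x‖ₑ := by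
    intro c
    have hc := coeFn_cut (dcube c.1) (hm c) b
    refine (lintegral_mono_set (compl_subset_compl.2
      (subset_iUnion (fun c : S => ball (z c) (4 * cubeDiam n c.1.1)) c))).trans ?_
    refine (hL.lintegral_atom_le hn _ ?_ (z c) (cubeDiam_pos hn c.1.1) ?_ ?_).trans (le_of_eq ?_)
    · exact (hb.indicator (hm c)).congr hc.symm
    · filter_upwards [hc] with x hx hxc
      rw [hx, indicator_of_notMem]
      exact fun h => hxc (dist_le_cubeDiam h (hz c))
    · rw [integral_congr_ae hc, integral_indicator (hm c)]
      exact hmean _ c.2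
    · congr 1
      rw [← lintegral_indicator (hm c)]
      refine lintegral_congr_ae ?_
      filter_upwards [hc] with x hx
      rw [hx, enorm_indicator_eq_indicator_enorm]
  calc ∫⁻ x in (⋃ c : S, ball (z c) (4 * cubeDiam n c.1.1))ᶜ,
        ‖L (∑ c ∈ F, cut (dcube c.1) (hm c) b) x‖ₑ
      ≤ ∫⁻ x in (⋃ c : S, ball (z c) (4 * cubeDiam n c.1.1))ᶜ,
        ∑ c ∈ F, ‖L (cut (dcube c.1) (hm c) b) x‖ₑ := by
        refine lintegral_mono_ae (ae_restrict_of_ae ?_)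
        rw [map_sum]
        filter_upwards [Lp.coeFn_finsetSum F fun c => L (cut (dcube c.1) (hm c) b)] with x hx
        rw [hx, Finset.sum_apply]
        exact enorm_sum_le _ _
    _ = ∑ c ∈ F, ∫⁻ x in (⋃ c : S, ball (z c) (4 * cubeDiam n c.1.1))ᶜ,
        ‖L (cut (dcube c.1) (hm c) b) x‖ₑ :=
        lintegral_finsetSum _ fun c _ => (Lp.stronglyMeasurable _).measurable.enorm
    _ ≤ ∑ c ∈ F, C * ∫⁻ x in dcube c.1, ‖b x‖ₑ := Finset.sum_le_sum fun c _ => hatom c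
    _ = C * ∑ c ∈ F, ∫⁻ x in dcube c.1, ‖b x‖ₑ := by rw [Finset.mul_sum]
    _ ≤ C * ∑' c : S, ∫⁻ x in dcube c.1, ‖b x‖ₑ := by gcongr; exact ENNReal.sum_le_tsum _
    _ = C * ∫⁻ x in ⋃ c : S, dcube c.1, ‖b x‖ₑ := by rw [lintegral_iUnion hm hS]
    _ ≤ _ := by gcongr; exact Measure.restrict_le_self

/-- The weak type `(1,1)` inequality with respect to Lebesgue measure. -/
lemma IsRegularCZO.exists_weak_type (hn : 0 < n) {L : L2 n →L[ℂ] L2 n} {K : Rn n → Rn n → ℂ}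
    {C : ℝ≥0} (hL : IsRegularCZO L K C) : ∃ C₁ : ℝ≥0, ∀ (φ : L2 n) (t : ℝ≥0), t ≠ 0 →
      Integrable φ → t * volume {x | (t : ℝ≥0∞) < ‖L φ x‖ₑ} ≤ C₁ * ∫⁻ x, ‖φ x‖ₑ := by
  set v : ℝ≥0 := (4 * n) ^ n * (volume (ball (0 : Rn n) 1)).toNNReal with hv
  -- The three summands come from the good part at height t/2, the union of the enlarged cubes, and
  -- the bad part at height t/2 off that union.
  refine ⟨4 * ‖L‖₊ ^ 2 * 2 ^ n + v + 4 * C, fun φ t ht hφ => ?_⟩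
  have ht' : (t : ℝ≥0∞) ≠ 0 := by exact_mod_cast ht
  set I := ∫⁻ x, ‖φ x‖ₑ with hI
  have hIt : I ≠ ∞ := hφ.2.ne
  set P := largeAverage (n := n) φ t with hP
  have hΩ := iUnion_stopCubes (exists_generation_bound_largeAverage hn ht hφ.2.ne)
  obtain ⟨g, hgm, hgA, hgI, hgo, hgc⟩ := exists_good_part hn φ hφ ht
  obtain ⟨u, hug, hu⟩ := good_part_estimate L hgm.aestronglyMeasurable (A := 2 ^ n * t)
    (by simpa using hgA) hgI hIt
  have hui : Integrable u := by
    refine Integrable.congr ⟨hgm.aestronglyMeasurable, hgI.trans_lt hIt.lt_top⟩ hug.symm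
  set b := φ - u with hb
  have hbx : b =ᵐ[volume] fun x => φ x - g x := by
    filter_upwards [Lp.coeFn_sub φ u, hug] with x h1 h2
    rw [h1, Pi.sub_apply, h2]
  have hbI : ∫⁻ x, ‖b x‖ₑ ≤ 2 * I := by
    calc ∫⁻ x, ‖b x‖ₑ ≤ ∫⁻ x, (‖φ x‖ₑ + ‖g x‖ₑ) := by
          refine lintegral_mono_ae (hbx.mono fun x hx => ?_)
          simp only [hx]
          exact enorm_sub_le
      _ = I + ∫⁻ x, ‖g x‖ₑ := lintegral_add_left (Lp.stronglyMeasurable φ).measurable.enorm _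
      _ ≤ 2 * I := by rw [two_mul]; gcongr
  choose z hz using fun c : stopCubes P => c.2.2.1
  have hbad := hL.bad_part_estimate hn (stopCubes P) (pairwise_disjoint_stopCubes P) z hz b
    ((hφ.sub hui).congr (Lp.coeFn_sub φ u).symm)
    (by
      rw [hΩ]
      filter_upwards [hbx] with x hx hxΩ
      rw [hx, hgo x hxΩ, sub_self])
    (fun c hc => by
      have hgi : Integrable g := hui.congr hug
      rw [integral_congr_ae (ae_restrict_of_ae hbx), integral_sub hφ.integrableOn
        hgi.integrableOn, (hgc c hc).1, sub_self])
  set Ω' := ⋃ c : stopCubes P, ball (z c) (4 * cubeDiam n c.1.1) with hΩ'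
  have hΩ'm : MeasurableSet Ω' := MeasurableSet.iUnion fun c => measurableSet_ball
  have hball : ∀ c : stopCubes P, volume (ball (z c) (4 * cubeDiam n c.1.1)) =
      v * volume (dcube c.1) := by
    intro c
    have := cubeDiam_pos hn c.1.1
    rw [volume_ball_eq _ (by positivity), volume_dcube, hv]
    push_cast
    rw [ENNReal.coe_toNNReal measure_ball_lt_top.ne, cubeDiam, ← mul_assoc, mul_pow,
      ENNReal.ofReal_mul (by positivity)]
    have : ENNReal.ofReal ((4 * (n : ℝ)) ^ n) = (4 * (n : ℝ≥0∞)) ^ n := by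
      rw [ENNReal.ofReal_pow (by positivity), ENNReal.ofReal_mul (by norm_num)]
      simp
    rw [this]
    ring
  have hvolΩ : t * volume Ω' ≤ v * I := by
    calc t * volume Ω' ≤ t * ∑' c : stopCubes P, volume (ball (z c) (4 * cubeDiam n c.1.1)) := by
          gcongr
          exact measure_iUnion_le _
      _ = v * ∑' c : stopCubes P, t * volume (dcube c.1) := by
          simp_rw [hball, ENNReal.tsum_mul_left]
          ring
      _ ≤ v * ∑' c : stopCubes P, ∫⁻ x in dcube c.1, ‖φ x‖ₑ := by
          gcongr with c
          exact (c.2.1).le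
      _ = v * ∫⁻ x in ⋃ c : stopCubes P, dcube c.1, ‖φ x‖ₑ := by
          rw [lintegral_iUnion (fun c => measurableSet_dcube _) (pairwise_disjoint_stopCubes P)]
      _ ≤ v * I := by gcongr; exact setLIntegral_le_lintegral _ _
  have hgood : t * volume {x | ((t / 2 : ℝ≥0) : ℝ≥0∞) < ‖L u x‖ₑ} ≤
      (4 * ‖L‖₊ ^ 2 * 2 ^ n : ℝ≥0) * I := by
    have h1 := hu (t / 2)
    have h2 : (4 : ℝ≥0∞) * ((t / 2 : ℝ≥0) : ℝ≥0∞) ^ 2 = t * t := by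
      norm_cast
      rw [div_pow]
      field_simp
      norm_num
    refine (ENNReal.mul_le_mul_iff_right ht' ENNReal.coe_ne_top).1 ?_
    calc (t : ℝ≥0∞) * (t * volume {x | ((t / 2 : ℝ≥0) : ℝ≥0∞) < ‖L u x‖ₑ})
        = 4 * (((t / 2 : ℝ≥0) : ℝ≥0∞) ^ 2 *
            volume {x | ((t / 2 : ℝ≥0) : ℝ≥0∞) < ‖L u x‖ₑ}) := by
          rw [← mul_assoc, ← h2, mul_assoc]
      _ ≤ 4 * (‖L‖ₑ ^ 2 * ((2 ^ n * t : ℝ≥0) * I)) := by gcongr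
      _ = _ := by
          push_cast
          rw [← enorm_eq_nnnorm]
          ring
  have hbadvol : t * volume ({x | ((t / 2 : ℝ≥0) : ℝ≥0∞) < ‖L b x‖ₑ} ∩ Ω'ᶜ) ≤
      (4 * C : ℝ≥0) * I := by
    have h1 := mul_meas_ge_le_lintegral (μ := volume.restrict Ω'ᶜ)
      (Lp.stronglyMeasurable (L b)).measurable.enorm ((t / 2 : ℝ≥0) : ℝ≥0∞)
    rw [Measure.restrict_apply' hΩ'm.compl] at h1
    have h2 : (t : ℝ≥0∞) = 2 * ((t / 2 : ℝ≥0) : ℝ≥0∞) := by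
      norm_cast
      field_simp
    rw [h2, mul_assoc]
    calc 2 * (((t / 2 : ℝ≥0) : ℝ≥0∞) *
          volume ({x | ((t / 2 : ℝ≥0) : ℝ≥0∞) < ‖L b x‖ₑ} ∩ Ω'ᶜ))
        ≤ 2 * (((t / 2 : ℝ≥0) : ℝ≥0∞) *
          volume ({x | ((t / 2 : ℝ≥0) : ℝ≥0∞) ≤ ‖L b x‖ₑ} ∩ Ω'ᶜ)) := by
          gcongr with x
          exact le_of_lt
      _ ≤ 2 * ∫⁻ x in Ω'ᶜ, ‖L b x‖ₑ := mul_le_mul_right h1 2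
      _ ≤ 2 * (C * (2 * I)) := mul_le_mul_right (hbad.trans (mul_le_mul_right hbI _)) 2
      _ = _ := by push_cast; ring
  have hsub : {x | (t : ℝ≥0∞) < ‖L φ x‖ₑ} ≤ᵐ[volume]
      ({x | ((t / 2 : ℝ≥0) : ℝ≥0∞) < ‖L u x‖ₑ} ∪ (Ω' ∪
        ({x | ((t / 2 : ℝ≥0) : ℝ≥0∞) < ‖L b x‖ₑ} ∩ Ω'ᶜ)) : Set (Rn n)) := by
    have e : L φ = L u + L b := by rw [← map_add, hb, add_sub_cancel]
    filter_upwards [Lp.coeFn_add (L u) (L b)] with x hx hxt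
    have hxt' : (t : ℝ≥0∞) < ‖L φ x‖ₑ := hxt
    rw [e, hx, Pi.add_apply] at hxt'
    by_contra hcon
    have hcon : ¬ x ∈ ({x | ((t / 2 : ℝ≥0) : ℝ≥0∞) < ‖L u x‖ₑ} ∪ (Ω' ∪
        ({x | ((t / 2 : ℝ≥0) : ℝ≥0∞) < ‖L b x‖ₑ} ∩ Ω'ᶜ)) : Set (Rn n)) := hcon
    simp only [mem_union, mem_inter_iff, mem_compl_iff, not_or, not_and, not_not] at hcon
    have h1 : ‖L u x‖ₑ ≤ ((t / 2 : ℝ≥0) : ℝ≥0∞) := not_lt.1 hcon.1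
    have h2 : ‖L b x‖ₑ ≤ ((t / 2 : ℝ≥0) : ℝ≥0∞) := not_lt.1 fun h => hcon.2.1 (hcon.2.2 h)
    refine absurd hxt' (not_lt.2 ((enorm_add_le _ _).trans ((add_le_add h1 h2).trans ?_)))
    norm_cast
    rw [add_halves]
  calc t * volume {x | (t : ℝ≥0∞) < ‖L φ x‖ₑ}
      ≤ t * (volume {x | ((t / 2 : ℝ≥0) : ℝ≥0∞) < ‖L u x‖ₑ} + (volume Ω' +
        volume ({x | ((t / 2 : ℝ≥0) : ℝ≥0∞) < ‖L b x‖ₑ} ∩ Ω'ᶜ))) := by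
        gcongr
        refine (measure_mono_ae hsub).trans ((measure_union_le _ _).trans ?_)
        gcongr
        exact measure_union_le _ _
    _ ≤ (4 * ‖L‖₊ ^ 2 * 2 ^ n : ℝ≥0) * I + (v * I + (4 * C : ℝ≥0) * I) := by
        rw [mul_add, mul_add]
        gcongr
    _ = _ := by push_cast; ring

/-! ### The maximal function -/

/-- The set where the centred Hardy–Littlewood maximal function of `φ` exceeds `s`. -/
def maximalSet (φ : Rn n → ℂ) (s : ℝ≥0) : Set (Rn n) :=
  {x | ∃ r : ℝ, 0 < r ∧ s * volume (ball x r) < ∫⁻ y in ball x r, ‖φ y‖ₑ}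

/-- On a ball where the average of |φ| exceeds s, A₁ gives sν(B) ≤ A∫_B|φ|dν. A disjoint Vitali
subfamily and the growth factor A·5^n for its enlargements account for the constant. -/
lemma IsA1Measure.maximalSet_le (hn : 0 < n) {ν : Measure (Rn n)} {A : ℝ≥0} (h : IsA1Measure ν A)
    {φ : Rn n → ℂ} (hφ : ∫⁻ x, ‖φ x‖ₑ ≠ ∞) {s : ℝ≥0} (hs : s ≠ 0) :
    s * ν (maximalSet φ s) ≤ (A * 5 ^ n * A : ℝ≥0) * ∫⁻ x, ‖φ x‖ₑ ∂ν := by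
  set T : Set (Rn n × ℝ) :=
    {p | 0 < p.2 ∧ s * volume (ball p.1 p.2) < ∫⁻ y in ball p.1 p.2, ‖φ y‖ₑ} with hT
  have hs' : (s : ℝ≥0∞) ≠ 0 := by exact_mod_cast hs
  have hv := measure_ball_pos volume (0 : Rn n) one_pos
  have hvt := (measure_ball_lt_top (μ := volume) (x := (0 : Rn n)) (r := 1)).ne
  set I := ∫⁻ x, ‖φ x‖ₑ with hI
  -- Vitali's lemma needs bounded radii; they are bounded since s|B| < ∫|φ|. For r ≥ 1 one may use r
  -- ≤ r^n, and smaller radii are covered by the maximum with 1.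
  have hbound : ∀ p ∈ T, p.2 ≤ max 1 (I / (s * volume (ball (0 : Rn n) 1))).toReal := by
    rintro ⟨x, r⟩ ⟨hr, hlt⟩
    rcases le_total r 1 with hr1 | hr1
    · exact hr1.trans (le_max_left _ _)
    refine le_trans ?_ (le_max_right _ _)
    dsimp only at hr hlt hr1 ⊢
    have hne : I / (s * volume (ball (0 : Rn n) 1)) ≠ ∞ :=
      ENNReal.div_ne_top hφ (mul_ne_zero hs' hv.ne')
    rw [← ENNReal.ofReal_le_iff_le_toReal hne, ENNReal.le_div_iff_mul_le
      (Or.inl (mul_ne_zero hs' hv.ne')) (Or.inl (ENNReal.mul_ne_top ENNReal.coe_ne_top hvt))]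
    calc ENNReal.ofReal r * (s * volume (ball (0 : Rn n) 1))
        ≤ ENNReal.ofReal (r ^ n) * (s * volume (ball (0 : Rn n) 1)) := by
          gcongr
          exact le_self_pow₀ hr1 hn.ne'
      _ = s * volume (ball x r) := by rw [volume_ball_eq x hr]; ring
      _ ≤ I := hlt.le.trans (setLIntegral_le_lintegral _ _)
  obtain ⟨u, huT, hud, hcov⟩ := Vitali.exists_disjoint_subfamily_covering_enlargement_closedBall
    T (fun p => p.1) (fun p => p.2) _ hbound 4 (by norm_num)
  have hud' : u.PairwiseDisjoint fun p => ball p.1 p.2 := fun p hp q hq hpq =>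
    (hud hp hq hpq).mono ball_subset_closedBall ball_subset_closedBall
  have huc : u.Countable := hud'.countable_of_isOpen (fun p _ => isOpen_ball)
    fun p hp => nonempty_ball.2 (huT hp).1
  have : Countable u := huc.to_subtype
  have hsub : maximalSet φ s ⊆ ⋃ p : u, ball p.1.1 (5 * p.1.2) := by
    rintro x ⟨r, hr, hlt⟩
    obtain ⟨q, hq, hsubq⟩ := hcov (x, r) ⟨hr, hlt⟩
    refine mem_iUnion.2 ⟨⟨q, hq⟩, ?_⟩
    have hq0 := (huT hq).1
    exact closedBall_subset_ball (by linarith) (hsubq (mem_closedBall_self hr.le))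
  have hp : ∀ p : u, s * ν (ball p.1.1 (5 * p.1.2)) ≤
      (A * 5 ^ n * A : ℝ≥0) * ∫⁻ x in ball p.1.1 p.1.2, ‖φ x‖ₑ ∂ν := by
    rintro ⟨⟨x, r⟩, hpu⟩
    obtain ⟨hr, hlt⟩ := huT hpu
    dsimp only at hr hlt ⊢
    have h1 : ν (ball x (5 * r)) ≤ A * 5 ^ n * ν (ball x r) := by
      have := h.ball_le hr (by norm_num : (0 : ℝ) < 5)
        (ball_subset_ball (x := x) (by linarith : r ≤ 5 * r))
      rwa [ENNReal.ofReal_pow (by norm_num), ENNReal.ofReal_ofNat] at this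
    have h2 : s * ν (ball x r) ≤ A * ∫⁻ y in ball x r, ‖φ y‖ₑ ∂ν := by
      refine (ENNReal.mul_le_mul_iff_left (volume_ball_ne_zero x hr) measure_ball_lt_top.ne).1 ?_
      calc s * ν (ball x r) * volume (ball x r) = ν (ball x r) * (s * volume (ball x r)) := by ring
        _ ≤ ν (ball x r) * ∫⁻ y in ball x r, ‖φ y‖ₑ := by gcongr
        _ ≤ A * volume (ball x r) * ∫⁻ y in ball x r, ‖φ y‖ₑ ∂ν := h.lintegral_le x hr _
        _ = _ := by ring
    calc s * ν (ball x (5 * r)) ≤ s * (A * 5 ^ n * ν (ball x r)) := by gcongr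
      _ = A * 5 ^ n * (s * ν (ball x r)) := by ring
      _ ≤ A * 5 ^ n * (A * ∫⁻ y in ball x r, ‖φ y‖ₑ ∂ν) := by gcongr
      _ = _ := by push_cast; ring
  calc s * ν (maximalSet φ s) ≤ s * ∑' p : u, ν (ball p.1.1 (5 * p.1.2)) := by
        gcongr
        exact (measure_mono hsub).trans (measure_iUnion_le _)
    _ = ∑' p : u, s * ν (ball p.1.1 (5 * p.1.2)) := ENNReal.tsum_mul_left.symm
    _ ≤ ∑' p : u, (A * 5 ^ n * A : ℝ≥0) * ∫⁻ x in ball p.1.1 p.1.2, ‖φ x‖ₑ ∂ν :=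
        ENNReal.tsum_le_tsum hp
    _ = (A * 5 ^ n * A : ℝ≥0) * ∫⁻ x in ⋃ p : u, ball p.1.1 p.1.2, ‖φ x‖ₑ ∂ν := by
        rw [ENNReal.tsum_mul_left, lintegral_iUnion (fun p => measurableSet_ball)]
        exact fun p q hpq => hud' p.2 q.2 fun h => hpq (Subtype.ext h)
    _ ≤ _ := mul_le_mul_right (setLIntegral_le_lintegral _ _) _

/-! ### Dyadic density sets -/

/-- `E` fills more than half of `s`. -/
def isDense (E s : Set (Rn n)) : Prop := volume s < 2 * volume (s ∩ E)

lemma exists_generation_bound_isDense (hn : 0 < n) {E : Set (Rn n)} (hE : volume E ≠ ∞) :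
    ∃ k₀ : ℤ, ∀ c : ℤ × (Fin n → ℤ), isDense E (dcube c) → k₀ ≤ c.1 := by
  obtain ⟨k₀, hk₀⟩ := exists_generation_bound hn (V := 2 * volume E)
    (ENNReal.mul_ne_top (by norm_num) hE)
  refine ⟨k₀, fun c hc => hk₀ c (hc.le.trans ?_)⟩
  gcongr
  exact inter_subset_right

lemma isDense.mono {E E' s : Set (Rn n)} (h : isDense E s) (hE : E ⊆ E') : isDense E' s :=
  lt_of_lt_of_le h (by gcongr)

/-- Lebesgue density: with tolerance 1/4 some cube through almost every point of E is three quarters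
filled, hence more than half. -/
lemma ae_mem_dyadicUnion_isDense (hn : 0 < n) {E : Set (Rn n)} (hE : MeasurableSet E) :
    ∀ᵐ x, x ∈ E → x ∈ dyadicUnion (isDense E) := by
  have hf : LocallyIntegrable (E.indicator fun _ => (1 : ℂ)) :=
    (locallyIntegrable_const 1).indicator hE
  filter_upwards [ae_dyadic_lintegral_le hn hf] with x hx hxE
  obtain ⟨k, hk⟩ := hx (1 / 4) (by norm_num)
  set Q := dcube (k, dyadicIndex k x) with hQ
  refine ⟨k, ?_⟩
  have hQ0 : volume Q ≠ 0 := volume_dcube_ne_zero _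
  have hQt : volume Q ≠ ∞ := volume_dcube_ne_top _
  have h1 : volume (Q \ E) ≤ ((1 / 4 : ℝ≥0) : ℝ≥0∞) * volume Q := by
    refine le_trans ?_ hk
    have hd : MeasurableSet (Q \ E) := (measurableSet_dcube _).diff hE
    calc volume (Q \ E) = ∫⁻ _y in Q \ E, 1 := by simp
      _ ≤ ∫⁻ y in Q \ E,
          ‖E.indicator (fun _ => (1 : ℂ)) y - E.indicator (fun _ => (1 : ℂ)) x‖ₑ := by
        refine setLIntegral_mono' hd fun y hy => ?_
        simp [indicator_of_notMem hy.2, indicator_of_mem hxE]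
      _ ≤ _ := lintegral_mono_set sdiff_subset
  have h2 : volume Q = volume (Q ∩ E) + volume (Q \ E) := (measure_inter_add_sdiff Q hE).symm
  rw [isDense, ← hQ]
  have hi : volume (Q ∩ E) ≠ ∞ := ne_top_of_le_ne_top hQt (measure_mono inter_subset_left)
  have hdt : volume (Q \ E) ≠ ∞ := ne_top_of_le_ne_top hQt (measure_mono sdiff_subset)
  generalize volume Q = p at *
  generalize volume (Q ∩ E) = a at *
  generalize volume (Q \ E) = b at *
  lift p to ℝ≥0 using hQt
  lift a to ℝ≥0 using hi
  lift b to ℝ≥0 using hdt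
  norm_cast at *
  rw [← NNReal.coe_le_coe] at h1
  rw [← NNReal.coe_lt_coe]
  rw [← NNReal.coe_inj] at h2
  have hp : (0 : ℝ) < p := lt_of_le_of_ne p.coe_nonneg (Ne.symm (by exact_mod_cast hQ0))
  push_cast at *
  linarith

/-- Comparison of a set with its dyadic density set. -/
lemma measure_dyadicUnion_isDense_le (hn : 0 < n) {ν : Measure (Rn n)} {A' : ℝ≥0}
    (hA : ∀ c : ℤ × (Fin n → ℤ), ∀ s ⊆ dcube c, MeasurableSet s →
      ν (dcube c) * volume s ≤ A' * volume (dcube c) * ν s)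
    {E : Set (Rn n)} (hE : MeasurableSet E) (hEt : volume E ≠ ∞) :
    ν (dyadicUnion (isDense E)) ≤ 2 * A' * ν E := by
  have hm : ∀ c : stopCubes (isDense E), MeasurableSet (dcube c.1) := fun c =>
    measurableSet_dcube _
  rw [← iUnion_stopCubes (exists_generation_bound_isDense hn hEt)]
  calc ν (⋃ c : stopCubes (isDense E), dcube c.1)
      ≤ ∑' c : stopCubes (isDense E), ν (dcube c.1) := measure_iUnion_le _
    _ ≤ ∑' c : stopCubes (isDense E), 2 * A' * ν.restrict E (dcube c.1) := by
        refine ENNReal.tsum_le_tsum fun c => ?_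
        rw [Measure.restrict_apply (hm c)]
        -- As E fills more than half of the maximal cube Q, A₁ yields ν(Q) ≤ 2A'ν(Q ∩ E); the
        -- disjointness of these cubes allows summation.
        have h1 := hA c.1 _ inter_subset_left ((hm c).inter hE)
        refine (ENNReal.mul_le_mul_iff_left (volume_dcube_ne_zero c.1)
          (volume_dcube_ne_top c.1)).1 ?_
        calc ν (dcube c.1) * volume (dcube c.1)
            ≤ ν (dcube c.1) * (2 * volume (dcube c.1 ∩ E)) := by
              gcongr
              exact c.2.1.le
          _ = 2 * (ν (dcube c.1) * volume (dcube c.1 ∩ E)) := by ring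
          _ ≤ 2 * (A' * volume (dcube c.1) * ν (dcube c.1 ∩ E)) := by gcongr
          _ = _ := by ring
    _ = 2 * A' * ν.restrict E (⋃ c : stopCubes (isDense E), dcube c.1) := by
        rw [ENNReal.tsum_mul_left, measure_iUnion (pairwise_disjoint_stopCubes _) hm]
    _ ≤ _ := mul_le_mul_right
        ((measure_mono (subset_univ _)).trans_eq (Measure.restrict_apply_univ E)) _

/-- If `E'` fills little of a maximal cube of the density set of `E ⊇ E'`, then so does its
density set. -/
lemma volume_inter_dyadicUnion_le (hn : 0 < n) {E E' : Set (Rn n)} (hE' : MeasurableSet E')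
    (hE't : volume E' ≠ ∞) (hsub : E' ⊆ E) {c : ℤ × (Fin n → ℤ)}
    (hc : c ∈ stopCubes (isDense E)) :
    volume (dcube c ∩ dyadicUnion (isDense E')) ≤ 2 * volume (dcube c ∩ E') := by
  set S'' := {c' : stopCubes (isDense E') // dcube c'.1 ⊆ dcube c} with hS''
  have hm : ∀ c' : S'', MeasurableSet (dcube c'.1.1) := fun c' => measurableSet_dcube _
  have hcov : dcube c ∩ dyadicUnion (isDense E') ⊆ ⋃ c' : S'', dcube c'.1.1 := by
    rintro x ⟨hxc, hxD⟩
    rw [← iUnion_stopCubes (exists_generation_bound_isDense hn hE't)] at hxD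
    obtain ⟨c', hxc'⟩ := mem_iUnion.1 hxD
    refine mem_iUnion.2 ⟨⟨c', ?_⟩, hxc'⟩
    obtain ⟨⟨k', m'⟩, hc'⟩ := c'
    obtain ⟨k, m⟩ := c
    have e : m = dyadicIndex k x := (mem_dcube.1 hxc).symm
    have e' : m' = dyadicIndex k' x := (mem_dcube.1 hxc').symm
    subst e e'
    refine dcube_subset_of_le ?_ x
    -- A strictly coarser cube dense for E' would be dense for E, contradicting the maximality of c.
    by_contra! hlt
    exact hc.2.2 k' hlt x hxc (hc'.1.mono hsub)
  calc volume (dcube c ∩ dyadicUnion (isDense E'))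
      ≤ ∑' c' : S'', volume (dcube c'.1.1) := (measure_mono hcov).trans (measure_iUnion_le _)
    _ ≤ ∑' c' : S'', 2 * volume (dcube c'.1.1 ∩ E') :=
        ENNReal.tsum_le_tsum fun c' => c'.1.2.1.le
    _ = 2 * volume (⋃ c' : S'', dcube c'.1.1 ∩ E') := by
        rw [ENNReal.tsum_mul_left, measure_iUnion _ fun c' => (hm c').inter hE']
        intro p q hpq
        exact (pairwise_disjoint_stopCubes _ fun h => hpq (Subtype.ext h)).mono
          inter_subset_left inter_subset_left
    _ ≤ _ := by
        gcongr
        exact iUnion_subset fun c' => inter_subset_inter_left _ c'.2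

/-! ### Level sets and the local good-λ estimate -/

lemma coe_lt_enorm_iff {t : ℝ≥0} {z : ℂ} : (t : ℝ≥0∞) < ‖z‖ₑ ↔ (t : ℝ) < ‖z‖ := by
  rw [enorm_eq_nnnorm, ENNReal.coe_lt_coe, ← NNReal.coe_lt_coe, coe_nnnorm]

lemma enorm_le_coe_iff {t : ℝ≥0} {z : ℂ} : ‖z‖ₑ ≤ (t : ℝ≥0∞) ↔ ‖z‖ ≤ (t : ℝ) := by
  rw [enorm_eq_nnnorm, ENNReal.coe_le_coe, ← NNReal.coe_le_coe, coe_nnnorm]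

/-- The level set of `u`. -/
def levelSet (u : L2 n) (t : ℝ≥0) : Set (Rn n) := {x | (t : ℝ≥0∞) < ‖u x‖ₑ}

lemma measurableSet_levelSet (u : L2 n) (t : ℝ≥0) : MeasurableSet (levelSet u t) :=
  measurableSet_lt measurable_const (Lp.stronglyMeasurable u).measurable.enorm

lemma volume_levelSet_ne_top (u : L2 n) {t : ℝ≥0} (ht : t ≠ 0) : volume (levelSet u t) ≠ ∞ := by
  intro h
  have h1 := mul_measure_lt_enorm_le u t
  have ht' : (t : ℝ≥0∞) ^ 2 ≠ 0 := pow_ne_zero 2 (by exact_mod_cast ht)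
  change (t : ℝ≥0∞) ^ 2 * volume (levelSet u t) ≤ _ at h1
  rw [h, ENNReal.mul_top ht'] at h1
  exact ENNReal.pow_ne_top enorm_ne_top (top_le_iff.1 h1)

/-- The local part of the good-`λ` argument. -/
lemma IsRegularCZO.exists_local_good_lambda (hn : 0 < n) {L : L2 n →L[ℂ] L2 n}
    {K : Rn n → Rn n → ℂ} {C : ℝ≥0} (hL : IsRegularCZO L K C) {κ : ℝ≥0} (hκ : κ ≠ 0) :
    ∃ γ : ℝ≥0, γ ≠ 0 ∧ ∀ (φ : L2 n) (t : ℝ≥0), t ≠ 0 → Integrable φ →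
      ∀ c ∈ stopCubes (isDense (levelSet (L φ) t)), ∀ x₀ ∈ dcube c,
        x₀ ∉ maximalSet φ (γ * t) →
        4 * volume (dcube c ∩ levelSet (L φ) ((1 + κ) * t)) ≤ volume (dcube c) := by
  obtain ⟨C₁, hC₁⟩ := hL.exists_weak_type hn
  set M : ℝ≥0 := (8 * n) ^ n * (volume (ball (0 : Rn n) 1)).toNNReal with hM
  -- Small enough that the far part oscillates by at most κt/8 (from 8Cγ ≤ κ) and that the local
  -- part exceeds κt/8 on at most a quarter of |Q| (from 32C₁Mγ ≤ κ). M is the volume ratio of B(x₀,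
  -- 4d) to Q, with d belonging to the parent.
  set γ : ℝ≥0 := κ / (8 * C + 32 * C₁ * M + 1) with hγ
  have hden : (0 : ℝ≥0) < 8 * C + 32 * C₁ * M + 1 := by positivity
  have hκpos : 0 < κ := pos_iff_ne_zero.2 hκ
  have hγκ : γ * (8 * C + 32 * C₁ * M + 1) = κ := div_mul_cancel₀ _ hden.ne'
  have hγC : 8 * (C * γ) ≤ κ := by
    rw [← hγκ, ← mul_assoc, mul_comm]
    gcongr
    exact le_add_right le_self_add
  have hγM : 32 * C₁ * M * γ ≤ κ := by
    rw [← hγκ, mul_comm]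
    gcongr
    exact le_add_right le_add_self
  refine ⟨γ, (div_pos hκpos hden).ne', fun φ t ht hφ c hc x₀ hx₀ hmax => ?_⟩
  obtain ⟨k, m⟩ := c
  have e : m = dyadicIndex k x₀ := (mem_dcube.1 hx₀).symm
  subst e
  set Q := dcube (k, dyadicIndex k x₀) with hQ
  set Q' := dcube (k - 1, dyadicIndex (k - 1) x₀) with hQ'
  have hQQ' : Q ⊆ Q' := dcube_subset_of_le (by omega) x₀
  have hvQ' : volume Q' = 2 ^ n * volume Q := volume_dcube_pred _ _ _
  set d := cubeDiam n (k - 1) with hd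
  have hdpos : 0 < d := cubeDiam_pos hn _
  have hdist : ∀ x ∈ Q', dist x x₀ ≤ d := fun x hx => dist_le_cubeDiam hx (mem_dcube_self _ _)
  have hmax' : ∀ r, 0 < r → ∫⁻ y in ball x₀ r, ‖φ y‖ₑ ≤ (γ * t : ℝ≥0) * volume (ball x₀ r) :=
    fun r hr => not_lt.1 fun h => hmax ⟨r, hr, h⟩
  set B := ball x₀ (4 * d) with hB
  have hBm : MeasurableSet B := measurableSet_ball
  set f₁ := cut B hBm φ with hf₁
  set f₂ := cut Bᶜ hBm.compl φ with hf₂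
  have h₁ := coeFn_cut B hBm φ
  have h₂ := coeFn_cut Bᶜ hBm.compl φ
  have hsum : φ = f₁ + f₂ := by
    refine Lp.ext ?_
    filter_upwards [h₁, h₂, Lp.coeFn_add f₁ f₂] with x hx₁ hx₂ hx
    rw [hx, Pi.add_apply, hx₁, hx₂, indicator_self_add_compl_apply]
  have h₂0 : ∀ᵐ y, y ∈ B → f₂ y = 0 := by
    filter_upwards [h₂] with y hy hyB
    rw [hy, indicator_of_notMem (notMem_compl_iff.2 hyB)]
  have hLsum : ∀ᵐ x, L φ x = L f₁ x + L f₂ x := by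
    rw [hsum, map_add]
    exact Lp.coeFn_add _ _
  -- the far part is nearly constant on the cube
  set I₀ := ∫ y, K x₀ y * f₂ y with hI₀
  have hint : ∀ x ∈ Q', Integrable fun y => K x y * f₂ y := fun x hx =>
    integrable_kernel_mul hn hL (Lp.memLp f₂) (by positivity : 0 < 3 * d)
      (h₂0.mono fun y hy hyx => hy (by
        rw [mem_ball] at hyx ⊢
        linarith [dist_triangle y x x₀, hdist x hx]))
  have hosc : ∀ᵐ x, x ∈ Q' → ‖L f₂ x - I₀‖ ≤ (κ / 8 * t : ℝ≥0) := by
    filter_upwards [hL.repr f₂ B isOpen_ball h₂0] with x hx hxQ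
    have hxB : x ∈ B := mem_ball.2 ((hdist x hxQ).trans_lt (by linarith))
    rw [hx hxB, hI₀, ← integral_sub (hint x hxQ) (hint x₀ (mem_dcube_self _ _)),
      ← enorm_le_coe_iff]
    refine (enorm_integral_le_lintegral_enorm _).trans ?_
    calc ∫⁻ y, ‖K x y * f₂ y - K x₀ y * f₂ y‖ₑ
        = ∫⁻ y in Bᶜ, ‖K x y - K x₀ y‖ₑ * ‖φ y‖ₑ := by
          rw [← lintegral_indicator hBm.compl]
          refine lintegral_congr_ae ?_
          filter_upwards [h₂] with y hy
          rw [hy, ← sub_mul, enorm_mul]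
          by_cases hyB : y ∈ Bᶜ
          · simp only [indicator_of_mem hyB]
          · simp only [indicator_of_notMem hyB, enorm_zero, mul_zero]
      _ ≤ C * (γ * t : ℝ≥0) :=
          hL.diff_left x₀ d x hdpos (hdist x hxQ) (fun y => ‖φ y‖ₑ) _ hmax'
      _ ≤ _ := by
          rw [← ENNReal.coe_mul, ENNReal.coe_le_coe, ← mul_assoc]
          gcongr
          rw [le_div_iff₀ (by norm_num), mul_comm]
          exact hγC
  -- the local part is small off a small set
  have hf₁i : Integrable f₁ := (hφ.indicator hBm).congr h₁.symm
  have hκt : κ / 8 * t ≠ 0 := mul_ne_zero (div_ne_zero hκ (by norm_num)) ht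
  have hlocal : 4 * volume (levelSet (L f₁) (κ / 8 * t)) ≤ volume Q := by
    have hw := hC₁ f₁ (κ / 8 * t) hκt hf₁i
    have hI₁ : ∫⁻ x, ‖f₁ x‖ₑ = ∫⁻ x in B, ‖φ x‖ₑ := by
      rw [← lintegral_indicator hBm]
      refine lintegral_congr_ae ?_
      filter_upwards [h₁] with x hx
      rw [hx, enorm_indicator_eq_indicator_enorm]
    have hvB : volume B = M * volume Q := by
      rw [hB, volume_ball_eq _ (by positivity), hQ, volume_dcube, hM]
      push_cast
      have e2 : (2 : ℝ) ^ (-(k - 1)) = 2 * 2 ^ (-k) := by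
        rw [neg_sub, sub_eq_add_neg, zpow_add₀ (by norm_num), zpow_one]
      rw [ENNReal.coe_toNNReal measure_ball_lt_top.ne, hd, cubeDiam, e2]
      have : (4 * ((n : ℝ) * (2 * 2 ^ (-k)))) ^ n = (8 * n) ^ n * (2 ^ (-k)) ^ n := by
        rw [← mul_pow]
        ring
      rw [this, ENNReal.ofReal_mul (by positivity)]
      have : ENNReal.ofReal ((8 * (n : ℝ)) ^ n) = (8 * (n : ℝ≥0∞)) ^ n := by
        rw [ENNReal.ofReal_pow (by positivity), ENNReal.ofReal_mul (by norm_num)]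
        simp
      rw [this]
      ring
    refine (ENNReal.mul_le_mul_iff_right (a := ((κ / 8 * t : ℝ≥0) : ℝ≥0∞))
      (by exact_mod_cast hκt) ENNReal.coe_ne_top).1 ?_
    calc ((κ / 8 * t : ℝ≥0) : ℝ≥0∞) * (4 * volume (levelSet (L f₁) (κ / 8 * t)))
        = 4 * (((κ / 8 * t : ℝ≥0) : ℝ≥0∞) * volume (levelSet (L f₁) (κ / 8 * t))) := by ring
      _ ≤ 4 * (C₁ * ((γ * t : ℝ≥0) * (M * volume Q))) := by
          rw [← hvB]
          refine mul_le_mul_right (hw.trans (mul_le_mul_right ?_ _)) _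
          rw [hI₁]
          exact hmax' _ (by positivity)
      _ = ((4 * (C₁ * (γ * t * M)) : ℝ≥0) : ℝ≥0∞) * volume Q := by push_cast; ring
      _ ≤ _ := by
          refine mul_le_mul_left (ENNReal.coe_le_coe.2 ?_) _
          calc 4 * (C₁ * (γ * t * M)) = (32 * C₁ * M * γ) / 8 * t := by
                field_simp
                ring
            _ ≤ _ := by gcongr
  -- a point of the parent where everything is under control
  have hparent : ¬ isDense (levelSet (L φ) t) Q' := hc.2.2 (k - 1) (by simp) x₀ hx₀
  have hI₀le : ‖I₀‖ ≤ t + κ / 4 * t := by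
    -- The level set takes at most half of the parent and the bad set of the local part at most a
    -- quarter, so the good points have positive measure.
    have hfreq : ∃ᶠ x in ae volume, x ∈ Q' ∧ x ∉ levelSet (L φ) t ∧
        x ∉ levelSet (L f₁) (κ / 8 * t) := by
      intro hcon
      have hle : Q' ≤ᵐ[volume] (Q' ∩ levelSet (L φ) t ∪ levelSet (L f₁) (κ / 8 * t) :
          Set (Rn n)) := by
        filter_upwards [hcon] with x hx hxQ
        by_contra h
        have h' : ¬ (x ∈ Q' ∩ levelSet (L φ) t ∪ levelSet (L f₁) (κ / 8 * t)) := h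
        rw [mem_union, mem_inter_iff, not_or] at h'
        exact hx ⟨hxQ, fun h => h'.1 ⟨hxQ, h⟩, h'.2⟩
      have h4 := (measure_mono_ae hle).trans (measure_union_le _ _)
      rw [isDense, not_lt] at hparent
      have h5 : 4 * volume (levelSet (L f₁) (κ / 8 * t)) ≤ volume Q' :=
        hlocal.trans (measure_mono hQQ')
      have h6 : 4 * volume Q' ≤ 3 * volume Q' := by
        calc 4 * volume Q' ≤ 4 * (volume (Q' ∩ levelSet (L φ) t) +
              volume (levelSet (L f₁) (κ / 8 * t))) := by gcongr
          _ = 2 * (2 * volume (Q' ∩ levelSet (L φ) t)) +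
              4 * volume (levelSet (L f₁) (κ / 8 * t)) := by ring
          _ ≤ 2 * volume Q' + volume Q' := by gcongr
          _ = 3 * volume Q' := by ring
      rw [ENNReal.mul_le_mul_iff_left (volume_dcube_ne_zero _) (volume_dcube_ne_top _)] at h6
      norm_num at h6
    obtain ⟨x, ⟨hxQ, hx1, hx2⟩, hx3, hx4⟩ := (hfreq.and_eventually (hosc.and hLsum)).exists
    have hx1' : ‖L φ x‖ ≤ t := enorm_le_coe_iff.1 (not_lt.1 hx1)
    have hx2' : ‖L f₁ x‖ ≤ (κ / 8 * t : ℝ≥0) := enorm_le_coe_iff.1 (not_lt.1 hx2)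
    have hx3' := hx3 hxQ
    have e3 : I₀ = L φ x - L f₁ x - (L f₂ x - I₀) := by rw [hx4]; ring
    rw [e3]
    refine (norm_sub_le _ _).trans ((add_le_add_left (norm_sub_le _ _) _).trans ?_)
    push_cast at hx2' hx3'
    linarith
  -- Of the height (1+κ)t, at most (1+κ/4)t comes from I₀ and κt/8 from the oscillation. The local
  -- part must then exceed 5κt/8, hence κt/8.
  have hsub : (Q ∩ levelSet (L φ) ((1 + κ) * t) : Set (Rn n)) ≤ᵐ[volume]
      levelSet (L f₁) (κ / 8 * t) := by
    filter_upwards [hosc, hLsum] with x hx3 hx4 hx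
    obtain ⟨hxQ, hxl⟩ : x ∈ Q ∩ levelSet (L φ) ((1 + κ) * t) := hx
    have hxl' : (((1 + κ) * t : ℝ≥0) : ℝ) < ‖L φ x‖ := coe_lt_enorm_iff.1 hxl
    show ((κ / 8 * t : ℝ≥0) : ℝ≥0∞) < ‖L f₁ x‖ₑ
    rw [coe_lt_enorm_iff]
    have hx3' := hx3 (hQQ' hxQ)
    have e3 : L φ x = L f₁ x + (L f₂ x - I₀) + I₀ := by rw [hx4]; ring
    rw [e3] at hxl'
    have := (norm_add_le (L f₁ x + (L f₂ x - I₀)) I₀).trans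
      (add_le_add_left (norm_add_le _ _) _)
    push_cast at hxl' hx3' ⊢
    have hp : (0 : ℝ) < κ * t := by positivity
    linarith
  exact (mul_le_mul_right (measure_mono_ae hsub) 4).trans hlocal

/-! ### The weighted weak type `(1,1)` inequality -/

/-- The good-`λ` inequality. -/
lemma IsRegularCZO.exists_good_lambda (hn : 0 < n) {L : L2 n →L[ℂ] L2 n}
    {K : Rn n → Rn n → ℂ} {C : ℝ≥0} (hL : IsRegularCZO L K C) {ν : Measure (Rn n)} {A : ℝ≥0}
    (hν : IsA1Measure ν A) :
    ∃ κ γ η : ℝ≥0, γ ≠ 0 ∧ (1 + κ) * η < 1 ∧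
      ∀ (φ : L2 n) (t : ℝ≥0), t ≠ 0 → Integrable φ →
        ν (dyadicUnion (isDense (levelSet (L φ) ((1 + κ) * t)))) ≤
          η * ν (dyadicUnion (isDense (levelSet (L φ) t))) + ν (maximalSet φ (γ * t)) := by
  obtain ⟨A', hA'1, hA'⟩ := hν.exists_dcube_le hn
  set ε : ℝ≥0 := 1 / (2 * A') with hε
  have hA'0 : 0 < A' := lt_of_lt_of_le one_pos hA'1
  have hε0 : 0 < ε := by positivity
  have hε1 : ε ≤ 1 := by
    rw [hε, div_le_iff₀ (by positivity), one_mul]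
    calc (1 : ℝ≥0) ≤ 2 * 1 := by norm_num
      _ ≤ 2 * A' := by gcongr
  obtain ⟨γ, hγ, hloc⟩ := hL.exists_local_good_lambda hn hε0.ne'
  -- The same ε = 1/(2A') serves as height increment and as lost share of mass, and (1+ε)(1-ε) =
  -- 1-ε² < 1.
  refine ⟨ε, γ, 1 - ε, hγ, ?_, fun φ t ht hφ => ?_⟩
  · rw [← NNReal.coe_lt_coe]
    push_cast [NNReal.coe_sub hε1]
    have : (0 : ℝ) < ε := hε0
    nlinarith
  set E := levelSet (L φ) t with hE
  set E' := levelSet (L φ) ((1 + ε) * t) with hE'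
  set U := maximalSet (n := n) φ (γ * t) with hU
  have ht' : (1 + ε) * t ≠ 0 := mul_ne_zero (by positivity) ht
  have hE'E : E' ⊆ E := fun x hx => by
    refine lt_of_le_of_lt ?_ (show (((1 + ε) * t : ℝ≥0) : ℝ≥0∞) < ‖L φ x‖ₑ from hx)
    exact ENNReal.coe_le_coe.2 (le_mul_of_one_le_left zero_le le_self_add)
  have hm : ∀ c : stopCubes (isDense E), MeasurableSet (dcube c.1) := fun c =>
    measurableSet_dcube _
  have hcov := iUnion_stopCubes
    (exists_generation_bound_isDense hn (volume_levelSet_ne_top (L φ) ht))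
  have hD'm := measurableSet_dyadicUnion (isDense E')
  have hD'D : dyadicUnion (isDense E') ⊆ ⋃ c : stopCubes (isDense E), dcube c.1 := by
    rw [hcov]
    exact fun x ⟨k, hk⟩ => ⟨k, hk.mono hE'E⟩
  have hcube : ∀ c : stopCubes (isDense E), ν (dcube c.1 ∩ dyadicUnion (isDense E')) ≤
      (1 - ε : ℝ≥0) * ν (dcube c.1) + ν.restrict U (dcube c.1) := by
    intro c
    -- A cube inside the maximal set is charged to it entirely; any other contains a point to which
    -- the local estimate applies.
    by_cases hcU : dcube c.1 ⊆ U
    · refine le_add_left ?_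
      rw [Measure.restrict_apply (hm c), inter_eq_self_of_subset_left hcU]
      exact measure_mono inter_subset_left
    · refine le_add_right ?_
      obtain ⟨x₀, hx₀, hx₀U⟩ := not_subset.1 hcU
      have h4 := hloc φ t ht hφ c.1 c.2 x₀ hx₀ hx₀U
      have h2 := volume_inter_dyadicUnion_le hn (measurableSet_levelSet (L φ) ((1 + ε) * t))
        (volume_levelSet_ne_top (L φ) ht') hE'E c.2
      refine measure_diff_le_of_half hA'1 ((hm c).inter hD'm) inter_subset_left
        (volume_dcube_ne_zero _) (volume_dcube_ne_top _) (hν.dcube_ne_top hn _)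
        (hA' c.1 _ sdiff_subset ((hm c).diff ((hm c).inter hD'm))) ?_
      rw [ENNReal.le_div_iff_mul_le (by simp) (by simp)]
      calc volume (dcube c.1 ∩ dyadicUnion (isDense E')) * 2
          ≤ (2 * volume (dcube c.1 ∩ E')) * 2 := by gcongr
        _ = 4 * volume (dcube c.1 ∩ E') := by ring
        _ ≤ _ := h4
  calc ν (dyadicUnion (isDense E'))
      = ν (⋃ c : stopCubes (isDense E), dcube c.1 ∩ dyadicUnion (isDense E')) := by
        rw [← iUnion_inter, inter_eq_self_of_subset_right hD'D]
    _ ≤ ∑' c : stopCubes (isDense E), ν (dcube c.1 ∩ dyadicUnion (isDense E')) :=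
        measure_iUnion_le _
    _ ≤ ∑' c : stopCubes (isDense E),
        ((1 - ε : ℝ≥0) * ν (dcube c.1) + ν.restrict U (dcube c.1)) :=
        ENNReal.tsum_le_tsum hcube
    _ = (1 - ε : ℝ≥0) * ν (dyadicUnion (isDense E)) +
        ν.restrict U (dyadicUnion (isDense E)) := by
        rw [ENNReal.tsum_add, ENNReal.tsum_mul_left,
          ← measure_iUnion (pairwise_disjoint_stopCubes _) hm,
          ← measure_iUnion (pairwise_disjoint_stopCubes _) hm, hcov]
    _ ≤ _ := add_le_add_right
        ((measure_mono (subset_univ _)).trans_eq (Measure.restrict_apply_univ U)) _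

/-- A priori bound of the distribution function for functions of bounded support. -/
lemma IsRegularCZO.exists_a_priori_bound {L : L2 n →L[ℂ] L2 n}
    (hn : 0 < n) {K : Rn n → Rn n → ℂ} {C : ℝ≥0} (hL : IsRegularCZO L K C) {ν : Measure (Rn n)}
    {A : ℝ≥0} (hν : IsA1Measure ν A) (φ : L2 n) (hφ : Integrable φ) {R : ℝ} (hR : 1 ≤ R)
    (hsupp : ∀ᵐ x, x ∉ closedBall 0 R → φ x = 0) (Λ : ℝ≥0) :
    ∃ B : ℝ≥0∞, B ≠ ∞ ∧ ∀ t : ℝ≥0, t ≠ 0 → t ≤ Λ → t * ν (levelSet (L φ) t) ≤ B := by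
  set J : ℝ := ∫ x, ‖φ x‖ with hJ
  have hJ0 : 0 ≤ J := integral_nonneg fun x => norm_nonneg _
  set M : ℝ := C * 2 ^ n * J + (2 * R) ^ n * Λ with hM
  have hM0 : 0 ≤ M := by positivity
  have hdecay : ∀ᵐ x, 2 * R ≤ ‖x‖ → ‖L φ x‖ ≤ C * 2 ^ n * J / ‖x‖ ^ n := by
    filter_upwards [hL.repr φ _ isClosed_closedBall.isOpen_compl hsupp] with x hx hxR
    have hxp : 0 < ‖x‖ := by linarith
    rw [hx (by
      simp only [mem_compl_iff, mem_closedBall, dist_zero_right, not_le]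
      linarith)]
    calc ‖∫ y, K x y * φ y‖ ≤ ∫ y, C * 2 ^ n / ‖x‖ ^ n * ‖φ y‖ := by
          refine norm_integral_le_of_norm_le (hφ.norm.const_mul _) ?_
          filter_upwards [hsupp] with y hy
          by_cases hyR : y ∈ closedBall 0 R
          · rw [norm_mul]
            gcongr
            rw [mem_closedBall, dist_zero_right] at hyR
            have h1 : ‖x‖ / 2 ≤ ‖x - y‖ := by linarith [norm_sub_norm_le x y]
            have hxy : x ≠ y := by
              rintro rfl
              rw [sub_self, norm_zero] at h1
              linarith
            refine (hL.size x y hxy).trans ?_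
            calc (C : ℝ) / ‖x - y‖ ^ n ≤ C / (‖x‖ / 2) ^ n := by gcongr
              _ = _ := by rw [div_pow]; field_simp
          · simp [hy hyR]
      _ = _ := by rw [integral_const_mul]; ring
  refine ⟨A * ENNReal.ofReal M * ν (ball 0 1), ENNReal.mul_ne_top (ENNReal.mul_ne_top
    ENNReal.coe_ne_top ENNReal.ofReal_ne_top) (hν.fin _ _), fun t ht htΛ => ?_⟩
  have htpos : (0 : ℝ) < t := by exact_mod_cast pos_iff_ne_zero.2 ht
  have htΛ' : (t : ℝ) ≤ Λ := by exact_mod_cast htΛ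
  -- The radius at which M/|x|^n equals t; beyond it |Lφ| ≤ t, while ν(B(0, ρ)) is at most a
  -- constant times ρ^n = M/t.
  set ρ : ℝ := (M / t) ^ (n⁻¹ : ℝ) with hρ
  have hρn : ρ ^ n = M / t := Real.rpow_inv_natCast_pow (by positivity) hn.ne'
  have hρ0 : 0 ≤ ρ := by positivity
  have hρR : 2 * R ≤ ρ := by
    refine le_of_pow_le_pow_left₀ hn.ne' hρ0 ?_
    rw [hρn, le_div_iff₀ htpos, hM]
    have : (2 * R) ^ n * t ≤ (2 * R) ^ n * Λ := by gcongr
    have : 0 ≤ C * 2 ^ n * J := by positivity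
    linarith
  have hsub : levelSet (L φ) t ≤ᵐ[volume] ball 0 ρ := by
    filter_upwards [hdecay] with x hx hxt
    by_contra hxρ
    have hxρ' : ρ ≤ ‖x‖ := by
      have : ¬ x ∈ ball (0 : Rn n) ρ := hxρ
      simpa using this
    have h1 : (t : ℝ) < ‖L φ x‖ := coe_lt_enorm_iff.1 hxt
    have h2 := hx (hρR.trans hxρ')
    have hρp : 0 < ρ := by linarith
    have h3 : C * 2 ^ n * J / ‖x‖ ^ n ≤ M / ρ ^ n := by
      gcongr
      rw [hM]
      have : (0 : ℝ) ≤ (2 * R) ^ n * Λ := by positivity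
      linarith
    have h4 : M / ρ ^ n = t := by
      have hMp : 0 < M := by
        have : 0 < M / t := by rw [← hρn]; positivity
        exact (div_pos_iff_of_pos_right htpos).1 this
      rw [hρn]
      field_simp
    linarith
  have hball : ν (ball 0 ρ) ≤ A * ENNReal.ofReal (ρ ^ n) * ν (ball 0 1) := by
    have := hν.ball_le (y := 0) (z := 0) one_pos (by linarith : 0 < ρ)
      (ball_subset_ball (by linarith))
    rwa [mul_one] at this
  calc t * ν (levelSet (L φ) t) ≤ t * (A * ENNReal.ofReal (ρ ^ n) * ν (ball 0 1)) := by
        gcongr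
        exact (measure_mono_ae (hν.ac.ae_le hsub)).trans hball
    _ = A * (ENNReal.ofReal t * ENNReal.ofReal (ρ ^ n)) * ν (ball 0 1) := by
        rw [ENNReal.ofReal_coe_nnreal]
        ring
    _ = _ := by
        rw [← ENNReal.ofReal_mul htpos.le, hρn, mul_div_cancel₀ _ htpos.ne']

/-- Let Y be the supremum of X over (0,t]. Writing s = l·(s/l) with s/l ≤ s shows Y ≤ ρY + b. Since
Y is finite, the term ρY can be absorbed, and bounds on bounded ranges of t suffice. -/
lemma le_of_contraction {X : ℝ≥0 → ℝ≥0∞} {l ρ : ℝ≥0} {b : ℝ≥0∞} (hl : 1 ≤ l) (hρ : ρ < 1)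
    (hX : ∀ t, t ≠ 0 → X (l * t) ≤ ρ * X t + b)
    (hB : ∀ Λ : ℝ≥0, ∃ B : ℝ≥0∞, B ≠ ∞ ∧ ∀ t, t ≠ 0 → t ≤ Λ → X t ≤ B) (t : ℝ≥0) (ht : t ≠ 0) :
    X t ≤ (1 - ρ : ℝ≥0)⁻¹ * b := by
  have hρ' : (1 - ρ : ℝ≥0) ≠ 0 := (tsub_pos_of_lt hρ).ne'
  rcases eq_or_ne b ∞ with rfl | hb
  · rw [ENNReal.mul_top (by simpa using hρ')]
    exact le_top
  obtain ⟨B, hBt, hB⟩ := hB t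
  have hl0 : l ≠ 0 := (lt_of_lt_of_le one_pos hl).ne'
  set Y : ℝ≥0∞ := ⨆ (s : ℝ≥0) (_ : s ≠ 0 ∧ s ≤ t), X s with hY
  have hYB : Y ≤ B := iSup₂_le fun s hs => hB s hs.1 hs.2
  have hYY : Y ≤ ρ * Y + b := by
    refine iSup₂_le fun s hs => ?_
    have h1 := hX (s / l) (div_ne_zero hs.1 hl0)
    rw [mul_div_cancel₀ _ hl0] at h1
    refine h1.trans ?_
    gcongr
    exact le_iSup₂_of_le (s / l) ⟨div_ne_zero hs.1 hl0, (div_le_self zero_le hl).trans hs.2⟩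
      le_rfl
  have hXY : X t ≤ Y := le_iSup₂_of_le t ⟨ht, le_rfl⟩ le_rfl
  refine hXY.trans ?_
  have hYt : Y ≠ ∞ := ne_top_of_le_ne_top hBt hYB
  clear_value Y
  clear hXY hY
  lift Y to ℝ≥0 using hYt
  lift b to ℝ≥0 using hb
  norm_cast at hYY ⊢
  rw [← NNReal.coe_le_coe] at hYY ⊢
  push_cast [NNReal.coe_sub hρ.le] at hYY ⊢
  have : (0 : ℝ) < 1 - ρ := sub_pos.2 (by exact_mod_cast hρ)
  rw [le_inv_mul_iff₀ this]
  linarith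

/-- Strict inequalities are open: a point of the limit's level set eventually lies in those of the
sequence. These tails increase, so continuity from below applies. -/
lemma measure_lt_enorm_le_of_tendsto {ν : Measure (Rn n)} {F : ℕ → Rn n → ℂ} {f : Rn n → ℂ}
    (h : ∀ᵐ x ∂ν, Tendsto (fun j => F j x) atTop (𝓝 (f x))) (t : ℝ≥0∞) (M : ℝ≥0∞)
    (hM : ∀ᶠ j in atTop, ν {x | t < ‖F j x‖ₑ} ≤ M) : ν {x | t < ‖f x‖ₑ} ≤ M := by
  obtain ⟨N₀, hN₀⟩ := eventually_atTop.1 hM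
  have hle : {x | t < ‖f x‖ₑ} ≤ᵐ[ν] ⋃ N : ℕ, ⋂ j ≥ N, {x | t < ‖F j x‖ₑ} := by
    filter_upwards [h] with x hx hxt
    obtain ⟨N, hN⟩ := eventually_atTop.1 (hx.enorm.eventually (lt_mem_nhds hxt))
    exact mem_iUnion.2 ⟨N, mem_iInter₂.2 fun j hj => hN j hj⟩
  refine (measure_mono_ae hle).trans ?_
  rw [Monotone.measure_iUnion]
  · refine iSup_le fun N => le_trans (measure_mono ?_) (hN₀ (max N N₀) (le_max_right _ _))
    exact biInter_subset_of_mem (le_max_left N N₀ : max N N₀ ≥ N)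
  · intro N N' hNN'
    exact biInter_subset_biInter_left fun j hj => le_trans hNN' hj

/-- Calderón–Zygmund operators are of weighted weak type `(1,1)` for `A₁` weights. -/
lemma IsRegularCZO.exists_weighted_weak_type (hn : 0 < n) {L : L2 n →L[ℂ] L2 n}
    {K : Rn n → Rn n → ℂ} {C : ℝ≥0} (hL : IsRegularCZO L K C) {ν : Measure (Rn n)} {A : ℝ≥0}
    (hν : IsA1Measure ν A) : ∃ C₁ : ℝ≥0, ∀ (φ : L2 n) (t : ℝ≥0),
      t * ν {x | (t : ℝ≥0∞) < ‖L φ x‖ₑ} ≤ C₁ * ∫⁻ x, ‖φ x‖ₑ ∂ν := by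
  obtain ⟨κ, γ, η, hγ, hη, hgl⟩ := hL.exists_good_lambda hn hν
  set A₁ : ℝ≥0 := A * 5 ^ n * A with hA₁
  -- The first factor comes from absorption, the second from the maximal inequality at height γt
  -- rescaled to (1+κ)t.
  set C₁ : ℝ≥0 := (1 - (1 + κ) * η)⁻¹ * ((1 + κ) / γ * A₁) with hC₁
  have hbdd : ∀ (φ : L2 n) (R : ℝ), 1 ≤ R → (∀ᵐ x, x ∉ closedBall 0 R → φ x = 0) →
      ∀ t : ℝ≥0, t ≠ 0 → t * ν (levelSet (L φ) t) ≤ C₁ * ∫⁻ x, ‖φ x‖ₑ ∂ν := by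
    intro φ R hR hsupp t ht
    have hφ : Integrable φ := by
      have h1 : IntegrableOn φ (closedBall 0 R) := by
        have : IsFiniteMeasure (volume.restrict (closedBall (0 : Rn n) R)) :=
          ⟨by simpa using measure_closedBall_lt_top⟩
        exact ((Lp.memLp φ).restrict _).integrable (by norm_num)
      refine (h1.integrable_indicator measurableSet_closedBall).congr ?_
      filter_upwards [hsupp] with x hx
      by_cases hxR : x ∈ closedBall 0 R
      · rw [indicator_of_mem hxR]
      · rw [indicator_of_notMem hxR, hx hxR]
    obtain ⟨A', -, hA'⟩ := hν.exists_dcube_le hn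
    have key := le_of_contraction
      (X := fun t => t * ν (dyadicUnion (isDense (levelSet (L φ) t)))) (l := 1 + κ)
      (ρ := (1 + κ) * η) (b := ((1 + κ) / γ * A₁ : ℝ≥0) * ∫⁻ x, ‖φ x‖ₑ ∂ν) le_self_add hη
      (fun s hs => by
        have h1 := hgl φ s hs hφ
        have h2 := hν.maximalSet_le hn hφ.2.ne (mul_ne_zero hγ hs)
        have h3 : (((1 + κ) * s : ℝ≥0) : ℝ≥0∞) * ν (maximalSet φ (γ * s)) ≤
            ((1 + κ) / γ * A₁ : ℝ≥0) * ∫⁻ x, ‖φ x‖ₑ ∂ν := by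
          have e : (1 + κ) * s = (1 + κ) / γ * (γ * s) := by field_simp
          rw [e, ENNReal.coe_mul, mul_assoc, ENNReal.coe_mul ((1 + κ) / γ), mul_assoc]
          gcongr
        calc (((1 + κ) * s : ℝ≥0) : ℝ≥0∞) *
              ν (dyadicUnion (isDense (levelSet (L φ) ((1 + κ) * s))))
            ≤ (((1 + κ) * s : ℝ≥0) : ℝ≥0∞) * (η * ν (dyadicUnion (isDense (levelSet (L φ) s))) +
              ν (maximalSet φ (γ * s))) := by gcongr
          _ = (((1 + κ) * η : ℝ≥0) : ℝ≥0∞) *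
                (s * ν (dyadicUnion (isDense (levelSet (L φ) s)))) +
              (((1 + κ) * s : ℝ≥0) : ℝ≥0∞) * ν (maximalSet φ (γ * s)) := by
              push_cast
              ring
          _ ≤ _ := by gcongr)
      (fun Λ => by
        obtain ⟨B, hBt, hB⟩ := hL.exists_a_priori_bound hn hν φ hφ hR hsupp Λ
        refine ⟨2 * A' * B, ENNReal.mul_ne_top (ENNReal.mul_ne_top (by norm_num)
          ENNReal.coe_ne_top) hBt, fun s hs hsΛ => ?_⟩
        calc s * ν (dyadicUnion (isDense (levelSet (L φ) s)))
            ≤ s * (2 * A' * ν (levelSet (L φ) s)) := by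
              gcongr
              exact measure_dyadicUnion_isDense_le hn hA' (measurableSet_levelSet _ _)
                (volume_levelSet_ne_top _ hs)
          _ = 2 * A' * (s * ν (levelSet (L φ) s)) := by ring
          _ ≤ _ := by gcongr; exact hB s hs hsΛ)
      t ht
    -- The contraction was run on the density sets, which contain the level sets up to a null set.
    refine le_trans (mul_le_mul_right (measure_mono_ae (hν.ac.ae_le ?_)) _) (key.trans_eq ?_)
    · exact ae_mem_dyadicUnion_isDense hn (measurableSet_levelSet (L φ) t)
    · rw [hC₁, ← mul_assoc, ← ENNReal.coe_mul]
  refine ⟨C₁, fun φ t => ?_⟩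
  rcases eq_or_ne t 0 with rfl | ht
  · simp
  have hm : ∀ k : ℕ, MeasurableSet (closedBall (0 : Rn n) (k + 1)) := fun k =>
    measurableSet_closedBall
  -- Bounded support was needed only for the a priori finiteness; cutting off to large balls removes
  -- it with the same constant.
  have hlim : Tendsto (fun k : ℕ => cut _ (hm k) φ) atTop (𝓝 φ) := by
    refine tendsto_cut hm (fun k k' h => closedBall_subset_closedBall (by
      have : (k : ℝ) ≤ k' := by exact_mod_cast h
      linarith)) φ (Eventually.of_forall fun x hx => absurd ?_ hx)
    obtain ⟨k, hk⟩ := exists_nat_ge ‖x‖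
    refine mem_iUnion.2 ⟨k, ?_⟩
    rw [mem_closedBall, dist_zero_right]
    linarith
  obtain ⟨ns, -, hae⟩ := ae_tendsto_subseq_of_tendsto ((L.continuous.tendsto _).comp hlim)
  have ht' : (t : ℝ≥0∞) ≠ 0 := by exact_mod_cast ht
  have h1 := measure_lt_enorm_le_of_tendsto (hν.ac.ae_le hae) t
    ((C₁ * ∫⁻ x, ‖φ x‖ₑ ∂ν) / t) (Eventually.of_forall fun j => by
      rw [ENNReal.le_div_iff_mul_le (Or.inl ht') (Or.inl ENNReal.coe_ne_top), mul_comm]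
      have hc := coeFn_cut _ (hm (ns j)) φ
      refine (hbdd (cut _ (hm (ns j)) φ) (ns j + 1) (by simp) ?_ t ht).trans ?_
      · filter_upwards [hc] with x hx hxb
        rw [hx, indicator_of_notMem hxb]
      · gcongr 1
        refine lintegral_mono_ae ?_
        filter_upwards [hν.ac.ae_le hc] with x hx
        rw [hx]
        exact enorm_indicator_le_enorm_self _ _)
  rwa [ENNReal.le_div_iff_mul_le (Or.inl ht') (Or.inl ENNReal.coe_ne_top), mul_comm] at h1

/-! ### The weak `L¹` quasi-norm -/

lemma weakNorm_one (ν : Measure (Rn n)) (F : Rn n → ℂ) :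
    weakNorm 1 ν F = ⨆ t : ℝ≥0, t * ν {x | (t : ℝ≥0∞) < ‖F x‖ₑ} := by
  simp [weakNorm]

lemma weakNorm_one_le_iff {ν : Measure (Rn n)} {F : Rn n → ℂ} {M : ℝ≥0∞} :
    weakNorm 1 ν F ≤ M ↔ ∀ t : ℝ≥0, t * ν {x | (t : ℝ≥0∞) < ‖F x‖ₑ} ≤ M := by
  rw [weakNorm_one, iSup_le_iff]

lemma mul_measure_le_weakNorm_one (ν : Measure (Rn n)) (F : Rn n → ℂ) (t : ℝ≥0) :
    t * ν {x | (t : ℝ≥0∞) < ‖F x‖ₑ} ≤ weakNorm 1 ν F :=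
  weakNorm_one_le_iff.1 le_rfl t

lemma weakNorm_one_mono {ν : Measure (Rn n)} {F G : Rn n → ℂ}
    (h : ∀ᵐ x ∂ν, ‖F x‖ₑ ≤ ‖G x‖ₑ) : weakNorm 1 ν F ≤ weakNorm 1 ν G := by
  refine weakNorm_one_le_iff.2 fun t => le_trans ?_ (mul_measure_le_weakNorm_one ν G t)
  refine mul_le_mul_right (measure_mono_ae ?_) _
  filter_upwards [h] with x hx hxt
  exact lt_of_lt_of_le (show (t : ℝ≥0∞) < ‖F x‖ₑ from hxt) hx

lemma weakNorm_one_congr {ν : Measure (Rn n)} {F G : Rn n → ℂ} (h : F =ᵐ[ν] G) :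
    weakNorm 1 ν F = weakNorm 1 ν G :=
  le_antisymm (weakNorm_one_mono (h.mono fun x hx => by rw [hx]))
    (weakNorm_one_mono (h.mono fun x hx => by rw [hx]))

lemma weakNorm_one_add_le (ν : Measure (Rn n)) (F G : Rn n → ℂ) :
    weakNorm 1 ν (fun x => F x + G x) ≤ 2 * (weakNorm 1 ν F + weakNorm 1 ν G) := by
  refine weakNorm_one_le_iff.2 fun t => ?_
  have e : (t : ℝ≥0∞) = 2 * ((t / 2 : ℝ≥0) : ℝ≥0∞) := by
    norm_cast
    field_simp
  have hsub : {x | (t : ℝ≥0∞) < ‖F x + G x‖ₑ} ⊆ {x | ((t / 2 : ℝ≥0) : ℝ≥0∞) < ‖F x‖ₑ} ∪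
      {x | ((t / 2 : ℝ≥0) : ℝ≥0∞) < ‖G x‖ₑ} := by
    intro x hx
    by_contra hcon
    simp only [mem_union, mem_ofPred_eq, not_or, not_lt] at hcon hx
    refine absurd hx (not_lt.2 ((enorm_add_le _ _).trans
      ((add_le_add hcon.1 hcon.2).trans_eq ?_)))
    rw [e, two_mul]
  calc t * ν {x | (t : ℝ≥0∞) < ‖F x + G x‖ₑ}
      ≤ t * (ν {x | ((t / 2 : ℝ≥0) : ℝ≥0∞) < ‖F x‖ₑ} +
          ν {x | ((t / 2 : ℝ≥0) : ℝ≥0∞) < ‖G x‖ₑ}) :=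
        mul_le_mul_right ((measure_mono hsub).trans (measure_union_le _ _)) _
    _ = 2 * (((t / 2 : ℝ≥0) : ℝ≥0∞) * ν {x | ((t / 2 : ℝ≥0) : ℝ≥0∞) < ‖F x‖ₑ} +
          ((t / 2 : ℝ≥0) : ℝ≥0∞) * ν {x | ((t / 2 : ℝ≥0) : ℝ≥0∞) < ‖G x‖ₑ}) := by
        generalize ((t / 2 : ℝ≥0) : ℝ≥0∞) = s at e ⊢
        rw [e]
        ring
    _ ≤ _ := by gcongr <;> exact mul_measure_le_weakNorm_one _ _ _

lemma weakNorm_one_const_mul_le (ν : Measure (Rn n)) (c : ℂ) (F : Rn n → ℂ) :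
    weakNorm 1 ν (fun x => c * F x) ≤ ‖c‖ₑ * weakNorm 1 ν F := by
  refine weakNorm_one_le_iff.2 fun t => ?_
  rcases eq_or_ne c 0 with rfl | hc
  · simp
  have hc0 : ‖c‖₊ ≠ 0 := nnnorm_ne_zero_iff.2 hc
  have hset : {x | (t : ℝ≥0∞) < ‖c * F x‖ₑ} = {x | ((t / ‖c‖₊ : ℝ≥0) : ℝ≥0∞) < ‖F x‖ₑ} := by
    ext x
    simp only [mem_ofPred_eq, enorm_eq_nnnorm, ENNReal.coe_lt_coe, nnnorm_mul]
    rw [div_lt_iff₀ (pos_iff_ne_zero.2 hc0), mul_comm]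
  have e : (t : ℝ≥0∞) = ‖c‖ₑ * ((t / ‖c‖₊ : ℝ≥0) : ℝ≥0∞) := by
    rw [enorm_eq_nnnorm, ← ENNReal.coe_mul, mul_div_cancel₀ _ hc0]
  rw [hset]
  conv_lhs => rw [e]
  rw [mul_assoc]
  gcongr
  exact mul_measure_le_weakNorm_one _ _ _

lemma weakNorm_one_le_of_bound {ν : Measure (Rn n)} {s : Set (Rn n)} {F : Rn n → ℂ} {M : ℝ≥0∞}
    (h : ∀ᵐ x ∂ν, ‖F x‖ₑ ≤ s.indicator (fun _ => M) x) : weakNorm 1 ν F ≤ M * ν s := by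
  refine weakNorm_one_le_iff.2 fun t => ?_
  by_cases htM : (t : ℝ≥0∞) < M
  · refine mul_le_mul' htM.le (measure_mono_ae ?_)
    filter_upwards [h] with x hx hxt
    have hxt' : (t : ℝ≥0∞) < ‖F x‖ₑ := hxt
    by_contra hxs
    have hxs' : x ∉ s := hxs
    rw [indicator_of_notMem hxs'] at hx
    exact absurd (hxt'.trans_le hx) not_lt_zero
  · have : ν {x | (t : ℝ≥0∞) < ‖F x‖ₑ} = 0 := by
      rw [measure_eq_zero_iff_ae_notMem]
      filter_upwards [h] with x hx hxt
      have hxt' : (t : ℝ≥0∞) < ‖F x‖ₑ := hxt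
      exact htM (hxt'.trans_le (hx.trans (indicator_le_self _ _ _)))
    rw [this, mul_zero]
    exact zero_le

lemma tendstoInMeasure_of_weakNorm {ν : Measure (Rn n)} {F : ℕ → Rn n → ℂ} {f : Rn n → ℂ}
    (h : Tendsto (fun k => weakNorm 1 ν fun x => F k x - f x) atTop (𝓝 0)) :
    TendstoInMeasure ν F atTop f := by
  refine tendstoInMeasure_iff_enorm.2 fun ε hε _ => ?_
  obtain ⟨δ, hδ0, hδε⟩ := ENNReal.lt_iff_exists_nnreal_btwn.1 hε
  have hδ : (δ : ℝ≥0∞) ≠ 0 := hδ0.ne'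
  have h1 : Tendsto (fun k => (δ : ℝ≥0∞)⁻¹ * weakNorm 1 ν fun x => F k x - f x) atTop (𝓝 0) := by
    have := ENNReal.Tendsto.const_mul h (Or.inr (ENNReal.inv_ne_top.2 hδ))
    rwa [mul_zero] at this
  refine tendsto_of_tendsto_of_tendsto_of_le_of_le tendsto_const_nhds h1 (fun _ => zero_le)
    fun k => ?_
  have h2 := mul_measure_le_weakNorm_one ν (fun x => F k x - f x) δ
  calc ν {x | ε ≤ ‖F k x - f x‖ₑ} ≤ ν {x | (δ : ℝ≥0∞) < ‖F k x - f x‖ₑ} :=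
        measure_mono fun x hx => hδε.trans_le hx
    _ ≤ _ := by
        rw [mul_comm, ← div_eq_mul_inv,
          ENNReal.le_div_iff_mul_le (Or.inl hδ) (Or.inl ENNReal.coe_ne_top), mul_comm]
        exact h2

lemma weakNorm_one_le_of_tendsto {ν : Measure (Rn n)} {F : ℕ → Rn n → ℂ} {f : Rn n → ℂ}
    (h : ∀ᵐ x ∂ν, Tendsto (fun j => F j x) atTop (𝓝 (f x))) {M : ℝ≥0∞}
    (hM : ∀ᶠ j in atTop, weakNorm 1 ν (F j) ≤ M) : weakNorm 1 ν f ≤ M := by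
  refine weakNorm_one_le_iff.2 fun t => ?_
  rcases eq_or_ne t 0 with rfl | ht
  · simp
  have ht' : (t : ℝ≥0∞) ≠ 0 := by exact_mod_cast ht
  have := measure_lt_enorm_le_of_tendsto h t (M / t) (hM.mono fun j hj => by
    rw [ENNReal.le_div_iff_mul_le (Or.inl ht') (Or.inl ENNReal.coe_ne_top), mul_comm]
    exact (mul_measure_le_weakNorm_one _ _ _).trans hj)
  rwa [ENNReal.le_div_iff_mul_le (Or.inl ht') (Or.inl ENNReal.coe_ne_top), mul_comm] at this

/-! ### The extension of the operator to `L¹_w` -/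

/-- Approximation by truncations. -/
lemma exists_truncation {f : Rn n → ℂ} (hf : AEStronglyMeasurable f) :
    ∃ φ : ℕ → L2 n, (∀ k, ∀ᵐ x, ‖φ k x‖ₑ ≤ ‖f x‖ₑ) ∧
      ∀ᵐ x, ∃ N, ∀ k ≥ N, φ k x = f x := by
  set f' := hf.mk f with hf'
  have hf'm : StronglyMeasurable f' := hf.stronglyMeasurable_mk
  set A : ℕ → Set (Rn n) := fun k => {x | ‖f' x‖ ≤ k} ∩ closedBall 0 k with hA
  have hAm : ∀ k, MeasurableSet (A k) := fun k =>
    (measurableSet_le hf'm.measurable.norm measurable_const).inter measurableSet_closedBall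
  have hmem : ∀ k, MemLp ((A k).indicator f') 2 := by
    intro k
    have h1 : MemLp ((closedBall (0 : Rn n) k).indicator fun _ => (k : ℝ)) 2 :=
      memLp_indicator_const 2 measurableSet_closedBall _ (Or.inr measure_closedBall_lt_top.ne)
    refine h1.mono (hf'm.indicator (hAm k)).aestronglyMeasurable
      (Eventually.of_forall fun x => ?_)
    by_cases hx : x ∈ A k
    · rw [indicator_of_mem hx, indicator_of_mem hx.2]
      simpa using hx.1
    · rw [indicator_of_notMem hx, norm_zero]
      exact norm_nonneg _
  refine ⟨fun k => (hmem k).toLp _, fun k => ?_, ?_⟩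
  · filter_upwards [(hmem k).coeFn_toLp, hf.ae_eq_mk] with x h1 h2
    rw [h1, h2]
    exact enorm_indicator_le_enorm_self _ _
  · filter_upwards [ae_all_iff.2 fun k => (hmem k).coeFn_toLp, hf.ae_eq_mk] with x h1 h2
    obtain ⟨N, hN⟩ := exists_nat_ge (max ‖f' x‖ ‖x‖)
    refine ⟨N, fun k hk => ?_⟩
    have hNk : max ‖f' x‖ ‖x‖ ≤ k := hN.trans (by exact_mod_cast hk)
    rw [h1, h2, indicator_of_mem]
    exact ⟨(le_max_left _ _).trans hNk, by simpa using (le_max_right _ _).trans hNk⟩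

lemma tendsto_eLpNorm_truncation {ν : Measure (Rn n)} (hν : ν ≪ volume) {f : Rn n → ℂ}
    (hf : MemLp f 1 ν) {φ : ℕ → L2 n} (h1 : ∀ k, ∀ᵐ x, ‖φ k x‖ₑ ≤ ‖f x‖ₑ)
    (h2 : ∀ᵐ x, ∃ N, ∀ k ≥ N, φ k x = f x) :
    Tendsto (fun k => eLpNorm (fun x => φ k x - f x) 1 ν) atTop (𝓝 0) := by
  simp only [eLpNorm_one_eq_lintegral_enorm]
  have hfi : ∫⁻ x, ‖f x‖ₑ ∂ν ≠ ∞ := by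
    rw [← eLpNorm_one_eq_lintegral_enorm]
    exact hf.2.ne
  have hlim := tendsto_lintegral_of_dominated_convergence' (μ := ν)
    (F := fun k x => ‖φ k x - f x‖ₑ) (f := fun _ => 0) (fun x => 2 * ‖f x‖ₑ)
    (fun k => (((Lp.stronglyMeasurable (φ k)).aestronglyMeasurable).sub hf.1).enorm)
    (fun k => by
      filter_upwards [hν.ae_le (h1 k)] with x hx
      rw [two_mul]
      exact enorm_sub_le.trans (by gcongr))
    (by
      rw [lintegral_const_mul' _ _ (by norm_num)]
      exact ENNReal.mul_ne_top (by norm_num) hfi)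
    (by
      filter_upwards [hν.ae_le h2] with x ⟨N, hN⟩
      refine tendsto_const_nhds.congr' ?_
      filter_upwards [eventually_ge_atTop N] with k hk
      simp [hN k hk])
  simpa using hlim

section L1Value

variable {L : L2 n →L[ℂ] L2 n} {w : Rn n → ℝ} {A C₁ : ℝ≥0}

lemma weakNorm_le_eLpNorm
    (hW : ∀ (φ : L2 n) (t : ℝ≥0),
      t * wMeas w {x | (t : ℝ≥0∞) < ‖L φ x‖ₑ} ≤ C₁ * ∫⁻ x, ‖φ x‖ₑ ∂(wMeas w)) (φ : L2 n) :
    weakNorm 1 (wMeas w) (L φ) ≤ C₁ * eLpNorm φ 1 (wMeas w) := by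
  rw [eLpNorm_one_eq_lintegral_enorm]
  exact weakNorm_one_le_iff.2 (hW φ)

/-- Comparing both functions with f makes the images of approximants Cauchy in WL¹_w, which gives
existence of the extension and its independence of the sequence. -/
lemma weakNorm_sub_le_eLpNorm (hν : IsA1Measure (wMeas w) A)
    (hW : ∀ (φ : L2 n) (t : ℝ≥0),
      t * wMeas w {x | (t : ℝ≥0∞) < ‖L φ x‖ₑ} ≤ C₁ * ∫⁻ x, ‖φ x‖ₑ ∂(wMeas w))
    (φ ψ : L2 n) {f : Rn n → ℂ} (hf : AEStronglyMeasurable f) :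
    weakNorm 1 (wMeas w) (fun x => L φ x - L ψ x) ≤
      C₁ * (eLpNorm (fun x => φ x - f x) 1 (wMeas w) +
        eLpNorm (fun x => ψ x - f x) 1 (wMeas w)) := by
  have h1 : (fun x => L φ x - L ψ x) =ᵐ[wMeas w] L (φ - ψ) := by
    rw [map_sub]
    filter_upwards [hν.ac.ae_le (Lp.coeFn_sub (L φ) (L ψ))] with x hx
    rw [hx, Pi.sub_apply]
  have h2 : φ - ψ =ᵐ[wMeas w] (fun x => φ x - f x) - fun x => ψ x - f x := by
    filter_upwards [hν.ac.ae_le (Lp.coeFn_sub φ ψ)] with x hx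
    rw [hx]
    simp
  rw [weakNorm_one_congr h1]
  refine (weakNorm_le_eLpNorm hW _).trans ?_
  rw [eLpNorm_congr_ae h2]
  gcongr
  have hfν : AEStronglyMeasurable f (wMeas w) := hf.mono_ac hν.ac
  exact eLpNorm_sub_le ((Lp.stronglyMeasurable φ).aestronglyMeasurable.sub hfν)
    ((Lp.stronglyMeasurable ψ).aestronglyMeasurable.sub hfν) le_rfl

/-- Every function in `L¹_w` has an image under the extended operator. -/
lemma exists_isL1Value (hν : IsA1Measure (wMeas w) A)
    (hW : ∀ (φ : L2 n) (t : ℝ≥0),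
      t * wMeas w {x | (t : ℝ≥0∞) < ‖L φ x‖ₑ} ≤ C₁ * ∫⁻ x, ‖φ x‖ₑ ∂(wMeas w))
    {f : Rn n → ℂ} (hf : MemLp f 1 (wMeas w)) : ∃ h, IsL1Value L w f h := by
  have hfv : AEStronglyMeasurable f := hf.1.mono_ac hν.ac'
  obtain ⟨φ₀, h1, h2⟩ := exists_truncation hfv
  have hlim := tendsto_eLpNorm_truncation hν.ac hf h1 h2
  have hpos : ∀ j : ℕ, (0 : ℝ≥0∞) < (1 / 4) ^ j := fun j =>
    ENNReal.pow_pos (by simp) j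
  -- With L¹_w errors 4^(-j), consecutive images differ by more than 2^(-j) only on sets of measure
  -- O(2^(-j)); Borel–Cantelli gives pointwise convergence.
  obtain ⟨ns, -, hns⟩ := extraction_forall_of_eventually'
    (P := fun j k => eLpNorm (fun x => φ₀ k x - f x) 1 (wMeas w) ≤ (1 / 4) ^ j)
    fun j => (hlim.eventually (gt_mem_nhds (hpos j))).exists_forall_of_atTop.imp
      fun N hN k hk => (hN k hk).le
  set φ : ℕ → L2 n := fun j => φ₀ (ns j) with hφ
  have hφj : ∀ j, eLpNorm (fun x => φ j x - f x) 1 (wMeas w) ≤ (1 / 4) ^ j := hns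
  have hmeas : ∀ j : ℕ, wMeas w {x | (((1 / 2) ^ j : ℝ≥0) : ℝ≥0∞) < ‖L (φ (j + 1)) x - L (φ j) x‖ₑ}
      ≤ 2 * C₁ * (1 / 2) ^ j := by
    intro j
    have h3 := weakNorm_sub_le_eLpNorm hν hW (φ (j + 1)) (φ j) hfv
    have h4 : eLpNorm (fun x => φ (j + 1) x - f x) 1 (wMeas w) +
        eLpNorm (fun x => φ j x - f x) 1 (wMeas w) ≤ 2 * (1 / 4) ^ j := by
      rw [two_mul]
      refine add_le_add ((hφj _).trans ?_) (hφj j)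
      exact pow_le_pow_right_of_le_one' (by simp) (Nat.le_succ j)
    have h5 := (mul_measure_le_weakNorm_one _ _ ((1 / 2) ^ j : ℝ≥0)).trans
      (h3.trans (mul_le_mul_right h4 _))
    have hp0 : (((1 / 2) ^ j : ℝ≥0) : ℝ≥0∞) ≠ 0 := by
      norm_cast
      positivity
    refine (ENNReal.mul_le_mul_iff_right hp0 ENNReal.coe_ne_top).1 (h5.trans_eq ?_)
    have e : ((1 / 4 : ℝ≥0∞)) ^ j = (((1 / 2) ^ j : ℝ≥0) : ℝ≥0∞) * (1 / 2) ^ j := by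
      push_cast
      rw [← mul_pow]
      congr 1
      simp only [one_div]
      rw [← ENNReal.mul_inv (by norm_num) (by norm_num)]
      norm_num
    rw [e]
    ring
  have hcauchy : ∀ᵐ x ∂(wMeas w), ∃ l, Tendsto (fun j => L (φ j) x) atTop (𝓝 l) := by
    have hsum : ∑' j : ℕ, wMeas w {x | (((1 / 2) ^ j : ℝ≥0) : ℝ≥0∞) <
        ‖L (φ (j + 1)) x - L (φ j) x‖ₑ} ≠ ∞ := by
      refine ne_top_of_le_ne_top ?_ (ENNReal.tsum_le_tsum hmeas)
      rw [ENNReal.tsum_mul_left, ENNReal.tsum_geometric]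
      refine ENNReal.mul_ne_top (ENNReal.mul_ne_top (by norm_num) ENNReal.coe_ne_top) ?_
      simp
    filter_upwards [ae_eventually_notMem hsum] with x hx
    refine cauchySeq_tendsto_of_complete (cauchySeq_of_summable_dist ?_)
    refine Summable.of_norm_bounded_eventually_nat (g := fun j => (1 / 2 : ℝ) ^ j)
      (summable_geometric_of_lt_one (by norm_num) (by norm_num)) ?_
    filter_upwards [hx] with j hj
    have := enorm_le_coe_iff.1 (not_lt.1 hj)
    rw [Real.norm_of_nonneg dist_nonneg, dist_comm, dist_eq_norm]
    simpa using this
  obtain ⟨h, hhm, hh⟩ := exists_stronglyMeasurable_limit_of_tendsto_ae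
    (fun j => (Lp.stronglyMeasurable (L (φ j))).aestronglyMeasurable) hcauchy
  refine ⟨h, hf, hhm.aestronglyMeasurable, fun ψ hψ => ?_⟩
  -- Compare with L(φ_j) for j ≥ k and let j tend to infinity; the weak norm is lower semicontinuous
  -- under almost everywhere limits.
  have key : ∀ k : ℕ, weakNorm 1 (wMeas w) (fun x => L (ψ k) x - h x) ≤
      C₁ * (eLpNorm (fun x => ψ k x - f x) 1 (wMeas w) + (1 / 4) ^ k) := by
    intro k
    refine weakNorm_one_le_of_tendsto (F := fun j x => L (ψ k) x - L (φ j) x)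
      (hh.mono fun x hx => tendsto_const_nhds.sub hx) ?_
    filter_upwards [eventually_ge_atTop k] with j hj
    refine (weakNorm_sub_le_eLpNorm hν hW (ψ k) (φ j) hfv).trans ?_
    gcongr
    exact (hφj j).trans (pow_le_pow_right_of_le_one' (by simp) hj)
  refine tendsto_of_tendsto_of_tendsto_of_le_of_le tendsto_const_nhds ?_ (fun _ => zero_le) key
  have h5 : Tendsto (fun k : ℕ => (1 / 4 : ℝ≥0∞) ^ k) atTop (𝓝 0) :=
    ENNReal.tendsto_pow_atTop_nhds_zero_of_lt_one (by
      rw [one_div, ENNReal.inv_lt_one]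
      norm_num)
  have h6 := ENNReal.Tendsto.const_mul (a := (C₁ : ℝ≥0∞)) (hψ.add h5) (Or.inr ENNReal.coe_ne_top)
  simpa using h6

lemma IsL1Value.exists_subseq {f h : Rn n → ℂ} (hh : IsL1Value L w f h) {φ : ℕ → L2 n}
    (hφ : Tendsto (fun k => eLpNorm (fun x => φ k x - f x) 1 (wMeas w)) atTop (𝓝 0)) :
    ∃ ns : ℕ → ℕ, StrictMono ns ∧
      ∀ᵐ x ∂(wMeas w), Tendsto (fun j => L (φ (ns j)) x) atTop (𝓝 (h x)) :=
  (tendstoInMeasure_of_weakNorm (hh.tendsto φ hφ)).exists_seq_tendsto_ae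

lemma IsL1Value.ae_eq (hν : IsA1Measure (wMeas w) A) {f h h' : Rn n → ℂ}
    (hh : IsL1Value L w f h) (hh' : IsL1Value L w f h') : h =ᵐ[volume] h' := by
  obtain ⟨φ, h1, h2⟩ := exists_truncation (hh.memLp.1.mono_ac hν.ac')
  have hlim := tendsto_eLpNorm_truncation hν.ac hh.memLp h1 h2
  exact hν.ac'.ae_le (tendstoInMeasure_ae_unique (tendstoInMeasure_of_weakNorm (hh.tendsto φ hlim))
    (tendstoInMeasure_of_weakNorm (hh'.tendsto φ hlim)))

lemma IsL1Value.weakNorm_le (hν : IsA1Measure (wMeas w) A)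
    (hW : ∀ (φ : L2 n) (t : ℝ≥0),
      t * wMeas w {x | (t : ℝ≥0∞) < ‖L φ x‖ₑ} ≤ C₁ * ∫⁻ x, ‖φ x‖ₑ ∂(wMeas w))
    {f h : Rn n → ℂ} (hh : IsL1Value L w f h) :
    weakNorm 1 (wMeas w) h ≤ C₁ * ∫⁻ x, ‖f x‖ₑ ∂(wMeas w) := by
  obtain ⟨φ, h1, h2⟩ := exists_truncation (hh.memLp.1.mono_ac hν.ac')
  obtain ⟨ns, -, hns⟩ := hh.exists_subseq (tendsto_eLpNorm_truncation hν.ac hh.memLp h1 h2)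
  refine weakNorm_one_le_of_tendsto hns (Eventually.of_forall fun j => ?_)
  refine (weakNorm_one_le_iff.2 (hW _)).trans ?_
  gcongr 1
  exact lintegral_mono_ae (hν.ac.ae_le (h1 _))

lemma isL1Value_of_L2 (hν : IsA1Measure (wMeas w) A)
    (hW : ∀ (φ : L2 n) (t : ℝ≥0),
      t * wMeas w {x | (t : ℝ≥0∞) < ‖L φ x‖ₑ} ≤ C₁ * ∫⁻ x, ‖φ x‖ₑ ∂(wMeas w))
    (φ : L2 n) {f : Rn n → ℂ} (hφf : φ =ᵐ[volume] f) (hf : MemLp f 1 (wMeas w)) :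
    IsL1Value L w f (L φ) := by
  refine ⟨hf, (Lp.stronglyMeasurable _).aestronglyMeasurable, fun ψ hψ => ?_⟩
  have h0 : eLpNorm (fun x => φ x - f x) 1 (wMeas w) = 0 := by
    have : (fun x => φ x - f x) =ᵐ[wMeas w] 0 := by
      filter_upwards [hν.ac.ae_le hφf] with x hx
      simp [hx]
    rw [eLpNorm_congr_ae this, eLpNorm_zero]
  have key : ∀ k, weakNorm 1 (wMeas w) (fun x => L (ψ k) x - L φ x) ≤
      C₁ * eLpNorm (fun x => ψ k x - f x) 1 (wMeas w) := by
    intro k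
    have := weakNorm_sub_le_eLpNorm hν hW (ψ k) φ (hf.1.mono_ac hν.ac')
    rwa [h0, add_zero] at this
  refine tendsto_of_tendsto_of_tendsto_of_le_of_le tendsto_const_nhds ?_ (fun _ => zero_le) key
  have := ENNReal.Tendsto.const_mul (a := (C₁ : ℝ≥0∞)) hψ (Or.inr ENNReal.coe_ne_top)
  rwa [mul_zero] at this

/-- A sequence φ_k approximating cf₁ + f₂ does not come split. Take truncations ψ_k of f₁; then φ_k
- cψ_k approximates f₂, and the two known limits add up. -/
lemma IsL1Value.smul_add (hν : IsA1Measure (wMeas w) A) {f₁ f₂ h₁ h₂ : Rn n → ℂ} (c : ℂ)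
    (hh₁ : IsL1Value L w f₁ h₁) (hh₂ : IsL1Value L w f₂ h₂) :
    IsL1Value L w (c • f₁ + f₂) (c • h₁ + h₂) := by
  refine ⟨(hh₁.memLp.const_smul c).add hh₂.memLp, (hh₁.measurable.const_smul c).add
    hh₂.measurable, fun φ hφ => ?_⟩
  obtain ⟨ψ, h1, h2⟩ := exists_truncation (hh₁.memLp.1.mono_ac hν.ac')
  have hψ := tendsto_eLpNorm_truncation hν.ac hh₁.memLp h1 h2
  have hχ : Tendsto (fun k => eLpNorm (fun x => (φ k - c • ψ k) x - f₂ x) 1 (wMeas w)) atTop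
      (𝓝 0) := by
    have h3 : Tendsto (fun k => eLpNorm (fun x => φ k x - (c • f₁ + f₂) x) 1 (wMeas w) +
        ‖c‖ₑ * eLpNorm (fun x => ψ k x - f₁ x) 1 (wMeas w)) atTop (𝓝 0) := by
      have := hφ.add (ENNReal.Tendsto.const_mul (a := ‖c‖ₑ) hψ (Or.inr enorm_ne_top))
      rwa [mul_zero, add_zero] at this
    refine tendsto_of_tendsto_of_tendsto_of_le_of_le tendsto_const_nhds h3 (fun _ => zero_le)
      fun k => ?_
    have e : (fun x => (φ k - c • ψ k) x - f₂ x) =ᵐ[wMeas w]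
        (fun x => φ k x - (c • f₁ + f₂) x) - c • fun x => ψ k x - f₁ x := by
      filter_upwards [hν.ac.ae_le (Lp.coeFn_sub (φ k) (c • ψ k)),
        hν.ac.ae_le (Lp.coeFn_smul c (ψ k))] with x hx1 hx2
      rw [hx1, Pi.sub_apply, hx2]
      simp only [Pi.sub_apply, Pi.add_apply, Pi.smul_apply, smul_eq_mul]
      ring
    dsimp only
    rw [eLpNorm_congr_ae e]
    refine (eLpNorm_sub_le ?_ ?_ le_rfl).trans ?_
    · exact (Lp.stronglyMeasurable _).aestronglyMeasurable.sub
        ((hh₁.memLp.1.const_smul c).add hh₂.memLp.1)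
    · exact ((Lp.stronglyMeasurable _).aestronglyMeasurable.sub hh₁.memLp.1).const_smul c
    · rw [eLpNorm_const_smul]
  have h4 := hh₁.tendsto ψ hψ
  have h5 := hh₂.tendsto _ hχ
  have h6 : Tendsto (fun k => 2 * (‖c‖ₑ * weakNorm 1 (wMeas w) (fun x => L (ψ k) x - h₁ x) +
      weakNorm 1 (wMeas w) fun x => L (φ k - c • ψ k) x - h₂ x)) atTop (𝓝 0) := by
    have := ENNReal.Tendsto.const_mul (a := 2)
      ((ENNReal.Tendsto.const_mul (a := ‖c‖ₑ) h4 (Or.inr enorm_ne_top)).add h5)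
      (Or.inr (by norm_num))
    simpa using this
  refine tendsto_of_tendsto_of_tendsto_of_le_of_le tendsto_const_nhds h6 (fun _ => zero_le)
    fun k => ?_
  have e : (fun x => L (φ k) x - (c • h₁ + h₂) x) =ᵐ[wMeas w]
      fun x => c * (L (ψ k) x - h₁ x) + (L (φ k - c • ψ k) x - h₂ x) := by
    rw [map_sub, map_smul]
    filter_upwards [hν.ac.ae_le (Lp.coeFn_sub (L (φ k)) (c • L (ψ k))),
      hν.ac.ae_le (Lp.coeFn_smul c (L (ψ k)))] with x hx1 hx2
    rw [hx1, Pi.sub_apply, hx2]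
    simp only [Pi.add_apply, Pi.smul_apply, smul_eq_mul]
    ring
  dsimp only
  rw [weakNorm_one_congr e]
  refine (weakNorm_one_add_le _ (fun x => c * (L (ψ k) x - h₁ x)) _).trans ?_
  gcongr
  exact weakNorm_one_const_mul_le _ _ _

/-- Kernel representation of the extended operator off the support. -/
lemma IsL1Value.repr {K : Rn n → Rn n → ℂ} {C : ℝ≥0} (hL : IsRegularCZO L K C)
    (hν : IsA1Measure (wMeas w) A) {f h : Rn n → ℂ} (hh : IsL1Value L w f h) {U : Set (Rn n)}
    (hU : IsOpen U) (h0 : ∀ᵐ x, x ∈ U → f x = 0)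
    (hint : ∀ᵐ x, x ∈ U → Integrable fun y => K x y * f y) :
    ∀ᵐ x, x ∈ U → h x = ∫ y, K x y * f y := by
  have hfv := hh.memLp.1.mono_ac hν.ac'
  obtain ⟨φ, h1, h2⟩ := exists_truncation hfv
  obtain ⟨ns, hns, hae⟩ := hh.exists_subseq (tendsto_eLpNorm_truncation hν.ac hh.memLp h1 h2)
  have hrep : ∀ᵐ x, ∀ j, x ∈ U → L (φ j) x = ∫ y, K x y * φ j y := by
    refine ae_all_iff.2 fun j => hL.repr (φ j) U hU ?_
    filter_upwards [h1 j, h0] with y hy hy0 hyU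
    rw [hy0 hyU] at hy
    simpa using hy
  filter_upwards [hν.ac'.ae_le hae, hrep, hint] with x hx hxr hxi hxU
  refine tendsto_nhds_unique hx ?_
  simp only [hxr _ hxU]
  refine tendsto_integral_of_dominated_convergence (fun y => ‖K x y * f y‖)
    (fun j => ?_) (hxi hxU).norm (fun j => ?_) ?_
  · exact ((hL.measurable.comp measurable_prodMk_left).mul
      (Lp.stronglyMeasurable _).measurable).aestronglyMeasurable
  · filter_upwards [h1 (ns j)] with y hy
    rw [norm_mul, norm_mul]
    gcongr
    rwa [enorm_eq_nnnorm, enorm_eq_nnnorm, ENNReal.coe_le_coe, ← NNReal.coe_le_coe] at hy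
  · filter_upwards [h2] with y ⟨N, hN⟩
    refine tendsto_const_nhds.congr' ?_
    filter_upwards [eventually_ge_atTop N] with j hj
    rw [hN _ (hj.trans (hns.id_le j))]

end L1Value

/-! ### Sums over dyadic dilates of a ball -/

/-- The sum of the `ν`-averages of `f` over the dyadic dilates of a ball. -/
def dilateSum (ν : Measure (Rn n)) (f : Rn n → ℂ) (y : Rn n) (r : ℝ) : ℝ≥0∞ :=
  ∑' k : ℕ, (ν (ball y (2 ^ (k + 1) * r)))⁻¹ * ∫⁻ x in ball y (2 ^ (k + 1) * r), ‖f x‖ₑ ∂ν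

lemma dilateSum_two_mul_le (ν : Measure (Rn n)) (f : Rn n → ℂ) (y : Rn n) (r : ℝ) :
    dilateSum ν f y (2 * r) ≤ dilateSum ν f y r := by
  have e : ∀ k : ℕ, (2 : ℝ) ^ (k + 1) * (2 * r) = 2 ^ (k + 1 + 1) * r := fun k => by ring
  unfold dilateSum
  simp only [e]
  exact ENNReal.tsum_comp_le_tsum_of_injective (add_left_injective 1)
    fun k : ℕ => (ν (ball y (2 ^ (k + 1) * r)))⁻¹ * ∫⁻ x in ball y (2 ^ (k + 1) * r), ‖f x‖ₑ ∂ν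

/-- The double ball is the zeroth term of the sum, and doubling replaces its measure by that of the
ball. -/
lemma lintegral_ball_le_dilateSum {ν : Measure (Rn n)} {A : ℝ≥0} (hν : IsA1Measure ν A)
    (f : Rn n → ℂ) (y : Rn n) {r : ℝ} (hr : 0 < r) :
    ∫⁻ x in ball y (2 * r), ‖f x‖ₑ ∂ν ≤ A * 2 ^ n * ν (ball y r) * dilateSum ν f y r := by
  have h1 : (ν (ball y (2 * r)))⁻¹ * ∫⁻ x in ball y (2 * r), ‖f x‖ₑ ∂ν ≤ dilateSum ν f y r := by
    have := ENNReal.le_tsum (f := fun k : ℕ => (ν (ball y (2 ^ (k + 1) * r)))⁻¹ *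
      ∫⁻ x in ball y (2 ^ (k + 1) * r), ‖f x‖ₑ ∂ν) 0
    unfold dilateSum
    simpa using this
  calc ∫⁻ x in ball y (2 * r), ‖f x‖ₑ ∂ν
      = ν (ball y (2 * r)) * ((ν (ball y (2 * r)))⁻¹ * ∫⁻ x in ball y (2 * r), ‖f x‖ₑ ∂ν) := by
        rw [← mul_assoc, ENNReal.mul_inv_cancel (hν.pos _ _ (by positivity)) (hν.fin _ _), one_mul]
    _ ≤ _ := mul_le_mul' (hν.doubling y hr) h1

/-- Each dilate about y₀ lies in the dilate of twice the radius about y, whose measure is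
comparable. Finiteness at one nearby centre therefore carries over. -/
lemma dilateSum_le_of_mem_ball {ν : Measure (Rn n)} {A : ℝ≥0} (hν : IsA1Measure ν A)
    (f : Rn n → ℂ) {y y₀ : Rn n} {r : ℝ} (hr : 0 < r) (hy : y ∈ ball y₀ r) :
    dilateSum ν f y₀ r ≤ A * 2 ^ n * dilateSum ν f y (2 * r) := by
  unfold dilateSum
  rw [← ENNReal.tsum_mul_left]
  refine ENNReal.tsum_le_tsum fun k => ?_
  have e : (2 : ℝ) ^ (k + 1) * (2 * r) = 2 * (2 ^ (k + 1) * r) := by ring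
  have hρ : 0 < 2 ^ (k + 1) * r := by positivity
  have h1 : r ≤ 2 ^ (k + 1) * r := le_mul_of_one_le_left hr.le (one_le_pow₀ (by norm_num))
  have hsub : ball y₀ (2 ^ (k + 1) * r) ⊆ ball y (2 * (2 ^ (k + 1) * r)) := by
    refine ball_subset_ball' ?_
    rw [mem_ball, dist_comm] at hy
    linarith
  rw [e, ← mul_assoc]
  refine mul_le_mul' ?_ (lintegral_mono_set hsub)
  have h2 := hν.ball_le hρ two_pos hsub
  rw [ENNReal.ofReal_pow (by norm_num), ENNReal.ofReal_ofNat] at h2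
  rw [← div_eq_mul_inv, ENNReal.le_div_iff_mul_le (Or.inl (hν.pos _ _ (by positivity)))
    (Or.inl (hν.fin _ _)), mul_comm, ← div_eq_mul_inv]
  exact ENNReal.div_le_of_le_mul h2

/-- The part of the integral away from a ball is controlled by the sum over dilates. -/
lemma IsRegularCZO.lintegral_far_le {L : L2 n →L[ℂ] L2 n} {K : Rn n → Rn n → ℂ}
    {C : ℝ≥0} (hL : IsRegularCZO L K C) {ν : Measure (Rn n)} {A : ℝ≥0} (hν : IsA1Measure ν A)
    (f : Rn n → ℂ) {x y : Rn n} {r : ℝ} (hx : x ∈ ball y r) :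
    ∫⁻ z in (ball y (2 * r))ᶜ, ‖K x z‖ₑ * ‖f z‖ₑ ≤
      (C * 4 ^ n * (volume (ball (0 : Rn n) 1)).toNNReal * A : ℝ≥0) * dilateSum ν f y r := by
  have hr : 0 < r := pos_of_mem_ball hx
  rw [mem_ball] at hx
  refine (lintegral_compl_ball_le y (by positivity : 0 < 2 * r) (fun z => ‖K x z‖ₑ)
    (fun z => ‖f z‖ₑ) (fun k => (C / (2 ^ k * r) ^ n).toNNReal) (fun k z hz => ?_)).trans ?_
  · have h1 : (1 : ℝ) ≤ 2 ^ k := one_le_pow₀ (by norm_num)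
    have h2 : 2 ^ k * r ≤ ‖x - z‖ := by
      have := dist_triangle z x y
      rw [dist_comm z x, dist_eq_norm x z] at this
      nlinarith
    have hxz : x ≠ z := by
      rintro rfl
      rw [sub_self, norm_zero] at h2
      have : 0 < 2 ^ k * r := by positivity
      linarith
    rw [← ofReal_norm]
    refine ENNReal.ofReal_le_ofReal ((hL.size x z hxz).trans ?_)
    gcongr
  · refine le_trans ?_ (mul_le_mul_right (dilateSum_two_mul_le ν f y r) _)
    unfold dilateSum
    rw [← ENNReal.tsum_mul_left]
    refine ENNReal.tsum_le_tsum fun k => ?_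
    set ρ : ℝ := 2 ^ (k + 1) * (2 * r) with hρ
    have hρ0 : 0 < ρ := by positivity
    -- A₁ bounds the Lebesgue average by the ν-average; the factor |B(y, ρ)| cancels the size of the
    -- kernel on the annulus.
    have h1 : ∫⁻ z in ball y ρ, ‖f z‖ₑ ≤
        A * volume (ball y ρ) * ((ν (ball y ρ))⁻¹ * ∫⁻ z in ball y ρ, ‖f z‖ₑ ∂ν) := by
      have h2 := hν.lintegral_le y hρ0 fun z => ‖f z‖ₑ
      rw [mul_left_comm, ← ENNReal.div_eq_inv_mul,
        ENNReal.le_div_iff_mul_le (Or.inl (hν.pos _ _ hρ0)) (Or.inl (hν.fin _ _)), mul_comm]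
      exact h2
    have h3 : ((C / (2 ^ k * r) ^ n).toNNReal : ℝ≥0∞) * volume (ball y ρ) =
        C * 4 ^ n * volume (ball (0 : Rn n) 1) := by
      have h4 : (C : ℝ≥0∞) * 4 ^ n = ENNReal.ofReal (C * 4 ^ n) := by
        rw [ENNReal.ofReal_mul C.coe_nonneg, ENNReal.ofReal_coe_nnreal,
          ENNReal.ofReal_pow (by norm_num), ENNReal.ofReal_ofNat]
      rw [volume_ball_eq y hρ0, ← mul_assoc, h4, ← ENNReal.ofReal,
        ← ENNReal.ofReal_mul (by positivity)]
      congr 2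
      have : ρ = 4 * (2 ^ k * r) := by rw [hρ]; ring
      rw [this, mul_pow 4]
      field_simp
    calc ((C / (2 ^ k * r) ^ n).toNNReal : ℝ≥0∞) * ∫⁻ z in ball y ρ, ‖f z‖ₑ
        ≤ ((C / (2 ^ k * r) ^ n).toNNReal : ℝ≥0∞) * (A * volume (ball y ρ) *
            ((ν (ball y ρ))⁻¹ * ∫⁻ z in ball y ρ, ‖f z‖ₑ ∂ν)) := by gcongr
      _ = (((C / (2 ^ k * r) ^ n).toNNReal : ℝ≥0∞) * volume (ball y ρ)) * A *
            ((ν (ball y ρ))⁻¹ * ∫⁻ z in ball y ρ, ‖f z‖ₑ ∂ν) := by ring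
      _ = _ := by
        rw [h3]
        push_cast
        rw [ENNReal.coe_toNNReal measure_ball_lt_top.ne]

lemma measurable_setLIntegral_ball {ν : Measure (Rn n)} [SFinite ν] {F : Rn n → ℝ≥0∞}
    (hF : Measurable F) (r : ℝ) : Measurable fun y => ∫⁻ x in ball y r, F x ∂ν := by
  have hs : MeasurableSet {p : Rn n × Rn n | dist p.2 p.1 < r} :=
    measurableSet_lt (measurable_snd.dist measurable_fst) measurable_const
  have hm : Measurable ({p : Rn n × Rn n | dist p.2 p.1 < r}.indicator fun p => F p.2) :=
    (hF.comp measurable_snd).indicator hs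
  have e : (fun y => ∫⁻ x in ball y r, F x ∂ν) = fun y => ∫⁻ x,
      ({p : Rn n × Rn n | dist p.2 p.1 < r}.indicator fun p => F p.2) (y, x) ∂ν := by
    ext y
    rw [← lintegral_indicator measurableSet_ball]
    rfl
  rw [e]
  exact hm.lintegral_prod_right' (ν := ν)

/-- Minkowski for finite sums, then monotone convergence; for q = ∞ the termwise essential bounds
are summed. -/
lemma eLpNorm_tsum_le {μ : Measure (Rn n)} {q : ℝ≥0∞} (hq : 1 ≤ q) {g : ℕ → Rn n → ℝ≥0∞}
    (hg : ∀ k, AEMeasurable (g k) μ) :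
    eLpNorm (fun y => ∑' k, g k y) q μ ≤ ∑' k, eLpNorm (g k) q μ := by
  rcases eq_or_ne q ∞ with rfl | hqt
  · simp only [eLpNorm_exponent_top, eLpNormEssSup_eq_essSup_enorm, enorm_eq_self]
    refine essSup_le_of_ae_le _ ?_
    filter_upwards [ae_all_iff.2 fun k => ENNReal.ae_le_essSup (μ := μ) (g k)] with y hy
    exact ENNReal.tsum_le_tsum hy
  have hq0 : q ≠ 0 := (one_pos.trans_le hq).ne'
  have hqr : 0 < q.toReal := ENNReal.toReal_pos hq0 hqt
  have hpart : ∀ N : ℕ, eLpNorm (fun y => ∑ k ∈ Finset.range N, g k y) q μ ≤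
      ∑' k, eLpNorm (g k) q μ := by
    intro N
    have := eLpNorm_sum_le (s := Finset.range N) (fun k _ => (hg k).aestronglyMeasurable) hq
    refine le_trans (le_of_eq ?_) (this.trans (ENNReal.sum_le_tsum _))
    congr 1
    ext y
    rw [Finset.sum_apply]
  simp only [eLpNorm_eq_lintegral_rpow_enorm_toReal hq0 hqt, enorm_eq_self] at hpart ⊢
  rw [one_div, ENNReal.rpow_inv_le_iff hqr]
  have e : ∀ y, (∑' k, g k y) ^ q.toReal =
      ⨆ N : ℕ, (∑ k ∈ Finset.range N, g k y) ^ q.toReal := by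
    intro y
    rw [ENNReal.tsum_eq_iSup_nat]
    exact (ENNReal.monotone_rpow_of_nonneg hqr.le).map_iSup_of_continuousAt
      ENNReal.continuous_rpow_const.continuousAt (by simp [hqr])
  simp_rw [e]
  rw [lintegral_iSup']
  · refine iSup_le fun N => ?_
    have := hpart N
    rwa [one_div, ENNReal.rpow_inv_le_iff hqr] at this
  · exact fun N => (Finset.aemeasurable_fun_sum _ fun k _ => hg k).pow_const _
  · refine Eventually.of_forall fun y N N' h => ?_
    dsimp only
    gcongr

instance sFinite_wMeas (w : Rn n → ℝ) : SFinite (wMeas w) := by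
  unfold wMeas
  infer_instance

/-! ### Dilate sums in the amalgam norm -/

section DilateSum

variable {w μ : Rn n → ℝ} {A : ℝ≥0} {q α : ℝ≥0∞} {f : Rn n → ℂ}

/-- The exponent `1/α - 1/q`. -/
def gapExponent (q α : ℝ≥0∞) : ℝ := (α⁻¹).toReal - (q⁻¹).toReal

/-- Strictness matters: it makes the ratio η^(1/α-1/q) of the geometric series smaller than one. -/
lemma gapExponent_pos (hα : 1 ≤ α) (hαq : α < q) : 0 < gapExponent q α := by
  have h1 : q⁻¹ < α⁻¹ := ENNReal.inv_lt_inv.2 hαq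
  have h2 : α⁻¹ ≠ ∞ := ENNReal.inv_ne_top.2 (one_pos.trans_le hα).ne'
  exact sub_pos.2 ((ENNReal.toReal_lt_toReal (h1.trans_le le_top).ne h2).2 h1)

lemma ballFactor_one (q α : ℝ≥0∞) (w : Rn n → ℝ) (y : Rn n) (r : ℝ) :
    ballFactor 1 q α w y r = wMeas w (ball y r) ^ (gapExponent q α - 1) := by
  unfold ballFactor gapExponent
  congr 1
  rw [NNReal.coe_one]
  ring

lemma ballFactor_one_mul_measure (hν : IsA1Measure (wMeas w) A) (y : Rn n) {r : ℝ} (hr : 0 < r) :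
    ballFactor 1 q α w y r * wMeas w (ball y r) = wMeas w (ball y r) ^ gapExponent q α := by
  have h := ENNReal.rpow_add (gapExponent q α - 1) 1 (hν.pos y r hr) (hν.fin y r)
  rw [ENNReal.rpow_one, sub_add_cancel] at h
  rw [ballFactor_one, h]

lemma eLpNorm_indicator_ball (ν : Measure (Rn n)) (f : Rn n → ℂ) (y : Rn n) (r : ℝ) :
    eLpNorm ((ball y r).indicator f) ((1 : ℝ≥0) : ℝ≥0∞) ν = ∫⁻ x in ball y r, ‖f x‖ₑ ∂ν := by
  rw [ENNReal.coe_one, eLpNorm_one_eq_lintegral_enorm, ← lintegral_indicator measurableSet_ball]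
  simp_rw [enorm_indicator_eq_indicator_enorm]

lemma measure_ball_le_pow {ν : Measure (Rn n)} {η : ℝ≥0}
    (h : ∀ y r, 0 < r → ν (ball y r) ≤ η * ν (ball y (2 * r))) (y : Rn n) {r : ℝ} (hr : 0 < r)
    (k : ℕ) : ν (ball y r) ≤ η ^ k * ν (ball y (2 ^ k * r)) := by
  induction k with
  | zero => simp
  | succ k ih =>
    refine ih.trans ?_
    have := h y (2 ^ k * r) (by positivity)
    rw [pow_succ (η : ℝ≥0∞), mul_assoc, pow_succ', mul_assoc]
    gcongr

lemma measurable_measure_ball (ν : Measure (Rn n)) [SFinite ν] (r : ℝ) :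
    Measurable fun y => ν (ball y r) := by
  simpa using measurable_setLIntegral_ball (ν := ν) (F := fun _ => 1) measurable_const r

lemma lintegral_ball_enorm_mk {ν : Measure (Rn n)} (hν : ν ≪ volume) (hf : AEStronglyMeasurable f)
    (y : Rn n) (r : ℝ) : ∫⁻ x in ball y r, ‖f x‖ₑ ∂ν = ∫⁻ x in ball y r, ‖hf.mk f x‖ₑ ∂ν := by
  refine lintegral_congr_ae (ae_restrict_of_ae ?_)
  filter_upwards [hν.ae_le hf.ae_eq_mk] with x hx
  rw [hx]

lemma measurable_ballFactor_mul_eLpNorm (hν : wMeas w ≪ volume) (hf : AEStronglyMeasurable f)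
    (r : ℝ) : Measurable fun y =>
      ballFactor 1 q α w y r * eLpNorm ((ball y r).indicator f) ((1 : ℝ≥0) : ℝ≥0∞) (wMeas w) := by
  simp only [ballFactor_one, eLpNorm_indicator_ball, lintegral_ball_enorm_mk hν hf]
  exact ((measurable_measure_ball _ r).pow_const _).mul
    (measurable_setLIntegral_ball hf.stronglyMeasurable_mk.enorm r)

/-- Reverse doubling trades w(B)^s for η^(sk) w(2^(k+1)B)^s, which turns the k-th average into the
integrand of the amalgam norm at radius 2^(k+1)r. -/
lemma measure_rpow_mul_dilateSum_le (hν : IsA1Measure (wMeas w) A) (hα : 1 ≤ α) (hαq : α < q)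
    {η : ℝ≥0} (hη : ∀ y r, 0 < r → wMeas w (ball y r) ≤ η * wMeas w (ball y (2 * r)))
    (f : Rn n → ℂ) (y : Rn n) {r : ℝ} (hr : 0 < r) :
    wMeas w (ball y r) ^ gapExponent q α * dilateSum (wMeas w) f y r ≤
      ∑' k : ℕ, ((η : ℝ≥0∞) ^ gapExponent q α) ^ k *
        (ballFactor 1 q α w y (2 ^ (k + 1) * r) *
          eLpNorm ((ball y (2 ^ (k + 1) * r)).indicator f) ((1 : ℝ≥0) : ℝ≥0∞) (wMeas w)) := by
  have hs := gapExponent_pos hα hαq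
  unfold dilateSum
  rw [← ENNReal.tsum_mul_left]
  refine ENNReal.tsum_le_tsum fun k => ?_
  set ρ : ℝ := 2 ^ (k + 1) * r with hρ
  have hρ0 : 0 < ρ := by positivity
  rw [eLpNorm_indicator_ball, ballFactor_one, ENNReal.rpow_sub _ _ (hν.pos _ _ hρ0) (hν.fin _ _),
    ENNReal.rpow_one, div_eq_mul_inv, ← mul_assoc, ← mul_assoc, ← mul_assoc]
  gcongr ?_ * _ * _
  calc wMeas w (ball y r) ^ gapExponent q α
      ≤ (η ^ k * wMeas w (ball y (2 ^ k * r))) ^ gapExponent q α :=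
        ENNReal.rpow_le_rpow (measure_ball_le_pow hη y hr k) hs.le
    _ ≤ (η ^ k * wMeas w (ball y ρ)) ^ gapExponent q α := by
        refine ENNReal.rpow_le_rpow (mul_le_mul_right (measure_mono (ball_subset_ball ?_)) _) hs.le
        rw [hρ]
        gcongr
        · norm_num
        · exact k.le_succ
    _ = _ := by
        rw [ENNReal.mul_rpow_of_nonneg _ _ hs.le, ← ENNReal.rpow_natCast, ← ENNReal.rpow_natCast,
          ← ENNReal.rpow_mul, ← ENNReal.rpow_mul, mul_comm (k : ℝ)]

/-- Averages over all dyadic dilates are controlled in the amalgam norm. -/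
lemma exists_eLpNorm_dilateSum_le (hn : 0 < n) (hν : IsA1Measure (wMeas w) A) (hα : 1 ≤ α)
    (hαq : α < q) (μ : Rn n → ℝ) : ∃ C : ℝ≥0, ∀ f : Rn n → ℂ, AEStronglyMeasurable f → ∀ r : ℝ,
      0 < r → eLpNorm (fun y => wMeas w (ball y r) ^ gapExponent q α * dilateSum (wMeas w) f y r)
        q (wMeas μ) ≤ C * amalgamNorm 1 q α w μ f := by
  obtain ⟨η, hη1, hη⟩ := hν.exists_reverse_doubling hn
  have hs := gapExponent_pos hα hαq
  set ε : ℝ≥0 := η ^ gapExponent q α with hε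
  have hε1 : ε < 1 := NNReal.rpow_lt_one hη1 hs
  have hεc : (ε : ℝ≥0∞) = (η : ℝ≥0∞) ^ gapExponent q α := ENNReal.coe_rpow_of_nonneg _ hs.le
  have hq : 1 ≤ q := hα.trans hαq.le
  refine ⟨(1 - ε)⁻¹, fun f hf r hr => ?_⟩
  set Φ : ℕ → Rn n → ℝ≥0∞ := fun k y => ballFactor 1 q α w y (2 ^ (k + 1) * r) *
    eLpNorm ((ball y (2 ^ (k + 1) * r)).indicator f) ((1 : ℝ≥0) : ℝ≥0∞) (wMeas w) with hΦ
  have hΦm : ∀ k, Measurable (Φ k) := fun k => measurable_ballFactor_mul_eLpNorm hν.ac hf _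
  have hΦle : ∀ k, eLpNorm (Φ k) q (wMeas μ) ≤ amalgamNorm 1 q α w μ f := fun k =>
    le_iSup₂ (f := fun (ρ : ℝ) (_ : 0 < ρ) => eLpNorm (fun y => ballFactor 1 q α w y ρ *
      eLpNorm ((ball y ρ).indicator f) ((1 : ℝ≥0) : ℝ≥0∞) (wMeas w)) q (wMeas μ))
      (2 ^ (k + 1) * r) (by positivity)
  calc eLpNorm (fun y => wMeas w (ball y r) ^ gapExponent q α * dilateSum (wMeas w) f y r)
        q (wMeas μ)
      ≤ eLpNorm (fun y => ∑' k, (ε : ℝ≥0∞) ^ k * Φ k y) q (wMeas μ) := by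
        refine eLpNorm_mono_enorm fun y => ?_
        rw [enorm_eq_self, enorm_eq_self, hεc]
        exact measure_rpow_mul_dilateSum_le hν hα hαq hη f y hr
    _ ≤ ∑' k, eLpNorm (fun y => (ε : ℝ≥0∞) ^ k * Φ k y) q (wMeas μ) :=
        eLpNorm_tsum_le hq fun k => ((hΦm k).const_mul _).aemeasurable
    _ ≤ ∑' k, (ε : ℝ≥0∞) ^ k * amalgamNorm 1 q α w μ f := by
        refine ENNReal.tsum_le_tsum fun k => ?_
        refine (eLpNorm_le_mul_eLpNorm_of_ae_le_mul' (c := ε ^ k) (g := Φ k)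
          (Eventually.of_forall fun y => ?_) q).trans ?_
        · rw [enorm_eq_self, enorm_eq_self, ENNReal.coe_pow]
        · rw [ENNReal.coe_pow]
          exact mul_le_mul_right (hΦle k) _
    _ = _ := by
        rw [ENNReal.tsum_mul_right, ENNReal.tsum_geometric, ENNReal.coe_inv, ENNReal.coe_sub,
          ENNReal.coe_one]
        exact (tsub_pos_of_lt hε1).ne'

lemma absolutelyContinuous_wMeas (hμ : IsWeight μ) : (volume : Measure (Rn n)) ≪ wMeas μ :=
  withDensity_absolutelyContinuous'
    hμ.locallyIntegrable.aestronglyMeasurable.aemeasurable.ennreal_ofReal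
    (hμ.pos.mono fun x hx => by simpa using hx)

/-- The dyadic sums of a function of the amalgam space are finite. -/
lemma dilateSum_ne_top (hn : 0 < n) (hν : IsA1Measure (wMeas w) A) (hα : 1 ≤ α) (hαq : α < q)
    (hμ : IsWeight μ) (hf : MemAmalgam 1 q α w μ f) (y : Rn n) {r : ℝ} (hr : 0 < r) :
    dilateSum (wMeas w) f y r ≠ ∞ := by
  obtain ⟨C, hC⟩ := exists_eLpNorm_dilateSum_le hn hν hα hαq μ
  have hs := gapExponent_pos hα hαq
  have hfm := hf.1.aestronglyMeasurable
  have h2r : 0 < 2 * r := by positivity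
  have h1 := (hC f hfm (2 * r) h2r).trans_lt (ENNReal.mul_lt_top ENNReal.coe_lt_top hf.2)
  have hm : AEMeasurable (fun y => wMeas w (ball y (2 * r)) ^ gapExponent q α *
      dilateSum (wMeas w) f y (2 * r)) (wMeas μ) := by
    unfold dilateSum
    simp only [lintegral_ball_enorm_mk hν.ac hfm]
    exact (((measurable_measure_ball _ _).pow_const _).mul (Measurable.tsum fun k =>
      (measurable_measure_ball _ _).inv.mul
        (measurable_setLIntegral_ball hfm.stronglyMeasurable_mk.enorm _))).aemeasurable
  have hae : ∀ᵐ y ∂(wMeas μ), wMeas w (ball y (2 * r)) ^ gapExponent q α *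
      dilateSum (wMeas w) f y (2 * r) < ∞ := by
    rcases eq_or_ne q ∞ with hq | hq
    · nth_rewrite 2 [hq] at h1
      simp only [eLpNorm_exponent_top, eLpNormEssSup_eq_essSup_enorm, enorm_eq_self] at h1
      filter_upwards [ENNReal.ae_le_essSup (μ := wMeas μ) fun y =>
        wMeas w (ball y (2 * r)) ^ gapExponent q α * dilateSum (wMeas w) f y (2 * r)] with y hy
      exact hy.trans_lt h1
    · have hq0 : q ≠ 0 := (one_pos.trans_le (hα.trans hαq.le)).ne'
      have h2 := lintegral_rpow_enorm_lt_top_of_eLpNorm_lt_top hq0 hq h1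
      simp only [enorm_eq_self] at h2
      filter_upwards [ae_lt_top' (hm.pow_const _) h2.ne] with y hy
      exact (ENNReal.rpow_lt_top_iff_of_pos (ENNReal.toReal_pos hq0 hq)).1 hy
  have hball : volume.restrict (ball y r) ≠ 0 := by
    rw [Ne, Measure.restrict_eq_zero]
    exact (measure_ball_pos _ _ hr).ne'
  have : (ae (volume.restrict (ball y r))).NeBot := ae_neBot.2 hball
  -- Finiteness holds μ-almost everywhere, hence Lebesgue almost everywhere, so some z in B(y, r)
  -- has it. Radius 2r is used at z because moving the centre to y costs a factor 2.
  obtain ⟨z, hz, hzy⟩ := ((ae_restrict_of_ae ((absolutelyContinuous_wMeas hμ).ae_le hae)).and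
    (ae_restrict_mem measurableSet_ball)).exists (f := ae (volume.restrict (ball y r)))
  have h3 : dilateSum (wMeas w) f z (2 * r) ≠ ∞ := by
    intro h
    rw [h, ENNReal.mul_top] at hz
    · exact lt_irrefl _ hz
    · exact (ENNReal.rpow_pos (pos_iff_ne_zero.2 (hν.pos _ _ h2r)) (hν.fin _ _)).ne'
  refine ne_top_of_le_ne_top ?_ (dilateSum_le_of_mem_ball hν f hr hzy)
  finiteness

end DilateSum

section Values

variable {w : Rn n → ℝ} {A C C₁ : ℝ≥0} {L : L2 n →L[ℂ] L2 n} {K : Rn n → Rn n → ℂ}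
  {f : Rn n → ℂ}

/-! ### The integral away from a ball -/

lemma memLp_indicator_ball (hν : IsA1Measure (wMeas w) A) (hf : AEStronglyMeasurable f)
    (hfin : ∀ y r, 0 < r → dilateSum (wMeas w) f y r ≠ ∞) (y : Rn n) {r : ℝ} (hr : 0 < r) :
    MemLp ((ball y (2 * r)).indicator f) 1 (wMeas w) := by
  refine ⟨(hf.mono_ac hν.ac).indicator measurableSet_ball, ?_⟩
  have e := eLpNorm_indicator_ball (wMeas w) f y (2 * r)
  rw [ENNReal.coe_one] at e
  rw [e]
  refine (lintegral_ball_le_dilateSum hν f y hr).trans_lt (lt_top_iff_ne_top.2 ?_)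
  have := hfin y r hr
  have := hν.fin y r
  finiteness

lemma IsRegularCZO.integrableOn_far (hL : IsRegularCZO L K C) (hν : IsA1Measure (wMeas w) A)
    (hf : AEStronglyMeasurable f) {x y : Rn n} {r : ℝ}
    (hfin : dilateSum (wMeas w) f y r ≠ ∞) (hx : x ∈ ball y r) :
    IntegrableOn (fun z => K x z * f z) (ball y (2 * r))ᶜ := by
  refine ⟨(hL.measurable.of_uncurry_left.aestronglyMeasurable.mul hf).restrict, ?_⟩
  refine lt_of_le_of_lt (le_of_eq ?_) ((hL.lintegral_far_le hν f hx).trans_lt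
    (ENNReal.mul_lt_top ENNReal.coe_lt_top (lt_top_iff_ne_top.2 hfin)))
  simp_rw [enorm_mul]

lemma IsRegularCZO.enorm_integral_far_le (hL : IsRegularCZO L K C)
    (hν : IsA1Measure (wMeas w) A) (f : Rn n → ℂ) {x y : Rn n} {r : ℝ} (hx : x ∈ ball y r) :
    ‖∫ z in (ball y (2 * r))ᶜ, K x z * f z‖ₑ ≤
      (C * 4 ^ n * (volume (ball (0 : Rn n) 1)).toNNReal * A : ℝ≥0) *
        dilateSum (wMeas w) f y r := by
  refine (enorm_integral_le_lintegral_enorm _).trans ?_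
  simp_rw [enorm_mul]
  exact hL.lintegral_far_le hν f hx

lemma IsRegularCZO.aestronglyMeasurable_integral_far (hL : IsRegularCZO L K C)
    (hf : AEStronglyMeasurable f) (s : Set (Rn n)) :
    AEStronglyMeasurable fun x => ∫ z in s, K x z * f z := by
  have h1 : AEStronglyMeasurable (fun p : Rn n × Rn n => K p.1 p.2 * f p.2)
      (volume.prod (volume.restrict s)) :=
    hL.measurable.aestronglyMeasurable.mul (hf.restrict (s := s)).comp_snd
  exact h1.integral_prod_right'

/-! ### Existence, uniqueness and linearity of values -/

/-- The local definitions of the value on nested balls are consistent. -/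
lemma IsRegularCZO.local_value_eq (hL : IsRegularCZO L K C) (hν : IsA1Measure (wMeas w) A)
    (hf : AEStronglyMeasurable f) (hfin : ∀ y r, 0 < r → dilateSum (wMeas w) f y r ≠ ∞)
    {y y' : Rn n} {r r' : ℝ} (h2 : ball y (2 * r) ⊆ ball y' (2 * r'))
    {h h' : Rn n → ℂ} (hh : IsL1Value L w ((ball y (2 * r)).indicator f) h)
    (hh' : IsL1Value L w ((ball y' (2 * r')).indicator f) h') :
    ∀ᵐ x, x ∈ ball y r → h x + ∫ z in (ball y (2 * r))ᶜ, K x z * f z =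
      h' x + ∫ z in (ball y' (2 * r'))ᶜ, K x z * f z := by
  -- The difference h' - h is the image of f restricted to 2B' \ 2B. That function vanishes on B, so
  -- there the image is the kernel integral over exactly the region by which the far integrals
  -- differ.
  have hd := hh.smul_add hν (-1) hh'
  have hu : (-1 : ℂ) • (ball y (2 * r)).indicator f + (ball y' (2 * r')).indicator f =
      (ball y' (2 * r') \ ball y (2 * r)).indicator f := by
    rw [indicator_sdiff h2, neg_one_smul, neg_add_eq_sub]
  have hms : MeasurableSet (ball y' (2 * r') \ ball y (2 * r)) :=
    measurableSet_ball.diff measurableSet_ball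
  rw [hu] at hd
  have e : ∀ x, (fun z => K x z * (ball y' (2 * r') \ ball y (2 * r)).indicator f z) =
      (ball y' (2 * r') \ ball y (2 * r)).indicator fun z => K x z * f z := by
    intro x
    ext z
    by_cases hz : z ∈ ball y' (2 * r') \ ball y (2 * r)
    · rw [indicator_of_mem hz, indicator_of_mem hz]
    · rw [indicator_of_notMem hz, indicator_of_notMem hz, mul_zero]
  have hsub : ball y' (2 * r') \ ball y (2 * r) ⊆ (ball y (2 * r))ᶜ := fun z hz => hz.2
  have hint : ∀ x ∈ ball y r, IntegrableOn (fun z => K x z * f z) (ball y (2 * r))ᶜ :=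
    fun x hx => hL.integrableOn_far hν hf (hfin y r (pos_of_mem_ball hx)) hx
  have hrep := hd.repr hL hν isOpen_ball (U := ball y r) (Eventually.of_forall fun x hx => ?_)
    (Eventually.of_forall fun x hx => ?_)
  · filter_upwards [hrep] with x hx hxB
    have h3 := hx hxB
    rw [e, integral_indicator hms] at h3
    have h4 : (ball y (2 * r))ᶜ = (ball y' (2 * r') \ ball y (2 * r)) ∪ (ball y' (2 * r'))ᶜ := by
      refine Subset.antisymm (fun z hz => ?_) (union_subset hsub (compl_subset_compl.2 h2))
      by_cases hz' : z ∈ ball y' (2 * r')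
      · exact Or.inl ⟨hz', hz⟩
      · exact Or.inr hz'
    have h5 : Disjoint (ball y' (2 * r') \ ball y (2 * r)) (ball y' (2 * r'))ᶜ :=
      disjoint_left.2 fun z hz hz' => hz' hz.1
    have h6 := setIntegral_union h5 measurableSet_ball.compl ((hint x hxB).mono_set hsub)
      ((hint x hxB).mono_set (compl_subset_compl.2 h2))
    rw [← h4, ← h3] at h6
    rw [h6]
    simp only [Pi.add_apply, Pi.smul_apply, smul_eq_mul]
    ring
  · have : x ∈ ball y (2 * r) := by
      have h0 := pos_of_mem_ball hx
      exact ball_subset_ball (by linarith) hx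
    exact indicator_of_notMem (fun hx' => hx'.2 this) _
  · rw [e, integrable_indicator_iff hms]
    exact (hint x hx).mono_set hsub

lemma ae_of_forall_ball {p : Rn n → Prop}
    (h : ∀ j : ℕ, ∀ᵐ x, x ∈ ball (0 : Rn n) (j + 1) → p x) : ∀ᵐ x, p x := by
  filter_upwards [ae_all_iff.2 h] with x hx
  obtain ⟨j, hj⟩ := exists_nat_gt ‖x‖
  exact hx j (by rw [mem_ball_zero_iff]; linarith)

lemma aestronglyMeasurable_of_forall_ball {g : Rn n → ℂ} {G : ℕ → Rn n → ℂ}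
    (hG : ∀ j, AEStronglyMeasurable (G j))
    (h : ∀ j : ℕ, ∀ᵐ x, x ∈ ball (0 : Rn n) (j + 1) → g x = G j x) : AEStronglyMeasurable g := by
  have hU : ⋃ j : ℕ, ball (0 : Rn n) (j + 1) = univ := by
    refine eq_univ_of_forall fun x => mem_iUnion.2 ?_
    obtain ⟨j, hj⟩ := exists_nat_gt ‖x‖
    exact ⟨j, by rw [mem_ball_zero_iff]; linarith⟩
  rw [← Measure.restrict_univ (μ := volume), ← hU, aestronglyMeasurable_iUnion_iff]
  intro j
  refine (hG j).restrict.congr ?_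
  filter_upwards [(ae_restrict_iff' measurableSet_ball).2 (h j)] with x hx
  exact hx.symm

lemma exists_isValue (hL : IsRegularCZO L K C) (hν : IsA1Measure (wMeas w) A)
    (hW : ∀ (φ : L2 n) (t : ℝ≥0),
      t * wMeas w {x | (t : ℝ≥0∞) < ‖L φ x‖ₑ} ≤ C₁ * ∫⁻ x, ‖φ x‖ₑ ∂(wMeas w))
    (hf : AEStronglyMeasurable f) (hfin : ∀ y r, 0 < r → dilateSum (wMeas w) f y r ≠ ∞) :
    ∃ g, IsValue L K w f g := by
  have hj0 : ∀ j : ℕ, (0 : ℝ) < j + 1 := fun j => by positivity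
  choose h hh using fun j : ℕ =>
    exists_isL1Value hν hW (memLp_indicator_ball hν hf hfin 0 (hj0 j))
  set G : ℕ → Rn n → ℂ := fun j x =>
    h j x + ∫ z in (ball (0 : Rn n) (2 * (j + 1)))ᶜ, K x z * f z with hG
  have hGm : ∀ j, AEStronglyMeasurable (G j) := fun j =>
    (hh j).measurable.add (hL.aestronglyMeasurable_integral_far hf _)
  have hcons : ∀ i j : ℕ, ∀ᵐ x, i ≤ j → x ∈ ball (0 : Rn n) (i + 1) → G i x = G j x := by
    intro i j
    by_cases hij : i ≤ j
    · have hij' : (i : ℝ) ≤ j := by exact_mod_cast hij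
      filter_upwards [hL.local_value_eq hν hf hfin
        (ball_subset_ball (by linarith)) (hh i) (hh j)] with x hx _ hxi
      exact hx hxi
    · exact Eventually.of_forall fun x h => absurd h hij
  -- Each x uses the first ball B(0, j+1) containing it; consistency makes g agree almost everywhere
  -- with every G_j on its ball.
  set g : Rn n → ℂ := fun x => G ⌊‖x‖⌋₊ x with hg
  have hgG : ∀ j : ℕ, ∀ᵐ x, x ∈ ball (0 : Rn n) (j + 1) → g x = G j x := by
    intro j
    filter_upwards [ae_all_iff.2 fun i => hcons i j] with x hx hxj
    rw [mem_ball_zero_iff] at hxj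
    refine hx _ ?_ ?_
    · have : ⌊‖x‖⌋₊ < j + 1 := (Nat.floor_lt (norm_nonneg x)).2 (by exact_mod_cast hxj)
      omega
    · rw [mem_ball_zero_iff]
      exact Nat.lt_floor_add_one _
  refine ⟨g, aestronglyMeasurable_of_forall_ball hGm hgG, fun y r hr => ?_⟩
  obtain ⟨h', hh'⟩ := exists_isL1Value hν hW (memLp_indicator_ball hν hf hfin y hr)
  refine ⟨h', hh', (ae_restrict_iff' measurableSet_ball).2 ?_⟩
  obtain ⟨j, hj⟩ := exists_nat_gt (‖y‖ + r)
  have hy : dist y 0 = ‖y‖ := dist_zero_right y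
  have hsub : ball y r ⊆ ball (0 : Rn n) (j + 1) := ball_subset_ball' (by rw [hy]; linarith)
  have hsub2 : ball y (2 * r) ⊆ ball (0 : Rn n) (2 * (j + 1)) :=
    ball_subset_ball' (by rw [hy]; linarith [norm_nonneg y])
  filter_upwards [hL.local_value_eq hν hf hfin hsub2 hh' (hh j), hgG j] with x h1 h2 hx
  exact ⟨hL.integrableOn_far hν hf (hfin y r hr) hx, (h2 (hsub hx)).trans (h1 hx).symm⟩

lemma IsValue.ae_eq (hν : IsA1Measure (wMeas w) A) {g g' : Rn n → ℂ}
    (hg : IsValue L K w f g) (hg' : IsValue L K w f g') : g =ᵐ[volume] g' := by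
  refine ae_of_forall_ball fun j => ?_
  have hj : (0 : ℝ) < j + 1 := by positivity
  obtain ⟨h, hh, hx⟩ := hg.onBall 0 _ hj
  obtain ⟨h', hh', hx'⟩ := hg'.onBall 0 _ hj
  filter_upwards [hh.ae_eq hν hh', (ae_restrict_iff' measurableSet_ball).1 hx,
    (ae_restrict_iff' measurableSet_ball).1 hx'] with x h1 h2 h3 hxB
  rw [(h2 hxB).2, (h3 hxB).2, h1]

lemma IsValue.smul_add (hν : IsA1Measure (wMeas w) A) {f₁ f₂ g₁ g₂ : Rn n → ℂ} (c : ℂ)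
    (hg₁ : IsValue L K w f₁ g₁) (hg₂ : IsValue L K w f₂ g₂) :
    IsValue L K w (c • f₁ + f₂) (c • g₁ + g₂) := by
  refine ⟨(hg₁.measurable.const_smul c).add hg₂.measurable, fun y r hr => ?_⟩
  obtain ⟨h₁, hh₁, hx₁⟩ := hg₁.onBall y r hr
  obtain ⟨h₂, hh₂, hx₂⟩ := hg₂.onBall y r hr
  refine ⟨c • h₁ + h₂, ?_, ?_⟩
  · have e : (ball y (2 * r)).indicator (c • f₁) = c • (ball y (2 * r)).indicator f₁ :=
      indicator_const_smul _ c f₁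
    rw [indicator_add', e]
    exact hh₁.smul_add hν c hh₂
  · filter_upwards [hx₁, hx₂] with x h1 h2
    have e : (fun z => K x z * (c • f₁ + f₂) z) =
        fun z => c * (K x z * f₁ z) + K x z * f₂ z := by
      ext z
      simp only [Pi.add_apply, Pi.smul_apply, smul_eq_mul]
      ring
    rw [e]
    refine ⟨(h1.1.const_mul c).add h2.1, ?_⟩
    rw [integral_add (h1.1.const_mul c) h2.1, integral_const_mul]
    simp only [Pi.add_apply, Pi.smul_apply, smul_eq_mul, h1.2, h2.2]
    ring

/-- Split φ at 2B: the image of the inner piece is its L¹_w value, and the outer piece vanishes on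
2B, so its image there is the far integral. -/
lemma isValue_L2 (hL : IsRegularCZO L K C) (hν : IsA1Measure (wMeas w) A)
    (hW : ∀ (φ : L2 n) (t : ℝ≥0),
      t * wMeas w {x | (t : ℝ≥0∞) < ‖L φ x‖ₑ} ≤ C₁ * ∫⁻ x, ‖φ x‖ₑ ∂(wMeas w))
    (φ : L2 n) (hfin : ∀ y r, 0 < r → dilateSum (wMeas w) φ y r ≠ ∞) :
    IsValue L K w φ (L φ) := by
  have hφ := (Lp.stronglyMeasurable φ).aestronglyMeasurable (μ := volume)
  refine ⟨(Lp.stronglyMeasurable _).aestronglyMeasurable, fun y r hr => ?_⟩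
  set B : Set (Rn n) := ball y (2 * r) with hB
  have hBm : MeasurableSet B := measurableSet_ball
  refine ⟨L (cut B hBm φ), isL1Value_of_L2 hν hW _ (coeFn_cut B hBm φ)
    (memLp_indicator_ball hν hφ hfin y hr), (ae_restrict_iff' measurableSet_ball).2 ?_⟩
  have hsum : φ = cut B hBm φ + cut Bᶜ hBm.compl φ := by
    refine Lp.ext ?_
    filter_upwards [Lp.coeFn_add (cut B hBm φ) (cut Bᶜ hBm.compl φ), coeFn_cut B hBm φ,
      coeFn_cut Bᶜ hBm.compl φ] with x h1 h2 h3
    rw [h1, Pi.add_apply, h2, h3]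
    exact (congrFun (indicator_self_add_compl B φ) x).symm
  have hLsum : L φ = L (cut B hBm φ) + L (cut Bᶜ hBm.compl φ) := by
    rw [← map_add, ← hsum]
  have hrep := hL.repr (cut Bᶜ hBm.compl φ) B isOpen_ball (by
    filter_upwards [coeFn_cut Bᶜ hBm.compl φ] with x hx hxB
    rw [hx]
    exact indicator_of_notMem (not_not.2 hxB) _)
  have hcoe := Lp.coeFn_add (L (cut B hBm φ)) (L (cut Bᶜ hBm.compl φ))
  rw [← hLsum] at hcoe
  filter_upwards [hrep, hcoe] with x h1 h2 hx
  refine ⟨hL.integrableOn_far hν hφ (hfin y r hr) hx, ?_⟩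
  have hxB : x ∈ B := ball_subset_ball (by linarith) hx
  rw [h2, Pi.add_apply, h1 hxB, ← integral_indicator hBm.compl]
  congr 1
  refine integral_congr_ae ?_
  filter_upwards [coeFn_cut Bᶜ hBm.compl φ] with z hz
  rw [hz]
  by_cases hzB : z ∈ Bᶜ
  · rw [indicator_of_mem hzB, indicator_of_mem hzB]
  · rw [indicator_of_notMem hzB, indicator_of_notMem hzB, mul_zero]

/-! ### The weak type bound -/

lemma IsValue.weakNorm_ball_le (hL : IsRegularCZO L K C) (hν : IsA1Measure (wMeas w) A)
    (hW : ∀ (φ : L2 n) (t : ℝ≥0),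
      t * wMeas w {x | (t : ℝ≥0∞) < ‖L φ x‖ₑ} ≤ C₁ * ∫⁻ x, ‖φ x‖ₑ ∂(wMeas w))
    {g : Rn n → ℂ} (hg : IsValue L K w f g) (y : Rn n) {r : ℝ} (hr : 0 < r) :
    weakNorm 1 (wMeas w) ((ball y r).indicator g) ≤
      (2 * (C₁ * (A * 2 ^ n) + C * 4 ^ n * (volume (ball (0 : Rn n) 1)).toNNReal * A) : ℝ≥0) *
        (wMeas w (ball y r) * dilateSum (wMeas w) f y r) := by
  obtain ⟨h, hh, hx⟩ := hg.onBall y r hr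
  set D : ℝ≥0 := C * 4 ^ n * (volume (ball (0 : Rn n) 1)).toNNReal * A with hD
  set I : Rn n → ℂ := (ball y r).indicator fun x => ∫ z in (ball y (2 * r))ᶜ, K x z * f z with hI
  have h1 : (ball y r).indicator g =ᵐ[wMeas w] fun x => (ball y r).indicator h x + I x := by
    filter_upwards [hν.ac.ae_le ((ae_restrict_iff' measurableSet_ball).1 hx)] with x hx
    by_cases hxB : x ∈ ball y r
    · simp only [hI, indicator_of_mem hxB]
      exact (hx hxB).2
    · simp only [hI, indicator_of_notMem hxB, add_zero]
  have h2 : weakNorm 1 (wMeas w) ((ball y r).indicator h) ≤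
      C₁ * (A * 2 ^ n) * (wMeas w (ball y r) * dilateSum (wMeas w) f y r) := by
    calc weakNorm 1 (wMeas w) ((ball y r).indicator h)
        ≤ weakNorm 1 (wMeas w) h := weakNorm_one_mono (Eventually.of_forall fun x => by
          rw [enorm_indicator_eq_indicator_enorm]
          exact indicator_le_self _ _ _)
      _ ≤ C₁ * ∫⁻ x, ‖(ball y (2 * r)).indicator f x‖ₑ ∂(wMeas w) := hh.weakNorm_le hν hW
      _ = C₁ * ∫⁻ x in ball y (2 * r), ‖f x‖ₑ ∂(wMeas w) := by
          rw [← eLpNorm_one_eq_lintegral_enorm, ← ENNReal.coe_one, eLpNorm_indicator_ball]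
      _ ≤ C₁ * (A * 2 ^ n * wMeas w (ball y r) * dilateSum (wMeas w) f y r) :=
          mul_le_mul_right (lintegral_ball_le_dilateSum hν f y hr) _
      _ = _ := by ring
  -- The far integral is bounded uniformly on B, and a function bounded by M and supported in B has
  -- weak norm at most M·w(B).
  have h3 : weakNorm 1 (wMeas w) I ≤ D * (wMeas w (ball y r) * dilateSum (wMeas w) f y r) := by
    refine (weakNorm_one_le_of_bound (s := ball y r) (M := D * dilateSum (wMeas w) f y r)
      (Eventually.of_forall fun x => ?_)).trans_eq (by ring)
    rw [hI, enorm_indicator_eq_indicator_enorm]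
    by_cases hxB : x ∈ ball y r
    · rw [indicator_of_mem hxB, indicator_of_mem hxB]
      exact hL.enorm_integral_far_le hν f hxB
    · rw [indicator_of_notMem hxB, indicator_of_notMem hxB]
  rw [weakNorm_one_congr h1]
  calc _ ≤ 2 * (weakNorm 1 (wMeas w) ((ball y r).indicator h) + weakNorm 1 (wMeas w) I) :=
        weakNorm_one_add_le _ _ _
    _ ≤ 2 * (C₁ * (A * 2 ^ n) * (wMeas w (ball y r) * dilateSum (wMeas w) f y r) +
          D * (wMeas w (ball y r) * dilateSum (wMeas w) f y r)) := by gcongr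
    _ = _ := by
      push_cast
      ring

lemma exists_weakAmalgamNorm_le (hn : 0 < n) (hL : IsRegularCZO L K C)
    (hν : IsA1Measure (wMeas w) A)
    (hW : ∀ (φ : L2 n) (t : ℝ≥0),
      t * wMeas w {x | (t : ℝ≥0∞) < ‖L φ x‖ₑ} ≤ C₁ * ∫⁻ x, ‖φ x‖ₑ ∂(wMeas w))
    {q α : ℝ≥0∞} (hα : 1 ≤ α) (hαq : α < q) (μ : Rn n → ℝ) :
    ∃ D : ℝ≥0, ∀ f g : Rn n → ℂ, AEStronglyMeasurable f → IsValue L K w f g →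
      weakAmalgamNorm 1 q α w μ g ≤ D * amalgamNorm 1 q α w μ f := by
  obtain ⟨D₁, hD₁⟩ := exists_eLpNorm_dilateSum_le hn hν hα hαq μ
  set D₂ : ℝ≥0 := 2 * (C₁ * (A * 2 ^ n) +
    C * 4 ^ n * (volume (ball (0 : Rn n) 1)).toNNReal * A) with hD₂
  refine ⟨D₂ * D₁, fun f g hf hg => iSup₂_le fun r hr => ?_⟩
  refine (eLpNorm_le_mul_eLpNorm_of_ae_le_mul' (c := D₂)
    (g := fun y => wMeas w (ball y r) ^ gapExponent q α * dilateSum (wMeas w) f y r)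
    (Eventually.of_forall fun y => ?_) q).trans ?_
  · rw [enorm_eq_self, enorm_eq_self, ← ballFactor_one_mul_measure hν y hr]
    refine (mul_le_mul_right (hg.weakNorm_ball_le hL hν hW y hr) _).trans_eq ?_
    rw [← hD₂]
    ring
  · rw [ENNReal.coe_mul D₂, mul_assoc (D₂ : ℝ≥0∞)]
    exact mul_le_mul_right (hD₁ f hf r hr) _

/-! ### Changing the kernel on the diagonal -/

/-- For each x the kernels differ only at the single point z = x, a null set because n ≥ 1. -/
lemma isValue_offDiag_iff (hn : 0 < n) {g : Rn n → ℂ} :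
    IsValue L (offDiag K) w f g ↔ IsValue L K w f g := by
  have e1 : ∀ (x : Rn n) (s : Set (Rn n)), (fun z => offDiag K x z * f z) =ᵐ[volume.restrict s]
      fun z => K x z * f z := fun x s => by
    filter_upwards [ae_restrict_of_ae (ae_offDiag_eq hn K x)] with z hz
    rw [hz]
  have e2 : ∀ (x : Rn n) (s : Set (Rn n)), IntegrableOn (fun z => offDiag K x z * f z) s ↔
      IntegrableOn (fun z => K x z * f z) s := fun x s => integrable_congr (e1 x s)
  have e3 : ∀ (x : Rn n) (s : Set (Rn n)), ∫ z in s, offDiag K x z * f z =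
      ∫ z in s, K x z * f z := fun x s => integral_congr_ae (e1 x s)
  refine ⟨fun h => ⟨h.measurable, ?_⟩, fun h => ⟨h.measurable, ?_⟩⟩
  · simpa only [e2, e3] using h.onBall
  · simpa only [e2, e3] using h.onBall

end Values

end Amalgam

end

/-! ### The boundedness theorem -/

theorem theorem2p2 (n : ℕ) (hn : 0 < n) (θ : ℝ → ℝ)
    (T : 𝓢(Amalgam.Rn n, ℂ) →ₗ[ℂ] 𝓢'(Amalgam.Rn n, ℂ))
    (L : Amalgam.L2 n →L[ℂ] Amalgam.L2 n)
    (K : Amalgam.Rn n → Amalgam.Rn n → ℂ)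
    (hT : Amalgam.IsThetaCZO θ T L K)
    (q α : ℝ≥0∞) (hα : 1 ≤ α) (hαq : α < q)
    (w μ : Amalgam.Rn n → ℝ) (hw : Amalgam.IsA1 w) (hμ : Amalgam.IsDoubling μ) :
    -- the extended operator is defined on the whole space, single-valued and bounded
    (∃ C : ℝ≥0, ∀ f : Amalgam.Rn n → ℂ, Amalgam.MemAmalgam 1 q α w μ f →
      ∃ g : Amalgam.Rn n → ℂ,
        Amalgam.IsValue L K w f g ∧
        (∀ g' : Amalgam.Rn n → ℂ, Amalgam.IsValue L K w f g' → g' =ᵐ[volume] g) ∧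
        Amalgam.MemWeakAmalgam 1 q α w μ g ∧
        Amalgam.weakAmalgamNorm 1 q α w μ g ≤ C * Amalgam.amalgamNorm 1 q α w μ f) ∧
    -- it is linear
    (∀ (c : ℂ) (f₁ f₂ g₁ g₂ : Amalgam.Rn n → ℂ),
      Amalgam.MemAmalgam 1 q α w μ f₁ → Amalgam.MemAmalgam 1 q α w μ f₂ →
      Amalgam.IsValue L K w f₁ g₁ → Amalgam.IsValue L K w f₂ g₂ →
      Amalgam.IsValue L K w (c • f₁ + f₂) (c • g₁ + g₂)) ∧
    -- it agrees with the given operator on square integrable functions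
    (∀ φ : Amalgam.L2 n, Amalgam.MemAmalgam 1 q α w μ φ →
      Amalgam.IsValue L K w φ (L φ)) := by
  obtain ⟨C, hL⟩ := hT.exists_isRegularCZO hn
  obtain ⟨A, hν⟩ := hw.exists_isA1Measure
  obtain ⟨C₁, hW⟩ := hL.exists_weighted_weak_type hn hν
  have hfin : ∀ f : Amalgam.Rn n → ℂ, Amalgam.MemAmalgam 1 q α w μ f →
      ∀ y r, 0 < r → Amalgam.dilateSum (Amalgam.wMeas w) f y r ≠ ∞ := fun f hf y r hr =>
    Amalgam.dilateSum_ne_top hn hν hα hαq hμ.1 hf y hr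
  refine ⟨?_, fun c f₁ f₂ g₁ g₂ _ _ h₁ h₂ => h₁.smul_add hν c h₂, fun φ hφ =>
    (Amalgam.isValue_offDiag_iff hn).1 (Amalgam.isValue_L2 hL hν hW φ (hfin φ hφ))⟩
  obtain ⟨D, hD⟩ := Amalgam.exists_weakAmalgamNorm_le hn hL hν hW hα hαq μ
  refine ⟨D, fun f hf => ?_⟩
  have hfm := hf.1.aestronglyMeasurable
  obtain ⟨g, hg⟩ := Amalgam.exists_isValue hL hν hW hfm (hfin f hf)
  have hg' := (Amalgam.isValue_offDiag_iff hn).1 hg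
  have hle := hD f g hfm hg
  exact ⟨g, hg', fun g' h' => h'.ae_eq hν hg',
    ⟨hg.measurable, hle.trans_lt (ENNReal.mul_lt_top ENNReal.coe_lt_top hf.2)⟩, hle⟩
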